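/- Let $n\ge 2$. A cornered space $(X,M,Q)$ is a smooth $(n+1)$-manifold $X$ with corners of codimension at most two, whose boundary is $M\cup Q$, where $M,Q$ are embedded hypersurfaces with common boundary $S=M\cap Q\neq\emptyset$, and $S$ is the codimension-two corner of $X$ (compactness is not required). A smooth cornered asymptotically hyperbolic (CAH) metric is a smooth Riemannian metric $g$ on $X\setminus M$ such that for every smooth defining function $\varphi$ of $M$ the metric $\varphi^2g$ extends to a smooth metric on $X$, with $|d\varphi|_{\varphi^2 g}=1$ along $M$. **Proposition.** Let $(X,M,Q)$ be a cornered space and let $g$ be a smooth CAH metric with $\mathrm{Ric}(g)=-n\,g$ on $X\setminus M$. Suppose that $K_Q=\lambda\, g|_{TQ}$ on $Q\setminus S$ for some $\lambda\in\mathbb{R}$, where $K_Q(U,V)=\langle\nabla_UV,\nu_Q\rangle$ is the second fundamental form of $Q$ with respect to the inward-pointing unit normal $\nu_Q$. (a) Let $r$ be a geodesic defining function for $M$, that is, a smooth defining function such that, for the smooth metric $\bar g=r^2g$ on $X$, one has $|dr|_{\bar g}=1$ on a neighborhood of $M$. Put $h=\bar g|_{TM}$. Let $\bar\nu_M$ be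 the $X$-inward $\bar g$-unit normal to $M$, $\bar\nu_S$ the $M$-inward $h$-unit normal to $S$ in $M$, $\bar K_S$ the second fundamental form of $S$ in $(M,h)$ with respect to $\bar\nu_S$, and $\bar R$ the curvature tensor of $\bar g$, $\bar R(U,V,W,Y)=\bar g(\bar\nabla_U\bar\nabla_VW-\bar\nabla_V\bar\nabla_UW-\bar\nabla_{[U,V]}W,\,Y)$. Then there is a function $\eta\in C^\infty(S)$ with $\bar K_S=\eta\, h|_{TS}$, and $$Z(\eta)=-\bar R(\bar\nu_M,Z,\bar\nu_M,\bar\nu_S)\qquad\text{for all } Z\in TS.$$ (b) In particular, let $n=2$, and suppose that $X$ is smoothly embedded in the closed upper half-space $\{x_0\ge0\}\subset\mathbb{R}^3$ in such a way that $M=X\cap\{x_0=0\}$, that $g$ is the restriction of the hyperbolic metric $x_0^{-2}(dx_0^2+dx_1^2+dx_2^2)$, and that $S$ is closed in $\mathbb{R}^3$ (for example compact). Then every connected component of $S$ is a circle or a straight line in the plane $\{x_0=0\}$. -/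

import Mathlib

open Set Filter Topology Manifold Bundle
open scoped ContDiff

noncomputable section

/-! ## The model with corners `[0,∞) × [0,∞) × ℝ^m`

Throughout, `m = dim S`, `n = m + 1 = dim M = dim Q` and `n + 1 = m + 2 = dim X`. -/

/-- The model space of an `(m+2)`-manifold with corners of codimension at most two. -/
def CornerSpace (m : ℕ) : Type :=
  { x : EuclideanSpace ℝ (Fin (m + 2)) // 0 ≤ x 0 ∧ 0 ≤ x 1 }

instance (m : ℕ) : TopologicalSpace (CornerSpace m) :=
  inferInstanceAs (TopologicalSpace { x : EuclideanSpace ℝ (Fin (m + 2)) // 0 ≤ x 0 ∧ 0 ≤ x 1 })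

theorem range_cornerSpace (m : ℕ) :
    range (fun x : CornerSpace m => x.1) =
      { x | 0 ≤ x 0 ∧ 0 ≤ x 1 } :=
  Subtype.range_val

/-- The inclusion of the corner model space in `ℝ^(m+2)`, as a model with corners. -/
def cornerModel (m : ℕ) :
    ModelWithCorners ℝ (EuclideanSpace ℝ (Fin (m + 2))) (CornerSpace m) where
  toFun := fun x => x.1
  invFun x := ⟨WithLp.toLp 2 (Function.update (Function.update (fun i => x i) 0 (max (x 0) 0))
    1 (max (x 1) 0)), by simp⟩
  source := univ
  target := { x | 0 ≤ x 0 ∧ 0 ≤ x 1 }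
  map_source' x _ := x.property
  map_target' _ _ := mem_univ _
  left_inv' := by
    rintro ⟨x, h0, h1⟩ _
    apply Subtype.ext
    ext i
    by_cases hi1 : i = 1
    · subst hi1; simp [h1]
    · by_cases hi0 : i = 0
      · subst hi0; simp [h0]
      · simp [Function.update_of_ne hi1, Function.update_of_ne hi0]
  right_inv' := by
    rintro x ⟨h0, h1⟩
    ext i
    by_cases hi1 : i = 1
    · subst hi1; simp [h1]
    · by_cases hi0 : i = 0
      · subst hi0; simp [h0]
      · simp [Function.update_of_ne hi1, Function.update_of_ne hi0]
  source_eq := rfl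
  convex_range' := by
    simp only [instIsRCLikeNormedField, ↓reduceDIte]
    apply Convex.convex_isRCLikeNormedField
    rw [show range (fun x : CornerSpace m => x.1) = _ from range_cornerSpace m]
    intro x hx y hy a b ha hb _
    obtain ⟨hx0, hx1⟩ := hx
    obtain ⟨hy0, hy1⟩ := hy
    constructor
    · simp only [PiLp.add_apply, PiLp.smul_apply, smul_eq_mul]; positivity
    · simp only [PiLp.add_apply, PiLp.smul_apply, smul_eq_mul]; positivity
  nonempty_interior' := by
    rw [range_cornerSpace]
    refine ⟨WithLp.toLp 2 fun _ => 1, ?_⟩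
    rw [mem_interior_iff_mem_nhds]
    have c0 : Continuous fun x : EuclideanSpace ℝ (Fin (m + 2)) => x 0 := by fun_prop
    have c1 : Continuous fun x : EuclideanSpace ℝ (Fin (m + 2)) => x 1 := by fun_prop
    have h : {x : EuclideanSpace ℝ (Fin (m + 2)) | 0 < x 0 ∧ 0 < x 1} ∈
        𝓝 (WithLp.toLp 2 fun _ => (1 : ℝ)) :=
      ((isOpen_lt continuous_const c0).inter (isOpen_lt continuous_const c1)).mem_nhds
        (by simp)
    exact Filter.mem_of_superset h fun x hx => ⟨hx.1.le, hx.2.le⟩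
  continuous_toFun := continuous_subtype_val
  continuous_invFun := by
    refine Continuous.subtype_mk ((PiLp.continuous_toLp 2 _).comp ?_) _
    refine Continuous.update (Continuous.update (by fun_prop) 0 ?_) 1 ?_
    · exact (PiLp.continuous_apply 2 _ 0).max continuous_const
    · exact (PiLp.continuous_apply 2 _ 1).max continuous_const

/-! ## Riemannian geometry in coordinates

A metric in coordinates is a matrix-valued function on a subset `s` of Euclidean space. All
derivatives are taken within `s`, so that they make sense up to the boundary of `s`. -/

section Coordinates

variable {k : ℕ}

/-- The partial derivative `∂_i f` within `s`. -/
def partialDeriv (s : Set (EuclideanSpace ℝ (Fin k))) (i : Fin k)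
    (f : EuclideanSpace ℝ (Fin k) → ℝ) (y : EuclideanSpace ℝ (Fin k)) : ℝ :=
  fderivWithin ℝ f s y (EuclideanSpace.single i 1)

/-- The Christoffel symbol `Γ^l_{ij}` of the Levi-Civita connection of the metric `G`, that is
`∇_{∂_i} ∂_j = ∑ l, Γ^l_{ij} ∂_l`. -/
def christoffel (s : Set (EuclideanSpace ℝ (Fin k)))
    (G : EuclideanSpace ℝ (Fin k) → Matrix (Fin k) (Fin k) ℝ) (l i j : Fin k)
    (y : EuclideanSpace ℝ (Fin k)) : ℝ :=
  (1 / 2) * ∑ a, (G y)⁻¹ l a *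
    (partialDeriv s i (fun x => G x j a) y + partialDeriv s j (fun x => G x i a) y
      - partialDeriv s a (fun x => G x i j) y)

/-- The components of the curvature endomorphism:
`∇_{∂_i} ∇_{∂_j} ∂_c - ∇_{∂_j} ∇_{∂_i} ∂_c = ∑ l, (curvatureEndo s G l c i j) ∂_l`. -/
def curvatureEndo (s : Set (EuclideanSpace ℝ (Fin k)))
    (G : EuclideanSpace ℝ (Fin k) → Matrix (Fin k) (Fin k) ℝ) (l c i j : Fin k)
    (y : EuclideanSpace ℝ (Fin k)) : ℝ :=
  partialDeriv s i (christoffel s G l j c) y - partialDeriv s j (christoffel s G l i c) y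
    + ∑ a, (christoffel s G l i a y * christoffel s G a j c y
      - christoffel s G l j a y * christoffel s G a i c y)

/-- The Ricci tensor `Ric(∂_j, ∂_c)`, the trace of `U ↦ R(U, ∂_j) ∂_c`. -/
def ricci (s : Set (EuclideanSpace ℝ (Fin k)))
    (G : EuclideanSpace ℝ (Fin k) → Matrix (Fin k) (Fin k) ℝ) (j c : Fin k)
    (y : EuclideanSpace ℝ (Fin k)) : ℝ :=
  ∑ i, curvatureEndo s G i c i j y

/-- The `(0,4)` curvature tensor `R(u, v, w, z) = ⟨R(u, v) w, z⟩` at `y`, where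
`R(U, V) W = ∇_U ∇_V W - ∇_V ∇_U W - ∇_{[U, V]} W`, on vectors given by components. -/
def curvature (s : Set (EuclideanSpace ℝ (Fin k)))
    (G : EuclideanSpace ℝ (Fin k) → Matrix (Fin k) (Fin k) ℝ)
    (y : EuclideanSpace ℝ (Fin k)) (u v w z : Fin k → ℝ) : ℝ :=
  ∑ i, ∑ j, ∑ c, ∑ l, ∑ a, G y a l * curvatureEndo s G a c i j y * u i * v j * w c * z l

/-- The unit normal vector (by components) of the face `{x_f = 0}`, pointing into `{x_f > 0}`:
the normalized gradient of `x_f`. -/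
def inwardNormal (G : EuclideanSpace ℝ (Fin k) → Matrix (Fin k) (Fin k) ℝ) (f : Fin k)
    (y : EuclideanSpace ℝ (Fin k)) (i : Fin k) : ℝ :=
  (G y)⁻¹ i f / √((G y)⁻¹ f f)

/-- The scalar second fundamental form `K(∂_i, ∂_j) = ⟨∇_{∂_i} ∂_j, ν⟩` of the face `{x_f = 0}`
with respect to its inward unit normal `ν`, for `i, j ≠ f` (so that `∂_i, ∂_j` are tangent). -/
def secondFundamentalForm (s : Set (EuclideanSpace ℝ (Fin k)))
    (G : EuclideanSpace ℝ (Fin k) → Matrix (Fin k) (Fin k) ℝ) (f : Fin k)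
    (y : EuclideanSpace ℝ (Fin k)) (i j : Fin k) : ℝ :=
  ∑ l, ∑ a, G y l a * christoffel s G l i j y * inwardNormal G f y a

end Coordinates

/-! ## Cornered spaces -/

section Manifolds

variable {m : ℕ} {X : Type*} [TopologicalSpace X] [ChartedSpace (CornerSpace m) X]

/-- A smooth chart of `X` in which `M` is the face `{x_0 = 0}` and `Q` the face `{x_1 = 0}`. -/
structure IsAdaptedChart (M Q : Set X) (φ : OpenPartialHomeomorph X (CornerSpace m)) : Prop where
  mem_maximalAtlas : φ ∈ IsManifold.maximalAtlas (cornerModel m) ∞ X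
  mem_M_iff : ∀ p ∈ φ.source, p ∈ M ↔ (φ p).1 0 = 0
  mem_Q_iff : ∀ p ∈ φ.source, p ∈ Q ↔ (φ p).1 1 = 0

/-- `(X, M, Q)` is a cornered space: the boundary of `X` is `M ∪ Q`, where `M` and `Q` are
embedded hypersurfaces with common boundary `S = M ∩ Q ≠ ∅`, and `S` is the codimension-two corner
of `X`. Compactness of `S` is not required. -/
structure IsCorneredSpace (M Q : Set X) : Prop where
  nonempty_corner : (M ∩ Q).Nonempty
  exists_chart : ∀ p : X, ∃ φ : OpenPartialHomeomorph X (CornerSpace m),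
    IsAdaptedChart M Q φ ∧ p ∈ φ.source

variable (m X) in
/-- A field of bilinear forms on the tangent spaces of `X`. -/
abbrev BilinField : Type _ :=
  ∀ p : X, TangentSpace (cornerModel m) p →L[ℝ] TangentSpace (cornerModel m) p →L[ℝ] ℝ

/-- The tangent vector `∑ i, v_i ∂_i` at the point of `X` with coordinates `y` in the chart `φ`. -/
def coordVector (φ : OpenPartialHomeomorph X (CornerSpace m))
    (y v : EuclideanSpace ℝ (Fin (m + 2))) :
    TangentSpace (cornerModel m) ((φ.extend (cornerModel m)).symm y) :=
  mfderivWithin 𝓘(ℝ, EuclideanSpace ℝ (Fin (m + 2))) (cornerModel m)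
    (φ.extend (cornerModel m)).symm (range (cornerModel m)) y v

/-- The components `g_ij = g(∂_i, ∂_j)` in the chart `φ`, as functions of the coordinates. -/
def components (φ : OpenPartialHomeomorph X (CornerSpace m)) (g : BilinField m X)
    (y : EuclideanSpace ℝ (Fin (m + 2))) : Matrix (Fin (m + 2)) (Fin (m + 2)) ℝ :=
  fun i j => g ((φ.extend (cornerModel m)).symm y)
    (coordVector φ y (EuclideanSpace.single i 1)) (coordVector φ y (EuclideanSpace.single j 1))

variable [IsManifold (cornerModel m) ∞ X]

variable (m X) in
/-- Smooth Riemannian metrics on all of `X`, up to the boundary and the corner. -/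
abbrev SmoothMetric : Type _ :=
  ContMDiffRiemannianMetric (cornerModel m) ∞ (EuclideanSpace ℝ (Fin (m + 2)))
    (TangentSpace (cornerModel m) : X → Type)

/-- `r` is a smooth defining function for `M`. -/
structure IsDefiningFunction (M : Set X) (r : X → ℝ) : Prop where
  smooth : ContMDiff (cornerModel m) 𝓘(ℝ, ℝ) ∞ r
  nonneg : ∀ p, 0 ≤ r p
  eq_zero_iff : ∀ p, r p = 0 ↔ p ∈ M
  mfderiv_ne_zero : ∀ p ∈ M, mfderiv (cornerModel m) 𝓘(ℝ, ℝ) r p ≠ 0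

/-- `|dr|_ḡ = 1` at `p`: the `ḡ`-gradient of `r` at `p` has unit length. -/
def HasUnitGradientAt (gbar : SmoothMetric m X) (r : X → ℝ) (p : X) : Prop :=
  ∃ w : TangentSpace (cornerModel m) p,
    (∀ v, gbar.inner p w v = mfderiv (cornerModel m) 𝓘(ℝ, ℝ) r p v) ∧ gbar.inner p w w = 1

/-- `ḡ` is the extension to `X` of the metric `r² g` on `X \ M`. -/
def IsCompactification (M : Set X) (g : BilinField m X) (r : X → ℝ)
    (gbar : SmoothMetric m X) : Prop :=
  ∀ p ∉ M, ∀ u v, gbar.inner p u v = r p ^ 2 * g p u v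

/-- `g` is a smooth cornered asymptotically hyperbolic metric: a smooth Riemannian metric on
`X \ M` (its values on `M` are irrelevant) such that, for every defining function `r` of `M`, the
metric `r² g` extends to a smooth metric on `X`, for which `|dr| = 1` on `M`. -/
structure IsCAHMetric (M : Set X) (g : BilinField m X) : Prop where
  symm : ∀ p ∉ M, ∀ u v, g p u v = g p v u
  pos : ∀ p ∉ M, ∀ u, u ≠ 0 → 0 < g p u u
  smooth : ContMDiffOn (cornerModel m) ((cornerModel m).prod 𝓘(ℝ, EuclideanSpace ℝ (Fin (m + 2))
      →L[ℝ] EuclideanSpace ℝ (Fin (m + 2)) →L[ℝ] ℝ)) ∞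
    (fun p => TotalSpace.mk' (EuclideanSpace ℝ (Fin (m + 2))
      →L[ℝ] EuclideanSpace ℝ (Fin (m + 2)) →L[ℝ] ℝ)
      (E := fun p : X => TangentSpace (cornerModel m) p →L[ℝ]
        TangentSpace (cornerModel m) p →L[ℝ] ℝ) p (g p)) Mᶜ
  extend : ∀ r : X → ℝ, IsDefiningFunction (m := m) M r → ∃ gbar : SmoothMetric m X,
    IsCompactification M g r gbar ∧ ∀ p ∈ M, HasUnitGradientAt gbar r p

/-- `Ric(g) = -n g` on `X \ M`, with `n = m + 1`, in every smooth chart. -/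
def IsEinstein (M : Set X) (g : BilinField m X) : Prop :=
  ∀ φ ∈ IsManifold.maximalAtlas (cornerModel m) ∞ X,
    ∀ y ∈ (φ.extend (cornerModel m)).target, (φ.extend (cornerModel m)).symm y ∉ M →
      ∀ i j, ricci (range (cornerModel m)) (components φ g) i j y =
        -((m : ℝ) + 1) * components φ g y i j

/-- `K_Q = lam • g` on the tangent spaces of `Q \ S`, where `K_Q` is the second fundamental form of
`Q` with respect to `g` and the inward unit normal. -/
def IsUmbilicFace (M Q : Set X) (g : BilinField m X) (lam : ℝ) : Prop :=
  ∀ φ : OpenPartialHomeomorph X (CornerSpace m), IsAdaptedChart M Q φ →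
    ∀ y ∈ (φ.extend (cornerModel m)).target, (φ.extend (cornerModel m)).symm y ∈ Q \ M →
      ∀ i j, i ≠ 1 → j ≠ 1 →
        secondFundamentalForm (range (cornerModel m)) (components φ g) 1 y i j =
          lam * components φ g y i j

/-- `r` is a geodesic defining function for `M`, with `ḡ = r² g`: one has `|dr|_ḡ = 1` on a
neighborhood of `M`. -/
structure IsGeodesicCompactification (M : Set X) (g : BilinField m X) (r : X → ℝ)
    (gbar : SmoothMetric m X) : Prop where
  defining : IsDefiningFunction (m := m) M r
  compactification : IsCompactification M g r gbar
  unitGradient : ∀ᶠ p in 𝓝ˢ M, HasUnitGradientAt gbar r p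

/-! ## The infinite face `M` with its metric `h = ḡ|_TM`, and its boundary `S` -/

/-- The point (or vector) `(0, z)` of the coordinate face `{x_0 = 0}`. -/
def faceEmb (z : EuclideanSpace ℝ (Fin (m + 1))) : EuclideanSpace ℝ (Fin (m + 2)) :=
  WithLp.toLp 2 (Fin.cons 0 (fun i => z i))

/-- The domain `{z_0 ≥ 0}` of the coordinates `z = (x_1, …, x_(m+1))` on `M` induced by an adapted
chart; in them `S = {z_0 = 0}`. -/
def faceDomain (m : ℕ) : Set (EuclideanSpace ℝ (Fin (m + 1))) := {z | 0 ≤ z 0}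

/-- The components of `h = ḡ|_TM` in the coordinates on `M` induced by an adapted chart. -/
def faceMetric (φ : OpenPartialHomeomorph X (CornerSpace m)) (gbar : BilinField m X)
    (z : EuclideanSpace ℝ (Fin (m + 1))) : Matrix (Fin (m + 1)) (Fin (m + 1)) ℝ :=
  fun a b => components φ gbar (faceEmb z) a.succ b.succ

/-- `K̄_S = η h` on the tangent spaces of `S`, where `K̄_S` is the second fundamental form of `S` in
the Riemannian manifold `(M, h)`, with respect to the `M`-inward `h`-unit normal. -/
def IsUmbilicCornerWith (M Q : Set X) (gbar : BilinField m X) (η : X → ℝ) : Prop :=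
  ∀ φ : OpenPartialHomeomorph X (CornerSpace m), IsAdaptedChart M Q φ →
    ∀ z : EuclideanSpace ℝ (Fin (m + 1)), z 0 = 0 →
      faceEmb z ∈ (φ.extend (cornerModel m)).target →
      ∀ i j : Fin m,
        secondFundamentalForm (faceDomain m) (faceMetric φ gbar) 0 z i.succ j.succ =
          η ((φ.extend (cornerModel m)).symm (faceEmb z)) *
            faceMetric φ gbar z i.succ j.succ

/-- `Z(η) = - R̄(ν̄_M, Z, ν̄_M, ν̄_S)` for every `p ∈ S` and every `Z ∈ T_p S`. Here `z` are the
coordinates of `p` in `M`, the vector `Z` is given by its components, `ν̄_M` is the `X`-inward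
`ḡ`-unit normal to `M`, and `ν̄_S` is the `M`-inward `h`-unit normal to `S` in `M`. -/
def SatisfiesCornerEquation (M Q : Set X) (gbar : BilinField m X) (η : X → ℝ) : Prop :=
  ∀ φ : OpenPartialHomeomorph X (CornerSpace m), IsAdaptedChart M Q φ →
    ∀ z : EuclideanSpace ℝ (Fin (m + 1)), z 0 = 0 →
      faceEmb z ∈ (φ.extend (cornerModel m)).target →
      ∀ Z : EuclideanSpace ℝ (Fin (m + 2)), Z 0 = 0 → Z 1 = 0 →
        (mfderivWithin (cornerModel m) 𝓘(ℝ, ℝ) η (M ∩ Q)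
            ((φ.extend (cornerModel m)).symm (faceEmb z)) (coordVector φ (faceEmb z) Z) : ℝ) =
          - curvature (range (cornerModel m)) (components φ gbar) (faceEmb z)
              (inwardNormal (components φ gbar) 0 (faceEmb z))
              (fun i => Z i)
              (inwardNormal (components φ gbar) 0 (faceEmb z))
              (Fin.cons 0 (inwardNormal (faceMetric φ gbar) 0 z))

/-! ## Subsets of the hyperbolic half-space -/

/-- `F` embeds `X` smoothly in the closed upper half-space `{x_0 ≥ 0}` of `ℝ³`, with
`M = F⁻¹({x_0 = 0})`, in such a way that `g` is the pullback of the hyperbolic metric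
`(dx_0² + dx_1² + dx_2²) / x_0²`. -/
structure IsHyperbolicEmbedding (M : Set X) (g : BilinField m X)
    (F : X → EuclideanSpace ℝ (Fin 3)) : Prop where
  isEmbedding : IsEmbedding F
  smooth : ContMDiff (cornerModel m) 𝓘(ℝ, EuclideanSpace ℝ (Fin 3)) ∞ F
  immersion : ∀ p, Function.Injective
    (mfderiv (cornerModel m) 𝓘(ℝ, EuclideanSpace ℝ (Fin 3)) F p)
  nonneg : ∀ p, 0 ≤ F p 0
  eq_zero_iff : ∀ p, F p 0 = 0 ↔ p ∈ M
  metric_eq : ∀ p ∉ M, ∀ u v, g p u v =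
    inner ℝ (mfderiv (cornerModel m) 𝓘(ℝ, EuclideanSpace ℝ (Fin 3)) F p u :
        EuclideanSpace ℝ (Fin 3))
      (mfderiv (cornerModel m) 𝓘(ℝ, EuclideanSpace ℝ (Fin 3)) F p v :
        EuclideanSpace ℝ (Fin 3)) / (F p 0) ^ 2

end Manifolds

/-- `C` is a (full) circle of positive radius in the plane `{x_0 = 0}`. -/
def IsPlanarCircle (C : Set (EuclideanSpace ℝ (Fin 3))) : Prop :=
  ∃ c : EuclideanSpace ℝ (Fin 3), ∃ ρ : ℝ, c 0 = 0 ∧ 0 < ρ ∧ C = {x | x 0 = 0 ∧ dist x c = ρ}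

/-- `C` is a (full) straight line in the plane `{x_0 = 0}`. -/
def IsPlanarLine (C : Set (EuclideanSpace ℝ (Fin 3))) : Prop :=
  ∃ c d : EuclideanSpace ℝ (Fin 3), c 0 = 0 ∧ d 0 = 0 ∧ d ≠ 0 ∧ C = range fun t : ℝ => c + t • d

end

/-!
The proof works in adapted charts, with `ḡ = r² g` smooth up to the face at infinity `M = {x_0 =
0}` and `Q = {x_1 = 0}`.

**The umbilic equation.** By the conformal transformation law, `Q` is umbilic for `ḡ` too, with a
factor `η_Q` (`faceCurvature`, globally `CornerSetting.cornerCurvature`) satisfying `r η_Q = λ -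
dr(ν_Q)` away from `M` (`CornerCoords.christoffel_of_umbilic`). In a chart `η_Q` is a quotient of
smooth functions, so it is smooth up to the corner, and `dr(ν_Q) = λ` there: the two faces meet at
the constant angle `arccos (-λ)`, with `λ² < 1` (`CornerCoords.sq_lt_one`). Since `ν_Q` does not
depend on the chart (`unitNormal_eq`), neither does `η_Q`.

Multiplying Einstein's equation for `g = r⁻² ḡ` by `r` and letting `r → 0` gives `(n - 1) Hess r +
(Δ r) ḡ = 0` on `M`. As `|dr| = 1` makes `Hess r (·, grad r)` vanish, both terms are zero
(`CornerCoords.hessComp_eq_zero`), so `M` is totally geodesic for `ḡ`. In the orthonormal frame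
`ν_M, ν_S` of the normal plane of `S`, `ν_Q = λ ν_M + √(1 - λ²) ν_S`
(`CornerCoords.inwardNormal_one_eq`), so the second fundamental form of `S` in `M` is `η h` with
`η = η_Q / √(1 - λ²)` (`CornerCoords.secondFundamentalForm_corner`).

The equation for `Z(η)` is the Codazzi equation of `Q` (`SmoothCoordMetric.codazzi`) for `Z` and
the vector `ν_M - λ ν_Q`, which is tangent to `Q` and normal to `S`. Expanded in the frame `ν_M,
ν_S`, it contains an unwanted curvature `R̄(Z, ν_S, ν_M, ν_S)`, which vanishes because `Hess r =
0` along `M` (`CornerCoords.curvature_inwardNormal_zero`, `CornerCoords.corner_equation`).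

**Circles and lines.** In the half-space model, the height `r = x_0` compactifies the hyperbolic
metric to the Euclidean one. With the Euclidean metric, `Q` is an umbilic surface with unit normal
`N`, and the Weingarten equation `dN = -η_Q dF` along `Q` shows that `η_Q`, `N + η_Q F` and the
constant term of the equation of the sphere or plane through these data are locally constant on
`S` (`FlatCoords.partialDeriv_flatNormal`, `CornerSetting.eventually_eq_sphere`). So a component
of `S` lies in a circle or line of the plane `{x_0 = 0}`, which is nondegenerate because `N` is
not vertical. The component contains a regular curve through each of its points, hence is open in
this circle or line (`mem_nhdsWithin_generalizedCircle`); it is also closed, hence everything, by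
connectedness.

The function `r` of the second part need not be geodesic, which is why `CornerSetting` and
`CornerCoords` do not assume `|dr| = 1`.
-/

namespace CornerGeometry

/-! ### Smooth functions on a coordinate domain -/

/-- A coordinate domain `T` in the closed set `s` (a quadrant or a half-space): `T` is relatively
open in `s`, and `s` is fat enough for derivatives within `s` to be unique and symmetric. -/
structure ChartDomain {k : ℕ} (s T : Set (EuclideanSpace ℝ (Fin k))) : Prop where
  uniqueDiffOn : UniqueDiffOn ℝ s
  subset_closure : s ⊆ closure (interior s)
  subset : T ⊆ s
  mem_nhdsWithin : ∀ x ∈ T, T ∈ 𝓝[s] x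

/-- `f` is smooth on `T` up to the boundary of `s`. -/
def SmoothFn {k : ℕ} (s T : Set (EuclideanSpace ℝ (Fin k)))
    (f : EuclideanSpace ℝ (Fin k) → ℝ) : Prop :=
  ∀ x ∈ T, ContDiffWithinAt ℝ ∞ f s x

section Calculus

variable {k : ℕ} {s T : Set (EuclideanSpace ℝ (Fin k))} {f g : EuclideanSpace ℝ (Fin k) → ℝ}
  {x : EuclideanSpace ℝ (Fin k)}

theorem ChartDomain.of_convex (hc : Convex ℝ s) (hi : (interior s).Nonempty) (hT : T ⊆ s)
    (hn : ∀ x ∈ T, T ∈ 𝓝[s] x) : ChartDomain s T where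
  uniqueDiffOn := uniqueDiffOn_convex hc hi
  subset_closure := by
    rw [hc.closure_interior_eq_closure_of_nonempty_interior hi]; exact _root_.subset_closure
  subset := hT
  mem_nhdsWithin := hn

theorem SmoothFn.differentiableWithinAt (hf : SmoothFn s T f) (hx : x ∈ T) :
    DifferentiableWithinAt ℝ f s x :=
  (hf x hx).differentiableWithinAt (by simp)

theorem SmoothFn.continuousWithinAt (hf : SmoothFn s T f) (hx : x ∈ T) :
    ContinuousWithinAt f s x := (hf x hx).continuousWithinAt

theorem SmoothFn.const (c : ℝ) : SmoothFn s T fun _ => c := fun _ _ => contDiffWithinAt_const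

theorem SmoothFn.add (hf : SmoothFn s T f) (hg : SmoothFn s T g) :
    SmoothFn s T fun x => f x + g x := fun x hx => (hf x hx).add (hg x hx)

theorem SmoothFn.sub (hf : SmoothFn s T f) (hg : SmoothFn s T g) :
    SmoothFn s T fun x => f x - g x := fun x hx => (hf x hx).sub (hg x hx)

theorem SmoothFn.neg (hf : SmoothFn s T f) :
    SmoothFn s T fun x => - f x := fun x hx => (hf x hx).neg

theorem SmoothFn.mul (hf : SmoothFn s T f) (hg : SmoothFn s T g) :
    SmoothFn s T fun x => f x * g x := fun x hx => (hf x hx).mul (hg x hx)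

theorem SmoothFn.pow (hf : SmoothFn s T f) (n : ℕ) :
    SmoothFn s T fun x => f x ^ n := fun x hx => (hf x hx).pow n

theorem SmoothFn.inv (hf : SmoothFn s T f) (h0 : ∀ x ∈ T, f x ≠ 0) :
    SmoothFn s T fun x => (f x)⁻¹ := fun x hx => (hf x hx).inv (h0 x hx)

theorem SmoothFn.div (hf : SmoothFn s T f) (hg : SmoothFn s T g) (h0 : ∀ x ∈ T, g x ≠ 0) :
    SmoothFn s T fun x => f x / g x := fun x hx => (hf x hx).div (hg x hx) (h0 x hx)

theorem SmoothFn.sqrt (hf : SmoothFn s T f) (h0 : ∀ x ∈ T, f x ≠ 0) :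
    SmoothFn s T fun x => √(f x) := fun x hx => (hf x hx).sqrt (h0 x hx)

theorem SmoothFn.sum {ι : Type*} {u : Finset ι} {f : ι → EuclideanSpace ℝ (Fin k) → ℝ}
    (hf : ∀ i ∈ u, SmoothFn s T (f i)) : SmoothFn s T fun x => ∑ i ∈ u, f i x :=
  fun x hx => ContDiffWithinAt.sum fun i hi => hf i hi x hx

theorem SmoothFn.prod {ι : Type*} {u : Finset ι} {f : ι → EuclideanSpace ℝ (Fin k) → ℝ}
    (hf : ∀ i ∈ u, SmoothFn s T (f i)) : SmoothFn s T fun x => ∏ i ∈ u, f i x :=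
  fun x hx => contDiffWithinAt_prod fun i hi => hf i hi x hx

theorem SmoothFn.mono {T' : Set (EuclideanSpace ℝ (Fin k))} (hf : SmoothFn s T f) (h : T' ⊆ T) :
    SmoothFn s T' f := fun x hx => hf x (h hx)

theorem SmoothFn.partialDeriv (h : ChartDomain s T) (hf : SmoothFn s T f) (i : Fin k) :
    SmoothFn s T (partialDeriv s i f) := fun x hx =>
  ((hf x hx).fderivWithin_right h.uniqueDiffOn (m := ∞) (by simp) (h.subset hx)).clm_apply
    contDiffWithinAt_const

theorem ChartDomain.eventuallyEq (h : ChartDomain s T) (hx : x ∈ T) (hfg : EqOn f g T) :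
    f =ᶠ[𝓝[s] x] g :=
  Filter.mem_of_superset (h.mem_nhdsWithin x hx) hfg

theorem SmoothFn.congr (h : ChartDomain s T) (hf : SmoothFn s T f) (hfg : EqOn g f T) :
    SmoothFn s T g := fun x hx =>
  (hf x hx).congr_of_eventuallyEq (h.eventuallyEq hx hfg) (hfg hx)

theorem partialDeriv_congr (h : ChartDomain s T) (hx : x ∈ T) (i : Fin k) (hfg : EqOn f g T) :
    partialDeriv s i f x = partialDeriv s i g x := by
  unfold partialDeriv
  rw [(h.eventuallyEq hx hfg).fderivWithin_eq (hfg hx)]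

theorem partialDeriv_const (i : Fin k) (c : ℝ) :
    partialDeriv s i (fun _ => c) x = 0 := by simp [partialDeriv]

theorem partialDeriv_add (h : ChartDomain s T) (hx : x ∈ T) (hf : SmoothFn s T f)
    (hg : SmoothFn s T g) (i : Fin k) :
    partialDeriv s i (fun y => f y + g y) x = partialDeriv s i f x + partialDeriv s i g x := by
  unfold partialDeriv
  rw [fderivWithin_fun_add (h.uniqueDiffOn x (h.subset hx)) (hf.differentiableWithinAt hx)
    (hg.differentiableWithinAt hx)]
  rfl

theorem partialDeriv_sub (h : ChartDomain s T) (hx : x ∈ T) (hf : SmoothFn s T f)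
    (hg : SmoothFn s T g) (i : Fin k) :
    partialDeriv s i (fun y => f y - g y) x = partialDeriv s i f x - partialDeriv s i g x := by
  unfold partialDeriv
  rw [fderivWithin_fun_sub (h.uniqueDiffOn x (h.subset hx)) (hf.differentiableWithinAt hx)
    (hg.differentiableWithinAt hx)]
  rfl

theorem partialDeriv_mul (h : ChartDomain s T) (hx : x ∈ T) (hf : SmoothFn s T f)
    (hg : SmoothFn s T g) (i : Fin k) :
    partialDeriv s i (fun y => f y * g y) x =
      partialDeriv s i f x * g x + f x * partialDeriv s i g x := by
  unfold partialDeriv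
  rw [fderivWithin_fun_mul (h.uniqueDiffOn x (h.subset hx)) (hf.differentiableWithinAt hx)
    (hg.differentiableWithinAt hx)]
  simp only [add_apply, smul_apply, smul_eq_mul]
  ring

theorem partialDeriv_const_mul (h : ChartDomain s T) (hx : x ∈ T) (hf : SmoothFn s T f)
    (c : ℝ) (i : Fin k) :
    partialDeriv s i (fun y => c * f y) x = c * partialDeriv s i f x := by
  rw [partialDeriv_mul h hx (SmoothFn.const c) hf, partialDeriv_const]; ring

theorem partialDeriv_neg (h : ChartDomain s T) (hx : x ∈ T) (hf : SmoothFn s T f) (i : Fin k) :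
    partialDeriv s i (fun y => - f y) x = - partialDeriv s i f x := by
  have := partialDeriv_const_mul h hx hf (-1) i
  simpa using this

theorem partialDeriv_sum (h : ChartDomain s T) (hx : x ∈ T) {ι : Type*} {u : Finset ι}
    {f : ι → EuclideanSpace ℝ (Fin k) → ℝ} (hf : ∀ i ∈ u, SmoothFn s T (f i)) (i : Fin k) :
    partialDeriv s i (fun y => ∑ a ∈ u, f a y) x = ∑ a ∈ u, partialDeriv s i (f a) x := by
  unfold partialDeriv
  rw [fderivWithin_fun_sum (h.uniqueDiffOn x (h.subset hx))
    (fun a ha => (hf a ha).differentiableWithinAt hx)]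
  simp

theorem partialDeriv_inv (h : ChartDomain s T) (hx : x ∈ T) (hf : SmoothFn s T f)
    (h0 : ∀ x ∈ T, f x ≠ 0) (i : Fin k) :
    partialDeriv s i (fun y => (f y)⁻¹) x = - partialDeriv s i f x / f x ^ 2 := by
  have e : partialDeriv s i (fun y => f y * (f y)⁻¹) x = partialDeriv s i (fun _ => (1 : ℝ)) x :=
    partialDeriv_congr h hx i fun y hy => mul_inv_cancel₀ (h0 y hy)
  rw [partialDeriv_mul h hx hf (hf.inv h0), partialDeriv_const] at e
  have := h0 x hx
  field_simp at e ⊢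
  linarith

theorem partialDeriv_sqrt (h : ChartDomain s T) (hx : x ∈ T) (hf : SmoothFn s T f)
    (h0 : ∀ x ∈ T, 0 < f x) (i : Fin k) :
    2 * √(f x) * partialDeriv s i (fun y => √(f y)) x = partialDeriv s i f x := by
  have hs : SmoothFn s T fun y => √(f y) := hf.sqrt fun y hy => (h0 y hy).ne'
  have e : partialDeriv s i (fun y => √(f y) * √(f y)) x = partialDeriv s i f x :=
    partialDeriv_congr h hx i fun y hy => Real.mul_self_sqrt (h0 y hy).le
  rw [partialDeriv_mul h hx hs hs] at e
  linarith

/-- Second derivatives within `s` are symmetric up to the boundary of `s`. -/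
theorem partialDeriv_comm (h : ChartDomain s T) (hx : x ∈ T) (hf : SmoothFn s T f)
    (i j : Fin k) :
    partialDeriv s i (partialDeriv s j f) x = partialDeriv s j (partialDeriv s i f) x := by
  have hd : DifferentiableWithinAt ℝ (fderivWithin ℝ f s) s x :=
    ((hf x hx).fderivWithin_right h.uniqueDiffOn (m := ∞) (by simp)
      (h.subset hx)).differentiableWithinAt (by simp)
  have key (i j : Fin k) : partialDeriv s i (partialDeriv s j f) x =
      fderivWithin ℝ (fderivWithin ℝ f s) s x (EuclideanSpace.single i 1)
        (EuclideanSpace.single j 1) := by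
    unfold partialDeriv
    rw [fderivWithin_clm_apply (h.uniqueDiffOn x (h.subset hx)) hd
      (differentiableWithinAt_const _)]
    simp
  rw [key, key]
  exact (hf x hx).isSymmSndFDerivWithinAt 
    (by simpa using WithTop.coe_le_coe.2 (le_top : (2 : ℕ∞) ≤ ⊤)) h.uniqueDiffOn
    (h.subset_closure (h.subset hx)) (h.subset hx) _ _

/-- The derivative in the direction `v` is the corresponding combination of partial derivatives. -/
theorem fderivWithin_apply_eq_sum (f : EuclideanSpace ℝ (Fin k) → ℝ)
    (s : Set (EuclideanSpace ℝ (Fin k))) (x v : EuclideanSpace ℝ (Fin k)) :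
    fderivWithin ℝ f s x v = ∑ i, v i * partialDeriv s i f x := by
  have hv : v = ∑ i, v i • EuclideanSpace.single i (1 : ℝ) := by
    ext j; simp [Finset.sum_apply, Pi.single_apply]
  conv_lhs => rw [hv]
  simp [map_sum, partialDeriv]

end Calculus

end CornerGeometry

namespace CornerGeometry

/-! ### The Levi-Civita connection in coordinates -/

/-- A smooth Riemannian metric `G` on the coordinate domain `T`. -/
structure SmoothCoordMetric {k : ℕ} (s T : Set (EuclideanSpace ℝ (Fin k)))
    (G : EuclideanSpace ℝ (Fin k) → Matrix (Fin k) (Fin k) ℝ) : Prop where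
  domain : ChartDomain s T
  smooth : ∀ i j, SmoothFn s T fun x => G x i j
  posDef : ∀ x ∈ T, (G x).PosDef

namespace SmoothCoordMetric

variable {k : ℕ} {s T : Set (EuclideanSpace ℝ (Fin k))}
  {G : EuclideanSpace ℝ (Fin k) → Matrix (Fin k) (Fin k) ℝ} {x : EuclideanSpace ℝ (Fin k)}

theorem transpose_eq (hG : SmoothCoordMetric s T G) (hx : x ∈ T) : (G x).transpose = G x := by
  simpa using (hG.posDef x hx).isHermitian.eq

theorem symm (hG : SmoothCoordMetric s T G) (hx : x ∈ T) (i j : Fin k) : G x i j = G x j i :=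
  congrFun (congrFun (hG.transpose_eq hx) j) i

theorem inv_transpose_eq (hG : SmoothCoordMetric s T G) (hx : x ∈ T) :
    (G x)⁻¹.transpose = (G x)⁻¹ := by
  rw [Matrix.transpose_nonsing_inv, hG.transpose_eq hx]

theorem inv_symm (hG : SmoothCoordMetric s T G) (hx : x ∈ T) (i j : Fin k) :
    (G x)⁻¹ i j = (G x)⁻¹ j i :=
  congrFun (congrFun (hG.inv_transpose_eq hx) j) i

theorem mul_inv (hG : SmoothCoordMetric s T G) (hx : x ∈ T) : G x * (G x)⁻¹ = 1 :=
  Matrix.mul_nonsing_inv _ ((hG.posDef x hx).det_pos.ne'.isUnit)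

theorem inv_mul (hG : SmoothCoordMetric s T G) (hx : x ∈ T) : (G x)⁻¹ * G x = 1 :=
  Matrix.nonsing_inv_mul _ ((hG.posDef x hx).det_pos.ne'.isUnit)

theorem sum_mul_inv (hG : SmoothCoordMetric s T G) (hx : x ∈ T) (i j : Fin k) :
    ∑ a, G x i a * (G x)⁻¹ a j = if i = j then 1 else 0 := by
  rw [← Matrix.mul_apply, hG.mul_inv hx, Matrix.one_apply]

theorem sum_inv_mul (hG : SmoothCoordMetric s T G) (hx : x ∈ T) (i j : Fin k) :
    ∑ a, (G x)⁻¹ i a * G x a j = if i = j then 1 else 0 := by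
  rw [← Matrix.mul_apply, hG.inv_mul hx, Matrix.one_apply]

theorem inv_diag_pos (hG : SmoothCoordMetric s T G) (hx : x ∈ T) (i : Fin k) :
    0 < (G x)⁻¹ i i := (hG.posDef x hx).inv.diag_pos

theorem diag_pos (hG : SmoothCoordMetric s T G) (hx : x ∈ T) (i : Fin k) :
    0 < G x i i := (hG.posDef x hx).diag_pos

theorem smooth_inv (hG : SmoothCoordMetric s T G) (i j : Fin k) :
    SmoothFn s T fun x => (G x)⁻¹ i j := by
  have hdet {A : EuclideanSpace ℝ (Fin k) → Matrix (Fin k) (Fin k) ℝ}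
      (hA : ∀ i j, SmoothFn s T fun x => A x i j) : SmoothFn s T fun x => (A x).det := by
    simp only [Matrix.det_apply']
    exact SmoothFn.sum fun σ _ => (SmoothFn.const _).mul (SmoothFn.prod fun i _ => hA _ _)
  have hd := hdet hG.smooth
  have ha : SmoothFn s T fun x => (G x).adjugate i j := by
    simp only [Matrix.adjugate_apply]
    refine hdet fun a b => ?_
    by_cases h : a = j
    · subst h; simpa using SmoothFn.const _
    · simpa [Matrix.updateRow_ne h] using hG.smooth a b
  have : SmoothFn s T fun x => ((G x).det)⁻¹ * (G x).adjugate i j :=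
    (hd.inv fun x hx => (hG.posDef x hx).det_pos.ne').mul ha
  simpa [Matrix.inv_def] using this

theorem smooth_sqrt_inv (hG : SmoothCoordMetric s T G) (i : Fin k) :
    SmoothFn s T fun x => √((G x)⁻¹ i i) :=
  (hG.smooth_inv i i).sqrt fun _ hx => (hG.inv_diag_pos hx i).ne'

theorem christoffel_symm (hG : SmoothCoordMetric s T G) (hx : x ∈ T) (l i j : Fin k) :
    christoffel s G l i j x = christoffel s G l j i x := by
  unfold christoffel
  have (a : Fin k) : partialDeriv s a (fun x => G x i j) x =
      partialDeriv s a (fun x => G x j i) x :=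
    partialDeriv_congr hG.domain hx a fun y hy => hG.symm hy i j
  congr 1
  refine Finset.sum_congr rfl fun a _ => ?_
  rw [this]; ring

theorem smooth_christoffel (hG : SmoothCoordMetric s T G) (l i j : Fin k) :
    SmoothFn s T (christoffel s G l i j) :=
  (SmoothFn.const (1 / 2)).mul <| SmoothFn.sum fun a _ => (hG.smooth_inv l a).mul <|
    (((hG.smooth j a).partialDeriv hG.domain i).add
      ((hG.smooth i a).partialDeriv hG.domain j)).sub ((hG.smooth i j).partialDeriv hG.domain a)

/-- Christoffel symbols of the first kind. -/
theorem sum_mul_christoffel (hG : SmoothCoordMetric s T G) (hx : x ∈ T) (a i j : Fin k) :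
    ∑ l, G x a l * christoffel s G l i j x = (1 / 2) * (partialDeriv s i (fun x => G x j a) x +
      partialDeriv s j (fun x => G x i a) x - partialDeriv s a (fun x => G x i j) x) := by
  unfold christoffel
  set P : Fin k → ℝ := fun a => partialDeriv s i (fun x => G x j a) x +
      partialDeriv s j (fun x => G x i a) x - partialDeriv s a (fun x => G x i j) x
  calc ∑ l, G x a l * ((1 / 2) * ∑ b, (G x)⁻¹ l b * P b)
      = (1 / 2) * ∑ b, (∑ l, G x a l * (G x)⁻¹ l b) * P b := by
        simp only [Finset.mul_sum, Finset.sum_mul]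
        rw [Finset.sum_comm]
        exact Finset.sum_congr rfl fun _ _ => Finset.sum_congr rfl fun _ _ => by ring
    _ = (1 / 2) * P a := by simp [hG.sum_mul_inv hx]

/-- Metric compatibility of the Levi-Civita connection. -/
theorem partialDeriv_eq (hG : SmoothCoordMetric s T G) (hx : x ∈ T) (i j c : Fin k) :
    partialDeriv s i (fun x => G x j c) x =
      ∑ a, G x j a * christoffel s G a i c x + ∑ a, G x c a * christoffel s G a i j x := by
  have e (a i j : Fin k) : partialDeriv s a (fun x => G x i j) x =
      partialDeriv s a (fun x => G x j i) x :=
    partialDeriv_congr hG.domain hx a fun y hy => hG.symm hy i j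
  rw [hG.sum_mul_christoffel hx, hG.sum_mul_christoffel hx, e i j c, e j i c, e c i j]
  ring

/-- The derivative of the inverse metric. -/
theorem partialDeriv_inv_eq (hG : SmoothCoordMetric s T G) (hx : x ∈ T) (c i j : Fin k) :
    partialDeriv s c (fun x => (G x)⁻¹ i j) x =
      - (∑ a, christoffel s G i c a x * (G x)⁻¹ a j +
        ∑ a, christoffel s G j c a x * (G x)⁻¹ a i) := by
  set A : Matrix (Fin k) (Fin k) ℝ := G x
  set dA : Matrix (Fin k) (Fin k) ℝ := .of fun i j => partialDeriv s c (fun x => G x i j) x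
    with hdA
  set dB : Matrix (Fin k) (Fin k) ℝ := .of fun i j => partialDeriv s c (fun x => (G x)⁻¹ i j) x
    with hdB
  set Γ : Matrix (Fin k) (Fin k) ℝ := .of fun a j => christoffel s G a c j x with hΓ
  have hAt : A.transpose = A := hG.transpose_eq hx
  have hBt : A⁻¹.transpose = A⁻¹ := hG.inv_transpose_eq hx
  have h1 : dA = A * Γ + Γ.transpose * A := by
    ext i j
    simp only [hdA, hΓ, Matrix.of_apply, Matrix.add_apply, Matrix.mul_apply,
      Matrix.transpose_apply]
    rw [hG.partialDeriv_eq hx]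
    congr 1
    exact Finset.sum_congr rfl fun a _ => by rw [hG.symm hx j a, mul_comm]
  have h2 : dB * A + A⁻¹ * dA = 0 := by
    ext i j
    have e : partialDeriv s c (fun x => ∑ a, (G x)⁻¹ i a * G x a j) x =
        partialDeriv s c (fun _ => if i = j then (1 : ℝ) else 0) x :=
      partialDeriv_congr hG.domain hx c fun y hy => hG.sum_inv_mul hy i j
    rw [partialDeriv_const, partialDeriv_sum hG.domain hx
      fun a _ => (hG.smooth_inv i a).mul (hG.smooth a j)] at e
    simp only [partialDeriv_mul hG.domain hx (hG.smooth_inv i _) (hG.smooth _ j),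
      Finset.sum_add_distrib] at e
    simp only [hdA, hdB, Matrix.of_apply, Matrix.add_apply, Matrix.mul_apply]
    exact e
  have h3 : dB = - (Γ * A⁻¹ + (Γ * A⁻¹).transpose) := by
    have hAB : A * A⁻¹ = 1 := hG.mul_inv hx
    have hBA : A⁻¹ * A = 1 := hG.inv_mul hx
    calc dB = dB * (A * A⁻¹) := by rw [hAB, mul_one]
      _ = (dB * A) * A⁻¹ := by rw [mul_assoc]
      _ = - (A⁻¹ * dA) * A⁻¹ := by rw [eq_neg_of_add_eq_zero_left h2]
      _ = - ((A⁻¹ * A) * Γ * A⁻¹ + A⁻¹ * Γ.transpose * (A * A⁻¹)) := by rw [h1]; noncomm_ring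
      _ = _ := by rw [hAB, hBA, Matrix.transpose_mul, hBt]; simp
  have := congrFun (congrFun h3 i) j
  simpa only [hdB, hΓ, Matrix.of_apply, Matrix.neg_apply, Matrix.add_apply, Matrix.mul_apply,
    Matrix.transpose_apply] using this

/-- The second fundamental form of a coordinate face is a normalized Christoffel symbol. -/
theorem secondFundamentalForm_eq (hG : SmoothCoordMetric s T G) (hx : x ∈ T) (f i j : Fin k) :
    secondFundamentalForm s G f x i j = christoffel s G f i j x / √((G x)⁻¹ f f) := by
  unfold secondFundamentalForm inwardNormal
  calc ∑ l, ∑ a, G x l a * christoffel s G l i j x * ((G x)⁻¹ a f / √((G x)⁻¹ f f))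
      = ∑ l, (∑ a, G x l a * (G x)⁻¹ a f) * (christoffel s G l i j x / √((G x)⁻¹ f f)) := by
        simp only [Finset.sum_mul]
        exact Finset.sum_congr rfl fun _ _ => Finset.sum_congr rfl fun _ _ => by ring
    _ = _ := by simp [hG.sum_mul_inv hx]

end SmoothCoordMetric

end CornerGeometry

namespace CornerGeometry

/-! ### Conformal change of the connection and of the Ricci tensor -/

section ConformalAlgebra

variable {k : ℕ}

/-- The difference tensor `δ^l_i p_j + δ^l_j p_i - g_ij P^l`: if `p = dr` and `P = grad r`, then
`- r⁻¹` times this is the difference between the connections of `r⁻² g` and `g`. -/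
def conformalTensor (g : Matrix (Fin k) (Fin k) ℝ) (p P : Fin k → ℝ) (l i j : Fin k) : ℝ :=
  (if l = i then p j else 0) + (if l = j then p i else 0) - g i j * P l

variable {g : Matrix (Fin k) (Fin k) ℝ} {p P : Fin k → ℝ}

theorem sum_mul_conformalTensor (f : Fin k → ℝ) (i j : Fin k) :
    ∑ l, f l * conformalTensor g p P l i j = f i * p j + f j * p i - g i j * ∑ l, f l * P l := by
  simp only [conformalTensor, mul_sub, mul_add, Finset.sum_sub_distrib, Finset.sum_add_distrib,
    mul_ite, mul_zero, Finset.sum_ite_eq', Finset.mem_univ, if_true, Finset.mul_sum]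
  simp [mul_left_comm]

theorem sum_conformalTensor_mul (f : Fin k → ℝ) (l i : Fin k) :
    ∑ j, conformalTensor g p P l i j * f j =
      (if l = i then ∑ j, p j * f j else 0) + p i * f l - P l * ∑ j, g i j * f j := by
  simp only [conformalTensor, sub_mul, add_mul, Finset.sum_sub_distrib, Finset.sum_add_distrib,
    ite_mul, zero_mul, Finset.sum_ite_eq, Finset.mem_univ, if_true, Finset.mul_sum]
  congr 1
  · congr 1
    split_ifs <;> simp
  · exact Finset.sum_congr rfl fun _ _ => by ring

theorem trace_conformalTensor (hlow : ∀ i, ∑ a, P a * g a i = p i) (c : Fin k) :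
    ∑ i, conformalTensor g p P i i c = k * p c := by
  simp only [conformalTensor, if_true, Finset.sum_sub_distrib, Finset.sum_add_distrib,
    Finset.sum_ite_eq', Finset.mem_univ, Finset.sum_const, Finset.card_univ, Fintype.card_fin,
    nsmul_eq_mul]
  rw [Finset.sum_congr rfl fun a _ => mul_comm (g a c) (P a), hlow]
  simp

/-- The algebra behind the conformal transformation law of the Ricci tensor. Here `Γ`, `dg`, `dp`
and `dP` stand for the Christoffel symbols and for the partial derivatives of `g`, `p = dr` and
`P = grad r`, and `q` for `r⁻¹`. -/
theorem ricci_conformal_algebra (hg : ∀ i j, g i j = g j i)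
    (hlow : ∀ i, ∑ a, P a * g a i = p i)
    {Γ dg : Fin k → Fin k → Fin k → ℝ} {dp dP : Fin k → Fin k → ℝ}
    (hΓ : ∀ l i j, Γ l i j = Γ l j i)
    (hcompat : ∀ i j c, dg i j c = ∑ a, g j a * Γ a i c + ∑ a, g c a * Γ a i j)
    (hdp : ∀ i j, dp i j = dp j i)
    (hdlow : ∀ i j, ∑ a, (dP i a * g a j + P a * dg i a j) = dp i j)
    (q : ℝ) (j c : Fin k) (T : Fin k → Fin k → Fin k → ℝ)
    (hT : ∀ l i j, T l i j = conformalTensor g p P l i j)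
    (dT : Fin k → Fin k → Fin k → Fin k → ℝ)
    (hdT : ∀ a l i j, dT a l i j = (if l = i then dp a j else 0) + (if l = j then dp a i else 0)
      - (dg a i j * P l + g i j * dP a l)) :
    ∑ i, ((p i * T i j c - p j * T i i c) * q ^ 2 - (dT i i j c - dT j i i c) * q
      - q * ∑ a, (Γ i i a * T a j c + T i i a * Γ a j c - Γ i j a * T a i c - T i j a * Γ a i c)
      + q ^ 2 * ∑ a, (T i i a * T a j c - T i j a * T a i c)) =
    q * (((k : ℝ) - 2) * (dp j c - ∑ a, Γ a j c * p a)
      + g j c * (∑ i, dP i i + ∑ i, ∑ a, Γ i i a * P a))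
      - ((k : ℝ) - 1) * q ^ 2 * (∑ a, p a * P a) * g j c := by
  have hlow' (i : Fin k) : ∑ a, g i a * P a = p i := by
    rw [← hlow]; exact Finset.sum_congr rfl fun a _ => by rw [hg, mul_comm]
  set N := ∑ a, p a * P a with hN
  have S1 (j : Fin k) : ∑ i, p i * T i j c = 2 * p j * p c - g j c * N := by
    simp only [hT, sum_mul_conformalTensor]; ring
  have S2 (c : Fin k) : ∑ i, T i i c = k * p c := by
    simp only [hT, trace_conformalTensor hlow]
  have S3 : ∑ i, dT i i j c = 2 * dp j c - ∑ i, dg i j c * P i - g j c * ∑ i, dP i i := by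
    simp only [hdT, Finset.sum_sub_distrib, Finset.sum_add_distrib, Finset.sum_ite_eq',
      Finset.mem_univ, if_true, ← Finset.mul_sum]
    rw [hdp c j]; ring
  have S4 : ∑ i, dT j i i c = k * dp j c := by
    have h := hdlow j c
    rw [Finset.sum_add_distrib] at h
    simp only [hdT, if_true, Finset.sum_sub_distrib, Finset.sum_add_distrib, Finset.sum_ite_eq',
      Finset.mem_univ, Finset.sum_const, Finset.card_univ, Fintype.card_fin, nsmul_eq_mul]
    rw [Finset.sum_congr rfl fun a _ => mul_comm (dg j a c) (P a),
      Finset.sum_congr rfl fun a _ => mul_comm (g a c) (dP j a)]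
    linarith
  have S5 : ∑ i, ∑ a, Γ i i a * T a j c =
      (∑ i, Γ i i j) * p c + (∑ i, Γ i i c) * p j - g j c * ∑ i, ∑ a, Γ i i a * P a := by
    simp only [hT, sum_mul_conformalTensor, Finset.sum_sub_distrib, Finset.sum_add_distrib,
      Finset.sum_mul, Finset.mul_sum]
  have S6 : ∑ i, ∑ a, T i i a * Γ a j c = k * ∑ a, Γ a j c * p a := by
    rw [Finset.sum_comm, Finset.mul_sum]
    refine Finset.sum_congr rfl fun a _ => ?_
    rw [← Finset.sum_mul, S2]; ring
  have S7 : ∑ i, ∑ a, Γ i j a * T a i c = (∑ i, Γ i i j) * p c + ∑ a, Γ a j c * p a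
      - ∑ i, ∑ a, g c a * Γ a i j * P i := by
    simp only [hT, sum_mul_conformalTensor, Finset.sum_sub_distrib, Finset.sum_add_distrib,
      Finset.sum_mul, Finset.mul_sum]
    congr 1
    · congr 1
      exact Finset.sum_congr rfl fun a _ => by rw [hΓ]
    · rw [Finset.sum_comm]
      exact Finset.sum_congr rfl fun a _ => Finset.sum_congr rfl fun b _ => by
        rw [hΓ b j a, hg c b]; ring
  have S8 : ∑ i, ∑ a, T i j a * Γ a i c = ∑ a, Γ a j c * p a + (∑ i, Γ i i c) * p j
      - ∑ i, ∑ a, g j a * Γ a i c * P i := by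
    simp only [hT, sum_conformalTensor_mul, Finset.sum_sub_distrib, Finset.sum_add_distrib,
      Finset.sum_ite_eq', Finset.mem_univ, if_true, Finset.sum_mul, Finset.mul_sum]
    congr 1
    · congr 1
      · exact Finset.sum_congr rfl fun a _ => mul_comm _ _
      · exact Finset.sum_congr rfl fun a _ => mul_comm _ _
    · exact Finset.sum_congr rfl fun a _ => Finset.sum_congr rfl fun b _ => by ring
  have S9 : ∑ i, ∑ a, T i i a * T a j c = k * (2 * p j * p c - g j c * N) := by
    rw [Finset.sum_comm, ← S1, Finset.mul_sum]
    refine Finset.sum_congr rfl fun a _ => ?_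
    rw [← Finset.sum_mul, S2]; ring
  have S10 : ∑ i, ∑ a, T i j a * T a i c = (k + 2) * (p j * p c) - 2 * g j c * N := by
    have h1 (i : Fin k) : ∑ a, T i j a * T a i c =
        (if i = j then 2 * p i * p c - g i c * N else 0) + p j * T i i c
          - P i * (g j i * p c + g j c * p i - g i c * p j) := by
      have h2 : ∑ a, g j a * T a i c = g j i * p c + g j c * p i - g i c * p j := by
        simp only [hT, sum_mul_conformalTensor, hlow']
      rw [← h2, ← S1 i]
      simp only [hT]
      rw [sum_conformalTensor_mul (fun a => conformalTensor g p P a i c)]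
    have h3 : ∑ i, P i * (g j i * p c + g j c * p i - g i c * p j) = g j c * N := by
      calc _ = (∑ a, g j a * P a) * p c + g j c * N - (∑ a, P a * g a c) * p j := by
            rw [hN, Finset.sum_mul, Finset.sum_mul, Finset.mul_sum, ← Finset.sum_add_distrib,
              ← Finset.sum_sub_distrib]
            exact Finset.sum_congr rfl fun _ _ => by ring
        _ = _ := by rw [hlow, hlow']; ring
    simp only [h1, Finset.sum_sub_distrib, Finset.sum_add_distrib, Finset.sum_ite_eq',
      Finset.mem_univ, if_true, ← Finset.mul_sum, S2, h3]
    ring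
  have S11 : ∑ i, dg i j c * P i =
      ∑ i, ∑ a, g j a * Γ a i c * P i + ∑ i, ∑ a, g c a * Γ a i j * P i := by
    rw [← Finset.sum_add_distrib]
    refine Finset.sum_congr rfl fun i _ => ?_
    rw [hcompat, add_mul, Finset.sum_mul, Finset.sum_mul]
  simp only [Finset.sum_add_distrib, Finset.sum_sub_distrib, ← Finset.mul_sum, ← Finset.sum_mul,
    S1, S2, S3, S4, S5, S6, S7, S8, S9, S10, S11]
  ring

end ConformalAlgebra

/-- The contravariant components of the gradient of `r`. -/
noncomputable def gradComp {k : ℕ} (s : Set (EuclideanSpace ℝ (Fin k)))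
    (G : EuclideanSpace ℝ (Fin k) → Matrix (Fin k) (Fin k) ℝ) (r : EuclideanSpace ℝ (Fin k) → ℝ)
    (l : Fin k) (x : EuclideanSpace ℝ (Fin k)) : ℝ :=
  ∑ a, (G x)⁻¹ l a * partialDeriv s a r x

/-- The components of the Hessian of `r`. -/
noncomputable def hessComp {k : ℕ} (s : Set (EuclideanSpace ℝ (Fin k)))
    (G : EuclideanSpace ℝ (Fin k) → Matrix (Fin k) (Fin k) ℝ) (r : EuclideanSpace ℝ (Fin k) → ℝ)
    (i j : Fin k) (x : EuclideanSpace ℝ (Fin k)) : ℝ :=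
  partialDeriv s i (partialDeriv s j r) x - ∑ a, christoffel s G a i j x * partialDeriv s a r x

/-- The squared norm of the gradient of `r`. -/
noncomputable def gradNormSq {k : ℕ} (s : Set (EuclideanSpace ℝ (Fin k)))
    (G : EuclideanSpace ℝ (Fin k) → Matrix (Fin k) (Fin k) ℝ) (r : EuclideanSpace ℝ (Fin k) → ℝ)
    (x : EuclideanSpace ℝ (Fin k)) : ℝ :=
  ∑ a, partialDeriv s a r x * gradComp s G r a x

namespace SmoothCoordMetric

variable {k : ℕ} {s T : Set (EuclideanSpace ℝ (Fin k))}
  {G H : EuclideanSpace ℝ (Fin k) → Matrix (Fin k) (Fin k) ℝ} {x : EuclideanSpace ℝ (Fin k)}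
  {r : EuclideanSpace ℝ (Fin k) → ℝ}

theorem smooth_gradComp (hG : SmoothCoordMetric s T G) (hr : SmoothFn s T r) (l : Fin k) :
    SmoothFn s T (gradComp s G r l) :=
  SmoothFn.sum fun a _ => (hG.smooth_inv l a).mul (hr.partialDeriv hG.domain a)

theorem smooth_hessComp (hG : SmoothCoordMetric s T G) (hr : SmoothFn s T r) (i j : Fin k) :
    SmoothFn s T (hessComp s G r i j) :=
  ((hr.partialDeriv hG.domain j).partialDeriv hG.domain i).sub <|
    SmoothFn.sum fun a _ => (hG.smooth_christoffel a i j).mul (hr.partialDeriv hG.domain a)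

theorem smooth_curvatureEndo (hG : SmoothCoordMetric s T G) (l c i j : Fin k) :
    SmoothFn s T (curvatureEndo s G l c i j) :=
  (((hG.smooth_christoffel l j c).partialDeriv hG.domain i).sub
    ((hG.smooth_christoffel l i c).partialDeriv hG.domain j)).add <| SmoothFn.sum fun a _ =>
    ((hG.smooth_christoffel l i a).mul (hG.smooth_christoffel a j c)).sub
      ((hG.smooth_christoffel l j a).mul (hG.smooth_christoffel a i c))

theorem smooth_ricci (hG : SmoothCoordMetric s T G) (j c : Fin k) :
    SmoothFn s T (ricci s G j c) :=
  SmoothFn.sum fun i _ => hG.smooth_curvatureEndo i c i j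

theorem sum_gradComp_mul (hG : SmoothCoordMetric s T G) (hx : x ∈ T) (i : Fin k) :
    ∑ a, gradComp s G r a x * G x a i = partialDeriv s i r x := by
  calc ∑ a, (∑ b, (G x)⁻¹ a b * partialDeriv s b r x) * G x a i
      = ∑ b, (∑ a, (G x)⁻¹ b a * G x a i) * partialDeriv s b r x := by
        simp only [Finset.sum_mul]
        rw [Finset.sum_comm]
        exact Finset.sum_congr rfl fun b _ => Finset.sum_congr rfl fun a _ => by
          rw [hG.inv_symm hx a b]; ring
    _ = _ := by simp [hG.sum_inv_mul hx]

theorem restrict (hG : SmoothCoordMetric s T G) {T' : Set (EuclideanSpace ℝ (Fin k))}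
    (h : ChartDomain s T') (hT : T' ⊆ T) : SmoothCoordMetric s T' G where
  domain := h
  smooth i j := (hG.smooth i j).mono hT
  posDef x hx := hG.posDef x (hT hx)

theorem conformal_inv (hH : EqOn H (fun x => (r x ^ 2)⁻¹ • G x) T) (hr0 : ∀ x ∈ T, r x ≠ 0)
    (hG : SmoothCoordMetric s T G) (hx : x ∈ T) :
    (H x)⁻¹ = r x ^ 2 • (G x)⁻¹ := by
  have h := hr0 x hx
  rw [hH hx]
  refine Matrix.inv_eq_right_inv ?_
  rw [Matrix.smul_mul, Matrix.mul_smul, hG.mul_inv hx, smul_smul, inv_mul_cancel₀ (by positivity),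
    one_smul]

/-- The Christoffel symbols of the conformal metric `H = r⁻² G`. -/
theorem conformal_christoffel (hH : EqOn H (fun x => (r x ^ 2)⁻¹ • G x) T)
    (hr0 : ∀ x ∈ T, r x ≠ 0) (hG : SmoothCoordMetric s T G) (hr : SmoothFn s T r) (hx : x ∈ T)
    (l i j : Fin k) :
    christoffel s H l i j x = christoffel s G l i j x - (r x)⁻¹ *
      conformalTensor (G x) (fun a => partialDeriv s a r x) (fun a => gradComp s G r a x) l i j := by
  have h0 := hr0 x hx
  have hd (a i j : Fin k) : partialDeriv s a (fun x => H x i j) x =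
      (r x ^ 2)⁻¹ * partialDeriv s a (fun x => G x i j) x
        - 2 * (r x ^ 3)⁻¹ * partialDeriv s a r x * G x i j := by
    have e : EqOn (fun x => H x i j) (fun x => (r x * r x)⁻¹ * G x i j) T := fun y hy => by
      simp [hH hy, pow_two]
    have h1 : ∀ y ∈ T, r y * r y ≠ 0 := fun y hy => mul_self_ne_zero.2 (hr0 y hy)
    rw [partialDeriv_congr hG.domain hx a e,
      partialDeriv_mul hG.domain hx ((hr.mul hr).inv h1) (hG.smooth i j),
      partialDeriv_inv hG.domain hx (hr.mul hr) h1, partialDeriv_mul hG.domain hx hr hr]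
    field_simp
    ring
  unfold christoffel
  simp only [conformal_inv hH hr0 hG hx, hd, Matrix.smul_apply, smul_eq_mul]
  set p : Fin k → ℝ := fun a => partialDeriv s a r x
  calc (1 / 2) * ∑ a, r x ^ 2 * (G x)⁻¹ l a *
        ((r x ^ 2)⁻¹ * partialDeriv s i (fun x => G x j a) x - 2 * (r x ^ 3)⁻¹ * p i * G x j a
        + ((r x ^ 2)⁻¹ * partialDeriv s j (fun x => G x i a) x - 2 * (r x ^ 3)⁻¹ * p j * G x i a)
        - ((r x ^ 2)⁻¹ * partialDeriv s a (fun x => G x i j) x - 2 * (r x ^ 3)⁻¹ * p a * G x i j))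
      = (1 / 2) * ∑ a, (G x)⁻¹ l a * (partialDeriv s i (fun x => G x j a) x +
          partialDeriv s j (fun x => G x i a) x - partialDeriv s a (fun x => G x i j) x)
        - (r x)⁻¹ * (p i * ∑ a, (G x)⁻¹ l a * G x a j + p j * ∑ a, (G x)⁻¹ l a * G x a i
          - G x i j * ∑ a, (G x)⁻¹ l a * p a) := by
        simp only [Finset.mul_sum, ← Finset.sum_add_distrib, ← Finset.sum_sub_distrib]
        refine Finset.sum_congr rfl fun a _ => ?_
        rw [hG.symm hx a j, hG.symm hx a i]
        field_simp
        ring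
    _ = _ := by
        rw [hG.sum_inv_mul hx, hG.sum_inv_mul hx]
        congr 2
        unfold conformalTensor gradComp
        simp only [mul_ite, mul_one, mul_zero]
        ring

/-- The conformal transformation law of the Ricci tensor. -/
theorem conformal_ricci (hH : EqOn H (fun x => (r x ^ 2)⁻¹ • G x) T)
    (hr0 : ∀ x ∈ T, r x ≠ 0) (hG : SmoothCoordMetric s T G) (hr : SmoothFn s T r) (hx : x ∈ T)
    (j c : Fin k) :
    ricci s H j c x = ricci s G j c x + ((r x)⁻¹ * (((k : ℝ) - 2) * hessComp s G r j c x
      + G x j c * (∑ i, partialDeriv s i (gradComp s G r i) x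
        + ∑ i, ∑ a, christoffel s G i i a x * gradComp s G r a x))
      - ((k : ℝ) - 1) * (r x)⁻¹ ^ 2 * gradNormSq s G r x * G x j c) := by
  have hD := hG.domain
  set Tt : Fin k → Fin k → Fin k → EuclideanSpace ℝ (Fin k) → ℝ := fun l i j y =>
    conformalTensor (G y) (fun a => partialDeriv s a r y) (fun a => gradComp s G r a y) l i j
    with hTt
  have hp (a : Fin k) := hr.partialDeriv hD a
  have hP (a : Fin k) := hG.smooth_gradComp hr a
  have hq : SmoothFn s T fun y => (r y)⁻¹ := hr.inv hr0
  have hite (P : Prop) [Decidable P] {f : EuclideanSpace ℝ (Fin k) → ℝ} (hf : SmoothFn s T f) :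
      SmoothFn s T fun y => if P then f y else 0 := by
    split_ifs
    · exact hf
    · exact SmoothFn.const 0
  have hTs (l i j : Fin k) : SmoothFn s T (Tt l i j) :=
    ((hite _ (hp j)).add (hite _ (hp i))).sub ((hG.smooth i j).mul (hP l))
  have hdite (P : Prop) [Decidable P] (a : Fin k) (f : EuclideanSpace ℝ (Fin k) → ℝ) :
      partialDeriv s a (fun y => if P then f y else 0) x =
        if P then partialDeriv s a f x else 0 := by
    split_ifs
    · rfl
    · exact partialDeriv_const _ _
  have hdT (a l i j : Fin k) : partialDeriv s a (Tt l i j) x =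
      (if l = i then partialDeriv s a (partialDeriv s j r) x else 0)
      + (if l = j then partialDeriv s a (partialDeriv s i r) x else 0)
      - (partialDeriv s a (fun x => G x i j) x * gradComp s G r l x
        + G x i j * partialDeriv s a (gradComp s G r l) x) := by
    simp only [hTt, conformalTensor]
    rw [partialDeriv_sub hD hx ((hite _ (hp j)).add (hite _ (hp i)))
      ((hG.smooth i j).mul (hP l)), partialDeriv_add hD hx (hite _ (hp j)) (hite _ (hp i)),
      partialDeriv_mul hD hx (hG.smooth i j) (hP l), hdite, hdite]
  have hΓ (l i j : Fin k) : EqOn (christoffel s H l i j)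
      (fun y => christoffel s G l i j y - (r y)⁻¹ * Tt l i j y) T := fun y hy =>
    conformal_christoffel hH hr0 hG hr hy l i j
  have hdΓ (a l i j : Fin k) : partialDeriv s a (christoffel s H l i j) x =
      partialDeriv s a (christoffel s G l i j) x
        - (- partialDeriv s a r x * (r x)⁻¹ ^ 2 * Tt l i j x
          + (r x)⁻¹ * partialDeriv s a (Tt l i j) x) := by
    rw [partialDeriv_congr hD hx a (hΓ l i j), partialDeriv_sub hD hx (hG.smooth_christoffel l i j)
      (hq.mul (hTs l i j)), partialDeriv_mul hD hx hq (hTs l i j),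
      partialDeriv_inv hD hx hr hr0, div_eq_mul_inv, inv_pow]
  have key := ricci_conformal_algebra (g := G x) (p := fun a => partialDeriv s a r x)
    (P := fun a => gradComp s G r a x) (hG.symm hx) (hG.sum_gradComp_mul hx)
    (Γ := fun l i j => christoffel s G l i j x)
    (dg := fun a i j => partialDeriv s a (fun y => G y i j) x)
    (dp := fun a i => partialDeriv s a (partialDeriv s i r) x)
    (dP := fun a l => partialDeriv s a (gradComp s G r l) x)
    (hG.christoffel_symm hx) (hG.partialDeriv_eq hx) (partialDeriv_comm hD hx hr)
    (fun i j => by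
      rw [← partialDeriv_congr hD hx i fun y hy => hG.sum_gradComp_mul (r := r) hy j,
        partialDeriv_sum hD hx fun a _ => (hP a).mul (hG.smooth a j)]
      exact Finset.sum_congr rfl fun a _ => (partialDeriv_mul hD hx (hP a) (hG.smooth a j) i).symm)
    (r x)⁻¹ j c (fun l i j => Tt l i j x) (fun l i j => rfl)
    (fun a l i j => partialDeriv s a (Tt l i j) x) hdT
  unfold hessComp gradNormSq
  rw [← key]
  unfold ricci curvatureEndo
  rw [← Finset.sum_add_distrib]
  refine Finset.sum_congr rfl fun i _ => ?_
  simp only [hdΓ, hΓ _ _ _ hx]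
  rw [Finset.mul_sum, Finset.mul_sum]
  have e : ∑ a, ((christoffel s G i i a x - (r x)⁻¹ * Tt i i a x) *
        (christoffel s G a j c x - (r x)⁻¹ * Tt a j c x) -
      (christoffel s G i j a x - (r x)⁻¹ * Tt i j a x) *
        (christoffel s G a i c x - (r x)⁻¹ * Tt a i c x)) =
      ∑ a, (christoffel s G i i a x * christoffel s G a j c x
        - christoffel s G i j a x * christoffel s G a i c x)
      - ∑ a, (r x)⁻¹ * (christoffel s G i i a x * Tt a j c x + Tt i i a x * christoffel s G a j c x
        - christoffel s G i j a x * Tt a i c x - Tt i j a x * christoffel s G a i c x)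
      + ∑ a, (r x)⁻¹ ^ 2 * (Tt i i a x * Tt a j c x - Tt i j a x * Tt a i c x) := by
    rw [← Finset.sum_sub_distrib, ← Finset.sum_add_distrib]
    exact Finset.sum_congr rfl fun a _ => by ring
  rw [e]
  ring

end SmoothCoordMetric

end CornerGeometry

namespace CornerGeometry

/-! ### Functions along coordinate rays -/

/-- `s` is stable under translation in all positive coordinate directions. -/
def RayStable {k : ℕ} (s : Set (EuclideanSpace ℝ (Fin k))) : Prop :=
  ∀ x ∈ s, ∀ i : Fin k, ∀ t : ℝ, 0 ≤ t → x + t • EuclideanSpace.single i (1 : ℝ) ∈ s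

section Rays

variable {k : ℕ} {s T : Set (EuclideanSpace ℝ (Fin k))} {f g : EuclideanSpace ℝ (Fin k) → ℝ}
  {x : EuclideanSpace ℝ (Fin k)}

theorem hasDerivWithinAt_ray (hs : RayStable s) (h : ChartDomain s T) (hx : x ∈ T)
    (hf : SmoothFn s T f) (i : Fin k) :
    HasDerivWithinAt (fun t : ℝ => f (x + t • EuclideanSpace.single i (1 : ℝ)))
      (partialDeriv s i f x) (Ici 0) 0 := by
  have hγ : HasDerivWithinAt (fun t : ℝ => x + t • EuclideanSpace.single i (1 : ℝ))
      (EuclideanSpace.single i (1 : ℝ)) (Ici 0) 0 := by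
    simpa using (((hasDerivAt_id (0 : ℝ)).smul_const
      (EuclideanSpace.single i (1 : ℝ))).const_add x).hasDerivWithinAt
  exact HasFDerivWithinAt.comp_hasDerivWithinAt_of_eq (0 : ℝ)
    (hf.differentiableWithinAt hx).hasFDerivWithinAt hγ
    (fun t ht => hs x (h.subset hx) i t ht) (by simp)

theorem eventually_ray_mem (hs : RayStable s) (h : ChartDomain s T) (hx : x ∈ T) (i : Fin k) :
    ∀ᶠ t in 𝓝[Ici 0] (0 : ℝ), x + t • EuclideanSpace.single i (1 : ℝ) ∈ T := by
  have hc : ContinuousWithinAt (fun t : ℝ => x + t • EuclideanSpace.single i (1 : ℝ)) (Ici 0) 0 :=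
    Continuous.continuousWithinAt (by fun_prop)
  have := hc.tendsto_nhdsWithin (t := s) fun t ht => hs x (h.subset hx) i t ht
  simp only [zero_smul, add_zero] at this
  exact this (h.mem_nhdsWithin x hx)

/-- A partial derivative only depends on the values of the function on the corresponding ray. -/
theorem partialDeriv_congr_ray (hs : RayStable s) (h : ChartDomain s T) (hx : x ∈ T)
    (hf : SmoothFn s T f) (hg : SmoothFn s T g) (i : Fin k)
    (hfg : ∀ t : ℝ, 0 ≤ t → x + t • EuclideanSpace.single i (1 : ℝ) ∈ T →
      f (x + t • EuclideanSpace.single i (1 : ℝ)) = g (x + t • EuclideanSpace.single i (1 : ℝ))) :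
    partialDeriv s i f x = partialDeriv s i g x := by
  have hev : (fun t : ℝ => g (x + t • EuclideanSpace.single i (1 : ℝ))) =ᶠ[𝓝[Ici 0] 0]
      fun t : ℝ => f (x + t • EuclideanSpace.single i (1 : ℝ)) := by
    filter_upwards [eventually_ray_mem hs h hx i, self_mem_nhdsWithin] with t ht ht0
    exact (hfg t ht0 ht).symm
  have h2 := (hasDerivWithinAt_ray hs h hx hf i).congr_of_eventuallyEq hev
    (hfg 0 le_rfl (by simpa using hx)).symm
  exact (uniqueDiffWithinAt_Ici (0 : ℝ)).eq_deriv _ h2 (hasDerivWithinAt_ray hs h hx hg i)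

/-- Two functions which agree on the face `{x_b = 0}` have the same tangential derivatives. -/
theorem partialDeriv_congr_face (hs : RayStable s) (h : ChartDomain s T) (hx : x ∈ T)
    (hf : SmoothFn s T f) (hg : SmoothFn s T g) {b i : Fin k} (hb : x b = 0) (hi : i ≠ b)
    (hfg : ∀ y ∈ T, y b = 0 → f y = g y) :
    partialDeriv s i f x = partialDeriv s i g x :=
  partialDeriv_congr_ray hs h hx hf hg i fun t _ ht => hfg _ ht (by simp [hb, hi.symm])

theorem partialDeriv_eq_zero_face (hs : RayStable s) (h : ChartDomain s T) (hx : x ∈ T)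
    (hf : SmoothFn s T f) {b i : Fin k} (hb : x b = 0) (hi : i ≠ b)
    (hf0 : ∀ y ∈ T, y b = 0 → f y = 0) : partialDeriv s i f x = 0 := by
  rw [partialDeriv_congr_face hs h hx hf (SmoothFn.const 0) hb hi hf0, partialDeriv_const]

theorem partialDeriv_nonneg (hs : RayStable s) (h : ChartDomain s T) (hx : x ∈ T)
    (hf : SmoothFn s T f) (i : Fin k) (hx0 : f x = 0) (hf0 : ∀ y ∈ T, 0 ≤ f y) :
    0 ≤ partialDeriv s i f x := by
  have h1 := hasDerivWithinAt_iff_tendsto_slope.1 (hasDerivWithinAt_ray hs h hx hf i)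
  refine ge_of_tendsto (h1.mono_left (nhdsWithin_mono 0 (t := Ici 0 \ {0}) (s := Ioi 0)
    fun t ht => ⟨(mem_Ioi.1 ht).le, (mem_Ioi.1 ht).ne'⟩)) ?_
  filter_upwards [(eventually_ray_mem hs h hx i).filter_mono
    (nhdsWithin_mono 0 Ioi_subset_Ici_self), self_mem_nhdsWithin] with t ht ht0
  rw [slope_def_field]
  have := hf0 _ ht
  simp only [zero_smul, add_zero, hx0, sub_zero]
  exact div_nonneg this (mem_Ioi.1 ht0).le

/-- Extension of an identity by continuity to the endpoint of a ray. -/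
theorem eq_of_eq_ray (hs : RayStable s) (h : ChartDomain s T) (hx : x ∈ T)
    (hf : ContinuousWithinAt f s x) (hg : ContinuousWithinAt g s x) (i : Fin k)
    (hfg : ∀ t : ℝ, 0 < t → x + t • EuclideanSpace.single i (1 : ℝ) ∈ T →
      f (x + t • EuclideanSpace.single i (1 : ℝ)) = g (x + t • EuclideanSpace.single i (1 : ℝ))) :
    f x = g x := by
  have hγ : Tendsto (fun t : ℝ => x + t • EuclideanSpace.single i (1 : ℝ)) (𝓝[>] 0) (𝓝[s] x) := by
    have hc : ContinuousWithinAt (fun t : ℝ => x + t • EuclideanSpace.single i (1 : ℝ))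
      (Ioi 0) 0 := Continuous.continuousWithinAt (by fun_prop)
    have := hc.tendsto_nhdsWithin (t := s) fun t ht =>
      hs x (h.subset hx) i t (mem_Ioi.1 ht).le
    simpa using this
  refine tendsto_nhds_unique (hf.tendsto.comp hγ) ((hg.tendsto.comp hγ).congr' ?_)
  filter_upwards [(eventually_ray_mem hs h hx i).filter_mono
    (nhdsWithin_mono 0 Ioi_subset_Ici_self), self_mem_nhdsWithin] with t ht ht0
  exact (hfg t ht0 ht).symm

theorem ChartDomain.inter_pos (h : ChartDomain s T) (i : Fin k) :
    ChartDomain s {y ∈ T | 0 < y i} where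
  uniqueDiffOn := h.uniqueDiffOn
  subset_closure := h.subset_closure
  subset := fun _ hy => h.subset hy.1
  mem_nhdsWithin := fun y hy => inter_mem (h.mem_nhdsWithin y hy.1) (mem_nhdsWithin_of_mem_nhds
    ((isOpen_lt continuous_const (EuclideanSpace.proj (𝕜 := ℝ) i).continuous).mem_nhds hy.2))

end Rays

/-! ### Curvature and the Codazzi equation -/

namespace SmoothCoordMetric

variable {k : ℕ} {s T : Set (EuclideanSpace ℝ (Fin k))}
  {G H : EuclideanSpace ℝ (Fin k) → Matrix (Fin k) (Fin k) ℝ} {x : EuclideanSpace ℝ (Fin k)}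
  {r : EuclideanSpace ℝ (Fin k) → ℝ}

theorem curvatureEndo_swap (l c i j : Fin k) :
    curvatureEndo s G l c i j x = - curvatureEndo s G l c j i x := by
  unfold curvatureEndo
  have : ∑ a, (christoffel s G l i a x * christoffel s G a j c x
      - christoffel s G l j a x * christoffel s G a i c x) =
      - ∑ a, (christoffel s G l j a x * christoffel s G a i c x
      - christoffel s G l i a x * christoffel s G a j c x) := by
    rw [← Finset.sum_neg_distrib]
    exact Finset.sum_congr rfl fun _ _ => by ring
  rw [this]; ring

/-- The curvature tensor is skew in its last two arguments. -/
theorem curvature_skew (hG : SmoothCoordMetric s T G) (hx : x ∈ T) (l c i j : Fin k) :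
    ∑ a, G x l a * curvatureEndo s G a c i j x = - ∑ a, G x c a * curvatureEndo s G a l i j x := by
  have hD := hG.domain
  set Γ : Fin k → Fin k → Fin k → ℝ := fun l i j => christoffel s G l i j x with hΓ
  -- the derivative of the identity expressing metric compatibility
  have hdd (i j : Fin k) : partialDeriv s i (partialDeriv s j fun y => G y l c) x =
      ∑ a, (partialDeriv s i (fun y => G y l a) x * Γ a j c
        + G x l a * partialDeriv s i (christoffel s G a j c) x)
      + ∑ a, (partialDeriv s i (fun y => G y c a) x * Γ a j l
        + G x c a * partialDeriv s i (christoffel s G a j l) x) := by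
    have hs1 (l c : Fin k) : ∀ a ∈ Finset.univ, SmoothFn s T
        fun y => G y l a * christoffel s G a j c y := fun a _ =>
      (hG.smooth l a).mul (hG.smooth_christoffel a j c)
    rw [partialDeriv_congr hD hx i fun y hy => hG.partialDeriv_eq hy j l c,
      partialDeriv_add hD hx (SmoothFn.sum (hs1 l c)) (SmoothFn.sum (hs1 c l)),
      partialDeriv_sum hD hx (hs1 l c), partialDeriv_sum hD hx (hs1 c l)]
    congr 1 <;> refine Finset.sum_congr rfl fun a _ => ?_ <;>
      exact partialDeriv_mul hD hx (hG.smooth _ a) (hG.smooth_christoffel a j _) i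
  have hsum (l c i j : Fin k) : ∑ a, partialDeriv s i (fun y => G y l a) x * Γ a j c =
      ∑ b, G x l b * ∑ a, Γ b i a * Γ a j c + ∑ a, ∑ b, G x a b * (Γ b i l * Γ a j c) := by
    simp only [hG.partialDeriv_eq hx i l, add_mul, Finset.sum_add_distrib, Finset.sum_mul,
      Finset.mul_sum]
    congr 1
    · rw [Finset.sum_comm]
      exact Finset.sum_congr rfl fun _ _ => Finset.sum_congr rfl fun _ _ => by ring
    · exact Finset.sum_congr rfl fun _ _ => Finset.sum_congr rfl fun _ _ => by ring
  have hcross (l c i j : Fin k) : ∑ a, ∑ b, G x a b * (Γ b i l * Γ a j c) =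
      ∑ a, ∑ b, G x a b * (Γ b j c * Γ a i l) := by
    rw [Finset.sum_comm]
    exact Finset.sum_congr rfl fun a _ => Finset.sum_congr rfl fun b _ => by
      rw [hG.symm hx]; ring
  have hexp (l c : Fin k) : ∑ a, G x l a * curvatureEndo s G a c i j x =
      ∑ a, G x l a * partialDeriv s i (christoffel s G a j c) x
      - ∑ a, G x l a * partialDeriv s j (christoffel s G a i c) x
      + ∑ a, G x l a * ∑ b, Γ a i b * Γ b j c - ∑ a, G x l a * ∑ b, Γ a j b * Γ b i c := by
    rw [← Finset.sum_sub_distrib, ← Finset.sum_add_distrib, ← Finset.sum_sub_distrib]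
    refine Finset.sum_congr rfl fun a _ => ?_
    unfold curvatureEndo
    rw [Finset.sum_sub_distrib]
    ring
  have h := partialDeriv_comm hD hx (hG.smooth l c) i j
  rw [hdd, hdd] at h
  simp only [Finset.sum_add_distrib, hsum] at h
  rw [hexp, hexp]
  have h1 := hcross l c i j
  have h2 := hcross c l i j
  linarith

theorem curvature_eq (hG : SmoothCoordMetric s T G) (hx : x ∈ T) (u v w z : Fin k → ℝ) :
    curvature s G x u v w z =
      ∑ i, ∑ j, ∑ c, ∑ l, (∑ a, G x l a * curvatureEndo s G a c i j x) * (u i * v j * w c * z l) := by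
  unfold curvature
  refine Finset.sum_congr rfl fun i _ => Finset.sum_congr rfl fun j _ =>
    Finset.sum_congr rfl fun c _ => Finset.sum_congr rfl fun l _ => ?_
  rw [Finset.sum_mul]
  refine Finset.sum_congr rfl fun a _ => ?_
  rw [hG.symm hx a l]; ring

theorem curvature_swap_last (hG : SmoothCoordMetric s T G) (hx : x ∈ T) (u v w z : Fin k → ℝ) :
    curvature s G x u v w z = - curvature s G x u v z w := by
  rw [hG.curvature_eq hx, hG.curvature_eq hx, ← Finset.sum_neg_distrib]
  refine Finset.sum_congr rfl fun i _ => ?_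
  rw [← Finset.sum_neg_distrib]
  refine Finset.sum_congr rfl fun j _ => ?_
  rw [← Finset.sum_neg_distrib, Finset.sum_comm]
  refine Finset.sum_congr rfl fun c _ => ?_
  rw [← Finset.sum_neg_distrib]
  refine Finset.sum_congr rfl fun l _ => ?_
  rw [hG.curvature_skew hx c l]
  ring

theorem curvature_swap_first (u v w z : Fin k → ℝ) :
    curvature s G x u v w z = - curvature s G x v u w z := by
  unfold curvature
  rw [Finset.sum_comm, ← Finset.sum_neg_distrib]
  refine Finset.sum_congr rfl fun i _ => ?_
  rw [← Finset.sum_neg_distrib]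
  refine Finset.sum_congr rfl fun j _ => ?_
  rw [← Finset.sum_neg_distrib]
  refine Finset.sum_congr rfl fun c _ => ?_
  rw [← Finset.sum_neg_distrib]
  refine Finset.sum_congr rfl fun l _ => ?_
  rw [← Finset.sum_neg_distrib]
  refine Finset.sum_congr rfl fun a _ => ?_
  rw [curvatureEndo_swap a c i j]
  ring

/-- The Codazzi equation for a coordinate face which is umbilic, with `K = η g` there. -/
theorem codazzi (hs : RayStable s) (hG : SmoothCoordMetric s T G) {f : Fin k}
    {η : EuclideanSpace ℝ (Fin k) → ℝ} (hη : SmoothFn s T η)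
    (hK : ∀ y ∈ T, y f = 0 → ∀ i j, i ≠ f → j ≠ f →
      christoffel s G f i j y = √((G y)⁻¹ f f) * η y * G y i j)
    (hx : x ∈ T) (hxf : x f = 0) {c i j : Fin k} (hc : c ≠ f) (hi : i ≠ f) (hj : j ≠ f) :
    curvatureEndo s G f c i j x = √((G x)⁻¹ f f) *
      (partialDeriv s i η x * G x j c - partialDeriv s j η x * G x i c) := by
  have hD := hG.domain
  set Γ : Fin k → Fin k → Fin k → ℝ := fun l i j => christoffel s G l i j x with hΓ
  set w : EuclideanSpace ℝ (Fin k) → ℝ := fun y => √((G y)⁻¹ f f) with hw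
  have hws : SmoothFn s T w := hG.smooth_sqrt_inv f
  have hw0 : 0 < w x := Real.sqrt_pos.2 (hG.inv_diag_pos hx f)
  have hw2 : (G x)⁻¹ f f = w x ^ 2 := (Real.sq_sqrt (hG.inv_diag_pos hx f).le).symm
  have hKx (i j : Fin k) (hi : i ≠ f) (hj : j ≠ f) : Γ f i j = w x * η x * G x i j :=
    hK x hx hxf i j hi hj
  -- the derivative of the length of the conormal
  have hdw (i : Fin k) (hi : i ≠ f) : partialDeriv s i w x =
      - Γ f i f * w x + w x ^ 2 * η x * G x i f := by
    have h1 := partialDeriv_sqrt hD hx (hG.smooth_inv f f) (fun y hy => hG.inv_diag_pos hy f) i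
    rw [hG.partialDeriv_inv_eq hx] at h1
    have h2 : ∑ a, Γ f i a * (G x)⁻¹ a f =
        w x * η x * ∑ a, G x i a * (G x)⁻¹ a f
          + (Γ f i f - w x * η x * G x i f) * (G x)⁻¹ f f := by
      have : ∀ a, Γ f i a * (G x)⁻¹ a f = w x * η x * (G x i a * (G x)⁻¹ a f)
          + if a = f then (Γ f i f - w x * η x * G x i f) * (G x)⁻¹ f f else 0 := by
        intro a
        by_cases ha : a = f
        · subst ha; simp; ring
        · rw [hKx i a hi ha, if_neg ha]; ring
      rw [Finset.sum_congr rfl fun a _ => this a, Finset.sum_add_distrib, ← Finset.mul_sum]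
      simp
    rw [h2, hG.sum_mul_inv hx, if_neg hi, hw2, Real.sqrt_sq hw0.le] at h1
    have h3 : 2 * w x * partialDeriv s i w x =
        2 * w x * (- Γ f i f * w x + w x ^ 2 * η x * G x i f) :=
      h1.trans (by ring)
    exact mul_left_cancel₀ (by positivity) h3
  -- the tangential derivatives of the second fundamental form
  have hdΓ (i j : Fin k) (hi : i ≠ f) (hj : j ≠ f) :
      partialDeriv s i (christoffel s G f j c) x =
        (partialDeriv s i w x * η x + w x * partialDeriv s i η x) * G x j c
          + w x * η x * (∑ a, G x j a * Γ a i c + ∑ a, G x c a * Γ a i j) := by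
    rw [partialDeriv_congr_face hs hD hx (hG.smooth_christoffel f j c)
      ((hws.mul hη).mul (hG.smooth j c)) hxf hi (fun y hy hyf => hK y hy hyf j c hj hc),
      partialDeriv_mul hD hx (hws.mul hη) (hG.smooth j c), partialDeriv_mul hD hx hws hη,
      hG.partialDeriv_eq hx]
  have hprod (i j : Fin k) (hi : i ≠ f) (hj : j ≠ f) : ∑ a, Γ f i a * Γ a j c =
      w x * η x * ∑ a, G x i a * Γ a j c
        + (Γ f i f - w x * η x * G x i f) * (w x * η x * G x j c) := by
    have : ∀ a, Γ f i a * Γ a j c = w x * η x * (G x i a * Γ a j c)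
        + if a = f then (Γ f i f - w x * η x * G x i f) * (w x * η x * G x j c) else 0 := by
      intro a
      by_cases ha : a = f
      · subst ha; rw [hKx j c hj hc]; simp; ring
      · rw [hKx i a hi ha, if_neg ha]; ring
    rw [Finset.sum_congr rfl fun a _ => this a, Finset.sum_add_distrib, ← Finset.mul_sum]
    simp
  have hcs : ∑ a, G x c a * Γ a i j = ∑ a, G x c a * Γ a j i :=
    Finset.sum_congr rfl fun a _ => by
      rw [show Γ a i j = Γ a j i from hG.christoffel_symm hx a i j]
  unfold curvatureEndo
  rw [Finset.sum_sub_distrib, hprod i j hi hj, hprod j i hj hi, hdΓ i j hi hj, hdΓ j i hj hi,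
    hdw i hi, hdw j hj, hcs]
  ring

/-- If the Hessian of `r` vanishes along a coordinate face, then the curvature satisfies
`R(∂_i, ∂_j, ∂_c, grad r) = 0` for `∂_i, ∂_j` tangent to the face. -/
theorem sum_curvatureEndo_mul_eq_zero (hs : RayStable s) (hG : SmoothCoordMetric s T G)
    (hr : SmoothFn s T r) {f : Fin k}
    (hH : ∀ y ∈ T, y f = 0 → ∀ i j, hessComp s G r i j y = 0)
    (hx : x ∈ T) (hxf : x f = 0) {c i j : Fin k} (hi : i ≠ f) (hj : j ≠ f) :
    ∑ a, partialDeriv s a r x * curvatureEndo s G a c i j x = 0 := by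
  have hD := hG.domain
  set Γ : Fin k → Fin k → Fin k → ℝ := fun l i j => christoffel s G l i j x with hΓ
  set p : Fin k → ℝ := fun a => partialDeriv s a r x with hp
  have hp2 (a i : Fin k) : partialDeriv s i (partialDeriv s a r) x = ∑ b, Γ b i a * p b := by
    have := hH x hx hxf i a
    unfold hessComp at this
    linarith
  have hd (i j : Fin k) (hi : i ≠ f) :
      partialDeriv s i (partialDeriv s j (partialDeriv s c r)) x =
        ∑ a, partialDeriv s i (christoffel s G a j c) x * p a + ∑ a, Γ a j c * ∑ b, Γ b i a * p b := by
    have h0 := partialDeriv_eq_zero_face hs hD hx (hG.smooth_hessComp hr j c) hxf hi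
      fun y hy hyf => hH y hy hyf j c
    have hsm : ∀ a ∈ Finset.univ, SmoothFn s T
        fun y => christoffel s G a j c y * partialDeriv s a r y := fun a _ =>
      (hG.smooth_christoffel a j c).mul (hr.partialDeriv hD a)
    unfold hessComp at h0
    rw [partialDeriv_sub hD hx ((hr.partialDeriv hD c).partialDeriv hD j) (SmoothFn.sum hsm),
      partialDeriv_sum hD hx hsm] at h0
    rw [sub_eq_zero.1 h0, ← Finset.sum_add_distrib]
    refine Finset.sum_congr rfl fun a _ => ?_
    rw [partialDeriv_mul hD hx (hG.smooth_christoffel a j c) (hr.partialDeriv hD a), hp2]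
  have hcomm := partialDeriv_comm hD hx (hr.partialDeriv hD c) i j
  rw [hd i j hi, hd j i hj] at hcomm
  have hsw (i j : Fin k) : ∑ a, Γ a j c * ∑ b, Γ b i a * p b =
      ∑ a, p a * ∑ b, Γ a i b * Γ b j c := by
    simp only [Finset.mul_sum]
    rw [Finset.sum_comm]
    exact Finset.sum_congr rfl fun _ _ => Finset.sum_congr rfl fun _ _ => by ring
  rw [hsw, hsw] at hcomm
  have : ∑ a, p a * curvatureEndo s G a c i j x =
      ∑ a, partialDeriv s i (christoffel s G a j c) x * p a
      - ∑ a, partialDeriv s j (christoffel s G a i c) x * p a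
      + ∑ a, p a * ∑ b, Γ a i b * Γ b j c - ∑ a, p a * ∑ b, Γ a j b * Γ b i c := by
    rw [← Finset.sum_sub_distrib, ← Finset.sum_add_distrib, ← Finset.sum_sub_distrib]
    refine Finset.sum_congr rfl fun a _ => ?_
    unfold curvatureEndo
    rw [Finset.sum_sub_distrib]
    ring
  rw [this]
  linarith

/-- If `|dr| = 1`, then `Hess r (·, grad r) = 0`. -/
theorem sum_hessComp_mul_gradComp (hG : SmoothCoordMetric s T G) (hr : SmoothFn s T r)
    (hu : ∀ y ∈ T, gradNormSq s G r y = 1) (hx : x ∈ T) (i : Fin k) :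
    ∑ j, hessComp s G r i j x * gradComp s G r j x = 0 := by
  have hD := hG.domain
  have hp (a : Fin k) := hr.partialDeriv hD a
  have hP (a : Fin k) := hG.smooth_gradComp hr a
  set Γ : Fin k → Fin k → Fin k → ℝ := fun l i j => christoffel s G l i j x with hΓ
  set p : Fin k → ℝ := fun a => partialDeriv s a r x with hpdef
  set P : Fin k → ℝ := fun a => gradComp s G r a x with hPdef
  set dp : Fin k → ℝ := fun a => partialDeriv s i (partialDeriv s a r) x
  set dP : Fin k → ℝ := fun a => partialDeriv s i (gradComp s G r a) x
  have hlow (j : Fin k) : ∑ a, P a * G x a j = p j := hG.sum_gradComp_mul hx j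
  have h1 : ∑ a, dp a * P a + ∑ a, p a * dP a = 0 := by
    have h : partialDeriv s i (gradNormSq s G r) x = partialDeriv s i (fun _ => (1 : ℝ)) x :=
      partialDeriv_congr hD hx i fun y hy => hu y hy
    unfold gradNormSq at h
    rw [partialDeriv_const, partialDeriv_sum hD hx fun a _ => (hp a).mul (hP a)] at h
    rw [← h, ← Finset.sum_add_distrib]
    exact Finset.sum_congr rfl fun a _ => (partialDeriv_mul hD hx (hp a) (hP a) i).symm
  have h2 (j : Fin k) : dp j = ∑ a, dP a * G x a j
      + ∑ a, P a * (∑ b, G x a b * Γ b i j + ∑ b, G x j b * Γ b i a) := by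
    rw [← Finset.sum_add_distrib]
    change partialDeriv s i (partialDeriv s j r) x = _
    rw [← partialDeriv_congr hD hx i fun y hy => hG.sum_gradComp_mul (r := r) hy j,
        partialDeriv_sum hD hx fun a _ => (hP a).mul (hG.smooth a j)]
    refine Finset.sum_congr rfl fun a _ => ?_
    rw [partialDeriv_mul hD hx (hP a) (hG.smooth a j), hG.partialDeriv_eq hx]
  have e1 : ∑ j, (∑ a, dP a * G x a j) * P j = ∑ a, p a * dP a := by
    simp only [Finset.sum_mul, ← hlow]
    rw [Finset.sum_comm]
    exact Finset.sum_congr rfl fun a _ => Finset.sum_congr rfl fun b _ => by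
      rw [hG.symm hx a b]; ring
  set C := ∑ j, (∑ b, Γ b i j * p b) * P j with hC
  have e2 : ∑ j, (∑ a, P a * ∑ b, G x a b * Γ b i j) * P j = C := by
    refine Finset.sum_congr rfl fun j _ => ?_
    congr 1
    simp only [Finset.mul_sum, ← hlow]
    rw [Finset.sum_comm]
    exact Finset.sum_congr rfl fun a _ => Finset.sum_congr rfl fun b _ => by ring
  have e3 : ∑ j, (∑ a, P a * ∑ b, G x j b * Γ b i a) * P j = C := by
    rw [← e2]
    simp only [Finset.sum_mul]
    rw [Finset.sum_comm]
    exact Finset.sum_congr rfl fun a _ => Finset.sum_congr rfl fun b _ => by ring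
  have h3 : ∑ j, dp j * P j = ∑ a, p a * dP a + (C + C) := by
    rw [← e1]
    nth_rewrite 1 [← e2]
    rw [← e3, ← Finset.sum_add_distrib, ← Finset.sum_add_distrib]
    refine Finset.sum_congr rfl fun j _ => ?_
    rw [h2 j]
    simp only [mul_add, Finset.sum_add_distrib]
    ring
  have h4 : ∑ j, hessComp s G r i j x * P j = ∑ j, dp j * P j - C := by
    rw [hC, ← Finset.sum_sub_distrib]
    exact Finset.sum_congr rfl fun j _ => sub_mul _ _ _
  rw [h4]
  linarith

end SmoothCoordMetric

end CornerGeometry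

namespace CornerGeometry

/-! ### The quadrant and its face -/

section Quadrant

variable {m : ℕ}

theorem mem_range_cornerModel {x : EuclideanSpace ℝ (Fin (m + 2))} :
    x ∈ range (cornerModel m) ↔ 0 ≤ x 0 ∧ 0 ≤ x 1 := by
  rw [show range (cornerModel m) = _ from range_cornerSpace m]; rfl

theorem convex_range_cornerModel : Convex ℝ (range (cornerModel m)) :=
  (cornerModel m).convex_range

theorem rayStable_range_cornerModel : RayStable (range (cornerModel m)) := by
  intro x hx i t ht
  rw [mem_range_cornerModel] at hx ⊢
  have (b : Fin (m + 2)) : 0 ≤ t * (EuclideanSpace.single i (1 : ℝ)) b := by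
    rw [PiLp.single_apply]; split_ifs <;> simp [ht]
  exact ⟨add_nonneg hx.1 (this 0), add_nonneg hx.2 (this 1)⟩

theorem chartDomain_corner {T : Set (EuclideanSpace ℝ (Fin (m + 2)))}
    (hT : T ⊆ range (cornerModel m)) (hn : ∀ x ∈ T, T ∈ 𝓝[range (cornerModel m)] x) :
    ChartDomain (range (cornerModel m)) T :=
  .of_convex convex_range_cornerModel (cornerModel m).nonempty_interior hT hn

theorem chartDomain_face {T : Set (EuclideanSpace ℝ (Fin (m + 1)))}
    (hT : T ⊆ faceDomain m) (hn : ∀ x ∈ T, T ∈ 𝓝[faceDomain m] x) :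
    ChartDomain (faceDomain m) T := by
  refine .of_convex ?_ ?_ hT hn
  · intro x hx y hy a b ha hb _
    have h1 : 0 ≤ x 0 := hx
    have h2 : 0 ≤ y 0 := hy
    change 0 ≤ a * x 0 + b * y 0
    positivity
  · refine ⟨WithLp.toLp 2 fun _ => 1, ?_⟩
    rw [mem_interior_iff_mem_nhds]
    have c0 : Continuous fun x : EuclideanSpace ℝ (Fin (m + 1)) => x 0 := by fun_prop
    exact Filter.mem_of_superset ((isOpen_lt continuous_const c0).mem_nhds (by simp))
      fun x (hx : 0 < x 0) => hx.le

/-- The embedding `z ↦ (0, z)` of the coordinate face, as a continuous linear map. -/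
noncomputable def faceEmbL (m : ℕ) :
    EuclideanSpace ℝ (Fin (m + 1)) →L[ℝ] EuclideanSpace ℝ (Fin (m + 2)) :=
  LinearMap.toContinuousLinearMap
    { toFun := faceEmb
      map_add' := fun x y => by
        ext i; refine Fin.cases ?_ (fun i => ?_) i <;> simp [faceEmb]
      map_smul' := fun c x => by
        ext i; refine Fin.cases ?_ (fun i => ?_) i <;> simp [faceEmb] }

theorem faceEmbL_apply (z : EuclideanSpace ℝ (Fin (m + 1))) : faceEmbL m z = faceEmb z := rfl

@[simp] theorem faceEmb_zero (z : EuclideanSpace ℝ (Fin (m + 1))) : faceEmb z 0 = 0 := rfl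

@[simp] theorem faceEmb_succ (z : EuclideanSpace ℝ (Fin (m + 1))) (i : Fin (m + 1)) :
    faceEmb z i.succ = z i := rfl

@[simp] theorem faceEmb_one (z : EuclideanSpace ℝ (Fin (m + 1))) : faceEmb z 1 = z 0 := rfl

theorem faceEmb_single (i : Fin (m + 1)) :
    faceEmb (EuclideanSpace.single i (1 : ℝ)) = EuclideanSpace.single i.succ 1 := by
  ext j
  refine Fin.cases ?_ (fun j => ?_) j
  · simp [(Fin.succ_ne_zero i).symm]
  · simp

theorem faceEmb_mem_range {z : EuclideanSpace ℝ (Fin (m + 1))} (hz : z ∈ faceDomain m) :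
    faceEmb z ∈ range (cornerModel m) :=
  mem_range_cornerModel.2 ⟨le_rfl, hz⟩

variable {T : Set (EuclideanSpace ℝ (Fin (m + 2)))}

theorem ChartDomain.face (h : ChartDomain (range (cornerModel m)) T) :
    ChartDomain (faceDomain m) (faceEmb ⁻¹' T) := by
  refine chartDomain_face (fun z hz => (mem_range_cornerModel.1 (h.subset hz)).2) fun z hz => ?_
  have hc : ContinuousWithinAt (faceEmbL m) (faceDomain m) z :=
    (faceEmbL m).continuous.continuousWithinAt
  exact hc.tendsto_nhdsWithin (fun z hz => faceEmb_mem_range hz) (h.mem_nhdsWithin _ hz)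

theorem SmoothFn.face {f : EuclideanSpace ℝ (Fin (m + 2)) → ℝ}
    (hf : SmoothFn (range (cornerModel m)) T f) :
    SmoothFn (faceDomain m) (faceEmb ⁻¹' T) fun z => f (faceEmb z) := fun z hz =>
  ContDiffWithinAt.comp z (hf _ hz) (faceEmbL m).contDiff.contDiffWithinAt
    fun _ hz => faceEmb_mem_range hz

/-- Tangential derivatives along the face are derivatives within the face. -/
theorem partialDeriv_face (h : ChartDomain (range (cornerModel m)) T)
    {f : EuclideanSpace ℝ (Fin (m + 2)) → ℝ} (hf : SmoothFn (range (cornerModel m)) T f)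
    {z : EuclideanSpace ℝ (Fin (m + 1))} (hz : faceEmb z ∈ T) (i : Fin (m + 1)) :
    partialDeriv (faceDomain m) i (fun z => f (faceEmb z)) z =
      partialDeriv (range (cornerModel m)) i.succ f (faceEmb z) := by
  have h1 : HasFDerivWithinAt (fun z => f (faceEmb z))
      ((fderivWithin ℝ f (range (cornerModel m)) (faceEmb z)).comp (faceEmbL m))
      (faceDomain m) z :=
    HasFDerivWithinAt.comp z (hf.differentiableWithinAt hz).hasFDerivWithinAt
      (faceEmbL m).hasFDerivWithinAt fun _ hz => faceEmb_mem_range hz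
  unfold partialDeriv
  rw [h1.fderivWithin (h.face.uniqueDiffOn z (h.face.subset hz))]
  rw [ContinuousLinearMap.comp_apply, faceEmbL_apply, faceEmb_single]

end Quadrant

/-! ### The induced metric on a face -/

section FaceMetric

variable {m : ℕ} {T : Set (EuclideanSpace ℝ (Fin (m + 2)))}
  {G : EuclideanSpace ℝ (Fin (m + 2)) → Matrix (Fin (m + 2)) (Fin (m + 2)) ℝ}

/-- The metric induced on the face `{x_0 = 0}`. -/
def inducedMetric (G : EuclideanSpace ℝ (Fin (m + 2)) → Matrix (Fin (m + 2)) (Fin (m + 2)) ℝ)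
    (z : EuclideanSpace ℝ (Fin (m + 1))) : Matrix (Fin (m + 1)) (Fin (m + 1)) ℝ :=
  fun a b => G (faceEmb z) a.succ b.succ

theorem SmoothCoordMetric.face (hG : SmoothCoordMetric (range (cornerModel m)) T G) :
    SmoothCoordMetric (faceDomain m) (faceEmb ⁻¹' T) (inducedMetric G) where
  domain := hG.domain.face
  smooth i j := (hG.smooth i.succ j.succ).face
  posDef _ hz := (hG.posDef _ hz).submatrix (Fin.succ_injective _)

/-- The inverse of the induced metric is a Schur complement. -/
theorem SmoothCoordMetric.inducedMetric_inv
    (hG : SmoothCoordMetric (range (cornerModel m)) T G)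
    {z : EuclideanSpace ℝ (Fin (m + 1))} (hz : faceEmb z ∈ T) (i j : Fin (m + 1)) :
    (inducedMetric G z)⁻¹ i j = (G (faceEmb z))⁻¹ i.succ j.succ -
      (G (faceEmb z))⁻¹ i.succ 0 * (G (faceEmb z))⁻¹ 0 j.succ / (G (faceEmb z))⁻¹ 0 0 := by
  set A := G (faceEmb z) with hA
  have h0 : A⁻¹ 0 0 ≠ 0 := (hG.inv_diag_pos hz 0).ne'
  have key : (inducedMetric G z)⁻¹ = .of fun i j : Fin (m + 1) =>
      A⁻¹ i.succ j.succ - A⁻¹ i.succ 0 * A⁻¹ 0 j.succ / A⁻¹ 0 0 := by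
    refine Matrix.inv_eq_right_inv ?_
    ext a c
    have h1 (c : Fin (m + 2)) : ∑ b : Fin (m + 1), A a.succ b.succ * A⁻¹ b.succ c =
        (if a.succ = c then 1 else 0) - A a.succ 0 * A⁻¹ 0 c := by
      have h2 := hG.sum_mul_inv hz a.succ c
      rw [Fin.sum_univ_succ] at h2
      exact eq_sub_of_add_eq' h2
    rw [Matrix.mul_apply, Matrix.one_apply]
    calc ∑ b : Fin (m + 1), A a.succ b.succ *
          (A⁻¹ b.succ c.succ - A⁻¹ b.succ 0 * A⁻¹ 0 c.succ / A⁻¹ 0 0)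
        = ∑ b : Fin (m + 1), A a.succ b.succ * A⁻¹ b.succ c.succ
          - (∑ b : Fin (m + 1), A a.succ b.succ * A⁻¹ b.succ 0) * (A⁻¹ 0 c.succ / A⁻¹ 0 0) := by
          rw [Finset.sum_mul, ← Finset.sum_sub_distrib]
          exact Finset.sum_congr rfl fun b _ => by ring
      _ = _ := by
          rw [h1, h1, if_neg (Fin.succ_ne_zero a)]
          simp only [Fin.succ_inj]
          field_simp
          ring
  rw [key]; rfl

/-- If the face `{x_0 = 0}` is totally geodesic, its Christoffel symbols are those of the ambient
metric. -/
theorem SmoothCoordMetric.christoffel_inducedMetric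
    (hG : SmoothCoordMetric (range (cornerModel m)) T G)
    {z : EuclideanSpace ℝ (Fin (m + 1))} (hz : faceEmb z ∈ T) {i j : Fin (m + 1)}
    (hΓ : christoffel (range (cornerModel m)) G 0 i.succ j.succ (faceEmb z) = 0)
    (l : Fin (m + 1)) :
    christoffel (faceDomain m) (inducedMetric G) l i j z =
      christoffel (range (cornerModel m)) G l.succ i.succ j.succ (faceEmb z) := by
  have h1 (a : Fin (m + 1)) : ∑ l, inducedMetric G z a l *
      christoffel (faceDomain m) (inducedMetric G) l i j z = ∑ l, inducedMetric G z a l *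
        christoffel (range (cornerModel m)) G l.succ i.succ j.succ (faceEmb z) := by
    have h2 := hG.sum_mul_christoffel hz a.succ i.succ j.succ
    rw [Fin.sum_univ_succ, hΓ, mul_zero, zero_add] at h2
    have hd (c a b : Fin (m + 1)) : partialDeriv (faceDomain m) c
        (fun z => inducedMetric G z a b) z = partialDeriv (range (cornerModel m)) c.succ
          (fun x => G x a.succ b.succ) (faceEmb z) :=
      partialDeriv_face hG.domain (hG.smooth a.succ b.succ) hz c
    rw [hG.face.sum_mul_christoffel hz, hd, hd, hd]
    exact h2.symm
  calc christoffel (faceDomain m) (inducedMetric G) l i j z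
      = ∑ b, (∑ a, (inducedMetric G z)⁻¹ l a * inducedMetric G z a b) *
          christoffel (faceDomain m) (inducedMetric G) b i j z := by
        simp [hG.face.sum_inv_mul (show z ∈ faceEmb ⁻¹' T from hz)]
    _ = ∑ a, (inducedMetric G z)⁻¹ l a * ∑ b, inducedMetric G z a b *
          christoffel (faceDomain m) (inducedMetric G) b i j z := by
        simp only [Finset.sum_mul, Finset.mul_sum, mul_assoc]
        exact Finset.sum_comm
    _ = ∑ a, (inducedMetric G z)⁻¹ l a * ∑ b, inducedMetric G z a b *
          christoffel (range (cornerModel m)) G b.succ i.succ j.succ (faceEmb z) := by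
        simp only [h1]
    _ = ∑ b, (∑ a, (inducedMetric G z)⁻¹ l a * inducedMetric G z a b) *
          christoffel (range (cornerModel m)) G b.succ i.succ j.succ (faceEmb z) := by
        simp only [Finset.sum_mul, Finset.mul_sum, mul_assoc]
        exact Finset.sum_comm
    _ = _ := by simp [hG.face.sum_inv_mul (show z ∈ faceEmb ⁻¹' T from hz)]

end FaceMetric

/-! ### The corner in an adapted coordinate system -/

/-- The data in an adapted chart: the metric `H = r⁻² G` away from the face `{x_0 = 0}`, where `G`
is smooth up to the boundary and `r` vanishes on the face. -/
structure CornerCoords {m : ℕ} (T : Set (EuclideanSpace ℝ (Fin (m + 2))))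
    (G H : EuclideanSpace ℝ (Fin (m + 2)) → Matrix (Fin (m + 2)) (Fin (m + 2)) ℝ)
    (r : EuclideanSpace ℝ (Fin (m + 2)) → ℝ) : Prop where
  metric : SmoothCoordMetric (range (cornerModel m)) T G
  smooth : SmoothFn (range (cornerModel m)) T r
  eq_zero : ∀ x ∈ T, x 0 = 0 → r x = 0
  pos : ∀ x ∈ T, 0 < x 0 → 0 < r x
  conformal : ∀ x ∈ T, 0 < x 0 → H x = (r x ^ 2)⁻¹ • G x

/-- The principal curvature of the face `{x_1 = 0}`, if this face is umbilic. -/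
noncomputable def faceCurvature {m : ℕ}
    (G : EuclideanSpace ℝ (Fin (m + 2)) → Matrix (Fin (m + 2)) (Fin (m + 2)) ℝ)
    (x : EuclideanSpace ℝ (Fin (m + 2))) : ℝ :=
  christoffel (range (cornerModel m)) G 1 0 0 x / (√((G x)⁻¹ 1 1) * G x 0 0)

namespace CornerCoords

variable {m : ℕ} {T : Set (EuclideanSpace ℝ (Fin (m + 2)))}
  {G H : EuclideanSpace ℝ (Fin (m + 2)) → Matrix (Fin (m + 2)) (Fin (m + 2)) ℝ}
  {r : EuclideanSpace ℝ (Fin (m + 2)) → ℝ} {x : EuclideanSpace ℝ (Fin (m + 2))}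

local notation "𝔻" => range (cornerModel m)

theorem restrict (h : CornerCoords T G H r) {T' : Set (EuclideanSpace ℝ (Fin (m + 2)))}
    (hD : ChartDomain 𝔻 T') (hT : T' ⊆ T) : CornerCoords T' G H r where
  metric := h.metric.restrict hD hT
  smooth := h.smooth.mono hT
  eq_zero x hx := h.eq_zero x (hT hx)
  pos x hx := h.pos x (hT hx)
  conformal x hx := h.conformal x (hT hx)

theorem zero_le (h : CornerCoords T G H r) (hx : x ∈ T) : 0 ≤ x 0 :=
  (mem_range_cornerModel.1 (h.metric.domain.subset hx)).1

theorem nonneg (h : CornerCoords T G H r) (hx : x ∈ T) : 0 ≤ r x := by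
  rcases (h.zero_le hx).eq_or_lt with h0 | h0
  · exact (h.eq_zero x hx h0.symm).ge
  · exact (h.pos x hx h0).le

/-- An identity on the face `{x_b = 0}` away from the face at infinity extends to the face at
infinity. -/
theorem eq_of_eq_pos (h : CornerCoords T G H r) (hx : x ∈ T) (hx0 : x 0 = 0)
    {f g : EuclideanSpace ℝ (Fin (m + 2)) → ℝ} (hf : SmoothFn 𝔻 T f) (hg : SmoothFn 𝔻 T g)
    {b : Fin (m + 2)} (hb : b ≠ 0) (hxb : x b = 0)
    (hfg : ∀ y ∈ T, 0 < y 0 → y b = 0 → f y = g y) : f x = g x := by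
  refine eq_of_eq_ray rayStable_range_cornerModel h.metric.domain hx (hf.continuousWithinAt hx)
    (hg.continuousWithinAt hx) 0 fun t ht hT => hfg _ hT ?_ ?_
  · simp [hx0, ht]
  · simp [hxb, hb]

/-- Einstein's equation makes the Hessian of a geodesic defining function vanish on the face at
infinity. -/
theorem hessComp_eq_zero (hm : 1 ≤ m) (h : CornerCoords T G H r)
    (hu : ∀ y ∈ T, gradNormSq 𝔻 G r y = 1)
    (hE : ∀ y ∈ T, 0 < y 0 → ∀ i j, ricci 𝔻 H i j y = -((m : ℝ) + 1) * H y i j)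
    (hx : x ∈ T) (hx0 : x 0 = 0) (i j : Fin (m + 2)) : hessComp 𝔻 G r i j x = 0 := by
  have hG := h.metric
  have hD := hG.domain
  set div : EuclideanSpace ℝ (Fin (m + 2)) → ℝ := fun x =>
    ∑ i, partialDeriv 𝔻 i (gradComp 𝔻 G r i) x
      + ∑ i, ∑ a, christoffel 𝔻 G i i a x * gradComp 𝔻 G r a x with hdiv
  have hdivs : SmoothFn 𝔻 T div :=
    (SmoothFn.sum fun i _ => (hG.smooth_gradComp h.smooth i).partialDeriv hD i).add <|
      SmoothFn.sum fun i _ => SmoothFn.sum fun a _ =>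
        (hG.smooth_christoffel i i a).mul (hG.smooth_gradComp h.smooth a)
  -- the identity obtained by multiplying Einstein's equation by `r`
  have key (j c : Fin (m + 2)) : (m : ℝ) * hessComp 𝔻 G r j c x + G x j c * div x = 0 := by
    have hs : SmoothFn 𝔻 T fun x => r x * ricci 𝔻 G j c x
        + ((m : ℝ) * hessComp 𝔻 G r j c x + G x j c * div x) :=
      (h.smooth.mul (hG.smooth_ricci j c)).add <|
        ((SmoothFn.const _).mul (hG.smooth_hessComp h.smooth j c)).add ((hG.smooth j c).mul hdivs)
    have h1 := eq_of_eq_ray rayStable_range_cornerModel hD hx (hs.continuousWithinAt hx)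
      ((SmoothFn.const 0).continuousWithinAt hx) 0 fun t ht hT => ?_
    · simpa [h.eq_zero x hx hx0] using h1
    · set y := x + t • EuclideanSpace.single 0 (1 : ℝ) with hy
      have hy0 : 0 < y 0 := by simp [hy, hx0, ht]
      have hT0 : y ∈ {y ∈ T | 0 < y 0} := ⟨hT, hy0⟩
      have hr0 : r y ≠ 0 := (h.pos y hT hy0).ne'
      have h2 := SmoothCoordMetric.conformal_ricci (H := H) (r := r)
        (fun y hy => h.conformal y hy.1 hy.2) (fun y hy => (h.pos y hy.1 hy.2).ne')
        (hG.restrict (hD.inter_pos 0) fun _ hy => hy.1) (h.smooth.mono fun _ hy => hy.1) hT0 j c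
      rw [hE y hT hy0, hu y hT, h.conformal y hT hy0, Matrix.smul_apply, smul_eq_mul] at h2
      push_cast at h2
      simp only [hdiv]
      field_simp at h2
      have h3 : r y * (r y * ricci 𝔻 G j c y + ((m : ℝ) * hessComp 𝔻 G r j c y + G y j c *
          (∑ i, partialDeriv 𝔻 i (gradComp 𝔻 G r i) y
            + ∑ i, ∑ a, christoffel 𝔻 G i i a y * gradComp 𝔻 G r a y))) = 0 := by
        linear_combination -h2
      exact (mul_eq_zero.1 h3).resolve_left hr0
  have hdiv0 : div x = 0 := by
    have h1 (j : Fin (m + 2)) : partialDeriv 𝔻 j r x * div x = 0 := by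
      have h2 := hG.sum_hessComp_mul_gradComp h.smooth hu hx j
      have h3 : ∑ c, ((m : ℝ) * hessComp 𝔻 G r j c x + G x j c * div x) * gradComp 𝔻 G r c x
          = (m : ℝ) * ∑ c, hessComp 𝔻 G r j c x * gradComp 𝔻 G r c x
            + (∑ c, gradComp 𝔻 G r c x * G x c j) * div x := by
        rw [Finset.mul_sum, Finset.sum_mul, ← Finset.sum_add_distrib]
        exact Finset.sum_congr rfl fun c _ => by rw [hG.symm hx c j]; ring
      rw [h2, hG.sum_gradComp_mul hx] at h3
      simpa [key] using h3.symm
    have h2 : gradNormSq 𝔻 G r x * div x = 0 := by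
      unfold gradNormSq
      rw [Finset.sum_mul]
      exact Finset.sum_eq_zero fun j _ => by rw [mul_right_comm, h1, zero_mul]
    rwa [hu x hx, one_mul] at h2
  have := key i j
  rw [hdiv0, mul_zero, add_zero] at this
  exact (mul_eq_zero.1 this).resolve_left (by positivity)

theorem partialDeriv_eq_zero (h : CornerCoords T G H r) (hx : x ∈ T) (hx0 : x 0 = 0)
    {a : Fin (m + 2)} (ha : a ≠ 0) : partialDeriv 𝔻 a r x = 0 :=
  partialDeriv_eq_zero_face rayStable_range_cornerModel h.metric.domain hx h.smooth hx0 ha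
    h.eq_zero

theorem gradComp_eq (h : CornerCoords T G H r) (hx : x ∈ T) (hx0 : x 0 = 0)
    (a : Fin (m + 2)) : gradComp 𝔻 G r a x = (G x)⁻¹ a 0 * partialDeriv 𝔻 0 r x := by
  unfold gradComp
  rw [Finset.sum_eq_single 0 (fun b _ hb => by rw [h.partialDeriv_eq_zero hx hx0 hb, mul_zero])
    (by simp)]

/-- If `|dr| = 1`, the transversal derivative of `r` on the face at infinity is determined by the
metric, because `r` is nonnegative. -/
theorem partialDeriv_zero_eq (h : CornerCoords T G H r) (hx : x ∈ T) (hx0 : x 0 = 0)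
    (hu : gradNormSq 𝔻 G r x = 1) : partialDeriv 𝔻 0 r x = (√((G x)⁻¹ 0 0))⁻¹ := by
  have h1 : 0 ≤ partialDeriv 𝔻 0 r x :=
    partialDeriv_nonneg rayStable_range_cornerModel h.metric.domain hx h.smooth 0
      (h.eq_zero x hx hx0) fun y hy => h.nonneg hy
  have h2 := h.metric.inv_diag_pos hx 0
  unfold gradNormSq at hu
  rw [Finset.sum_eq_single 0 (fun b _ hb => by rw [h.partialDeriv_eq_zero hx hx0 hb, zero_mul])
    (by simp), h.gradComp_eq hx hx0] at hu
  rw [← Real.sqrt_inv, eq_comm, Real.sqrt_eq_iff_mul_self_eq (by positivity) h1]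
  field_simp
  linarith

/-- On the face at infinity the gradient of `r` is the unit normal. -/
theorem gradComp_eq_inwardNormal (h : CornerCoords T G H r) (hx : x ∈ T) (hx0 : x 0 = 0)
    (hu : gradNormSq 𝔻 G r x = 1) (a : Fin (m + 2)) :
    gradComp 𝔻 G r a x = inwardNormal G 0 x a := by
  rw [h.gradComp_eq hx hx0, h.partialDeriv_zero_eq hx hx0 hu]
  rfl

/-- The face at infinity is totally geodesic. -/
theorem christoffel_zero_eq_zero (h : CornerCoords T G H r)
    (hx : x ∈ T) (hx0 : x 0 = 0) (hu : gradNormSq 𝔻 G r x = 1)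
    (hH : ∀ i j, hessComp 𝔻 G r i j x = 0) {i j : Fin (m + 2)}
    (hi : i ≠ 0) (hj : j ≠ 0) : christoffel 𝔻 G 0 i j x = 0 := by
  have h1 := hH i j
  unfold hessComp at h1
  rw [partialDeriv_eq_zero_face rayStable_range_cornerModel h.metric.domain hx
    (h.smooth.partialDeriv h.metric.domain j) hx0 hi
    fun y hy hy0 => h.partialDeriv_eq_zero hy hy0 hj,
    Finset.sum_eq_single 0 (fun b _ hb => by rw [h.partialDeriv_eq_zero hx hx0 hb, mul_zero])
    (by simp), h.partialDeriv_zero_eq hx hx0 hu] at h1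
  have h2 : (√((G x)⁻¹ 0 0))⁻¹ ≠ 0 :=
    inv_ne_zero (Real.sqrt_pos.2 (h.metric.inv_diag_pos hx 0)).ne'
  simpa [h2] using h1

theorem smooth_faceCurvature (h : CornerCoords T G H r) :
    SmoothFn 𝔻 T (faceCurvature G) :=
  (h.metric.smooth_christoffel 1 0 0).div
    ((h.metric.smooth_sqrt_inv 1).mul (h.metric.smooth 0 0)) fun _ hx =>
      mul_ne_zero (Real.sqrt_pos.2 (h.metric.inv_diag_pos hx 1)).ne' (h.metric.diag_pos hx 0).ne'

/-- An umbilic face stays umbilic under the conformal change; the factors are related by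
`r * η = lam - dr(ν)`. -/
theorem christoffel_of_umbilic (h : CornerCoords T G H r) {lam : ℝ}
    (hQ : ∀ y ∈ T, 0 < y 0 → y 1 = 0 → ∀ i j, i ≠ 1 → j ≠ 1 →
      secondFundamentalForm 𝔻 H 1 y i j = lam * H y i j)
    (hx : x ∈ T) (hx0 : 0 < x 0) (hx1 : x 1 = 0) {i j : Fin (m + 2)} (hi : i ≠ 1) (hj : j ≠ 1) :
    r x * christoffel 𝔻 G 1 i j x =
      (lam * √((G x)⁻¹ 1 1) - gradComp 𝔻 G r 1 x) * G x i j := by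
  have hG := h.metric
  have hT0 : x ∈ {y ∈ T | 0 < y 0} := ⟨hx, hx0⟩
  have hG' := hG.restrict (hG.domain.inter_pos 0) fun _ hy => hy.1
  have hr := h.pos x hx hx0
  have hH : EqOn H (fun x => (r x ^ 2)⁻¹ • G x) {y ∈ T | 0 < y 0} :=
    fun y hy => h.conformal y hy.1 hy.2
  have h1 := SmoothCoordMetric.conformal_christoffel hH (fun y hy => (h.pos y hy.1 hy.2).ne')
    hG' (h.smooth.mono fun _ hy => hy.1) hT0 1 i j
  have h2 := SmoothCoordMetric.conformal_inv hH (fun y hy => (h.pos y hy.1 hy.2).ne') hG' hT0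
  have hHm : SmoothCoordMetric 𝔻 {y ∈ T | 0 < y 0} H := by
    refine ⟨hG'.domain, fun i j => ?_, fun y hy => ?_⟩
    · refine SmoothFn.congr hG'.domain (f := fun x => (r x ^ 2)⁻¹ * G x i j) ?_ fun y hy => ?_
      · exact (((h.smooth.mono fun _ hy => hy.1).pow 2).inv
          fun y hy => (pow_pos (h.pos y hy.1 hy.2) 2).ne').mul (hG'.smooth i j)
      · simp [hH hy]
    · rw [hH hy]
      have := h.pos y hy.1 hy.2
      exact (hG'.posDef y hy).smul (by positivity)
  have h3 := hQ x hx hx0 hx1 i j hi hj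
  rw [hHm.secondFundamentalForm_eq hT0, h1, h2, h.conformal x hx hx0] at h3
  simp only [conformalTensor, if_neg hi.symm, if_neg hj.symm, Matrix.smul_apply, smul_eq_mul] at h3
  rw [Real.sqrt_mul (by positivity), Real.sqrt_sq hr.le] at h3
  have h4 := Real.sqrt_pos.2 (hG.inv_diag_pos hx 1)
  field_simp at h3
  linarith

/-- `r * η = lam - dr(ν)` on the umbilic face: this determines the principal curvature away from the
face at infinity. -/
theorem mul_faceCurvature (h : CornerCoords T G H r) {lam : ℝ}
    (hQ : ∀ y ∈ T, 0 < y 0 → y 1 = 0 → ∀ i j, i ≠ 1 → j ≠ 1 →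
      secondFundamentalForm 𝔻 H 1 y i j = lam * H y i j)
    (hx : x ∈ T) (hx0 : 0 < x 0) (hx1 : x 1 = 0) :
    r x * faceCurvature G x = lam - gradComp 𝔻 G r 1 x / √((G x)⁻¹ 1 1) := by
  have h1 := h.christoffel_of_umbilic hQ hx hx0 hx1 (i := 0) (j := 0) (by simp) (by simp)
  have h2 := Real.sqrt_pos.2 (h.metric.inv_diag_pos hx 1)
  have h3 := h.metric.diag_pos hx 0
  unfold faceCurvature
  rw [← mul_div_assoc, h1]
  field_simp

/-- The second fundamental form of the umbilic face is `faceCurvature` times the metric, including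
at the corner. -/
theorem christoffel_eq_faceCurvature (h : CornerCoords T G H r) {lam : ℝ}
    (hQ : ∀ y ∈ T, 0 < y 0 → y 1 = 0 → ∀ i j, i ≠ 1 → j ≠ 1 →
      secondFundamentalForm 𝔻 H 1 y i j = lam * H y i j)
    (hx : x ∈ T) (hx1 : x 1 = 0) {i j : Fin (m + 2)} (hi : i ≠ 1) (hj : j ≠ 1) :
    christoffel 𝔻 G 1 i j x = √((G x)⁻¹ 1 1) * faceCurvature G x * G x i j := by
  have hpos {y} (hy : y ∈ T) (hy0 : 0 < y 0) (hy1 : y 1 = 0) :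
      christoffel 𝔻 G 1 i j y = √((G y)⁻¹ 1 1) * faceCurvature G y * G y i j := by
    have h1 := h.christoffel_of_umbilic hQ hy hy0 hy1 hi hj
    have h2 := h.mul_faceCurvature hQ hy hy0 hy1
    have h3 := Real.sqrt_pos.2 (h.metric.inv_diag_pos hy 1)
    refine mul_left_cancel₀ (h.pos y hy hy0).ne' ?_
    rw [h1, show r y * (√((G y)⁻¹ 1 1) * faceCurvature G y * G y i j) =
      √((G y)⁻¹ 1 1) * (r y * faceCurvature G y) * G y i j by ring, h2]
    field_simp
  rcases (h.zero_le hx).eq_or_lt with h0 | h0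
  · exact h.eq_of_eq_pos hx h0.symm (h.metric.smooth_christoffel 1 i j)
      (((h.metric.smooth_sqrt_inv 1).mul h.smooth_faceCurvature).mul (h.metric.smooth i j))
      (by simp) hx1 fun y hy h1 h2 => hpos hy h1 h2
  · exact hpos hx h0 hx1

/-- The angle between the two faces along the corner is constant. -/
theorem gradComp_one_eq (h : CornerCoords T G H r) {lam : ℝ}
    (hQ : ∀ y ∈ T, 0 < y 0 → y 1 = 0 → ∀ i j, i ≠ 1 → j ≠ 1 →
      secondFundamentalForm 𝔻 H 1 y i j = lam * H y i j)
    (hx : x ∈ T) (hx0 : x 0 = 0) (hx1 : x 1 = 0) :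
    gradComp 𝔻 G r 1 x = lam * √((G x)⁻¹ 1 1) := by
  have h1 := h.eq_of_eq_pos hx hx0 (h.smooth.mul h.smooth_faceCurvature)
    ((SmoothFn.const lam).sub ((h.metric.smooth_gradComp h.smooth 1).div
      (h.metric.smooth_sqrt_inv 1) fun y hy =>
        (Real.sqrt_pos.2 (h.metric.inv_diag_pos hy 1)).ne')) (b := 1) (by simp) hx1
    fun y hy h1 h2 => h.mul_faceCurvature hQ hy h1 h2
  have h3 := Real.sqrt_pos.2 (h.metric.inv_diag_pos hx 1)
  rw [h.eq_zero x hx hx0, zero_mul] at h1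
  field_simp at h1
  linarith

/-- The angle between the faces, expressed by the inverse metric. -/
theorem inv_zero_one_eq (h : CornerCoords T G H r) {lam : ℝ}
    (hQ : ∀ y ∈ T, 0 < y 0 → y 1 = 0 → ∀ i j, i ≠ 1 → j ≠ 1 →
      secondFundamentalForm 𝔻 H 1 y i j = lam * H y i j)
    (hx : x ∈ T) (hx0 : x 0 = 0) (hx1 : x 1 = 0) (hu : gradNormSq 𝔻 G r x = 1) :
    (G x)⁻¹ 1 0 = lam * √((G x)⁻¹ 0 0) * √((G x)⁻¹ 1 1) := by
  have h1 := h.gradComp_one_eq hQ hx hx0 hx1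
  have h3 := Real.sqrt_pos.2 (h.metric.inv_diag_pos hx 0)
  rw [h.gradComp_eq hx hx0, h.partialDeriv_zero_eq hx hx0 hu] at h1
  field_simp at h1
  linarith

variable {z : EuclideanSpace ℝ (Fin (m + 1))}

theorem inducedMetric_inv_zero_zero (h : CornerCoords T G H r) {lam : ℝ}
    (hQ : ∀ y ∈ T, 0 < y 0 → y 1 = 0 → ∀ i j, i ≠ 1 → j ≠ 1 →
      secondFundamentalForm 𝔻 H 1 y i j = lam * H y i j)
    (hz : faceEmb z ∈ T) (hz0 : z 0 = 0) (hu : gradNormSq 𝔻 G r (faceEmb z) = 1) :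
    (inducedMetric G z)⁻¹ 0 0 = (1 - lam ^ 2) * (G (faceEmb z))⁻¹ 1 1 := by
  have hG := h.metric
  have h1 := h.inv_zero_one_eq hQ hz (by simp) (by simpa) hu
  have h0 := hG.inv_diag_pos hz 0
  have h2 := hG.inv_diag_pos hz 1
  have e := hG.inducedMetric_inv hz 0 0
  rw [Fin.succ_zero_eq_one, hG.inv_symm hz 0 1, h1] at e
  rw [e]
  have e0 := Real.mul_self_sqrt h0.le
  have e1 := Real.mul_self_sqrt h2.le
  rw [show lam * √((G (faceEmb z))⁻¹ 0 0) * √((G (faceEmb z))⁻¹ 1 1) *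
      (lam * √((G (faceEmb z))⁻¹ 0 0) * √((G (faceEmb z))⁻¹ 1 1)) =
      lam ^ 2 * (√((G (faceEmb z))⁻¹ 0 0) * √((G (faceEmb z))⁻¹ 0 0)) *
        (√((G (faceEmb z))⁻¹ 1 1) * √((G (faceEmb z))⁻¹ 1 1)) by ring, e0, e1]
  field_simp

/-- The faces meet transversally, so their angle is neither `0` nor `π`. -/
theorem sq_lt_one (h : CornerCoords T G H r) {lam : ℝ}
    (hQ : ∀ y ∈ T, 0 < y 0 → y 1 = 0 → ∀ i j, i ≠ 1 → j ≠ 1 →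
      secondFundamentalForm 𝔻 H 1 y i j = lam * H y i j)
    (hz : faceEmb z ∈ T) (hz0 : z 0 = 0) (hu : gradNormSq 𝔻 G r (faceEmb z) = 1) :
    0 < 1 - lam ^ 2 := by
  have h1 := h.metric.face.inv_diag_pos (x := z) hz 0
  rw [h.inducedMetric_inv_zero_zero hQ hz hz0 hu] at h1
  exact pos_of_mul_pos_left h1 (h.metric.inv_diag_pos hz 1).le

/-- The corner is umbilic in the face at infinity. -/
theorem secondFundamentalForm_corner (h : CornerCoords T G H r) {lam : ℝ}
    (hQ : ∀ y ∈ T, 0 < y 0 → y 1 = 0 → ∀ i j, i ≠ 1 → j ≠ 1 →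
      secondFundamentalForm 𝔻 H 1 y i j = lam * H y i j)
    (hz : faceEmb z ∈ T) (hz0 : z 0 = 0) (hu : gradNormSq 𝔻 G r (faceEmb z) = 1)
    (hH : ∀ i j, hessComp 𝔻 G r i j (faceEmb z) = 0) (i j : Fin m) :
    secondFundamentalForm (faceDomain m) (inducedMetric G) 0 z i.succ j.succ =
      faceCurvature G (faceEmb z) / √(1 - lam ^ 2) * inducedMetric G z i.succ j.succ := by
  have h1 := h.sq_lt_one hQ hz hz0 hu
  have h2 := h.metric.inv_diag_pos hz 1
  rw [h.metric.face.secondFundamentalForm_eq hz, h.metric.christoffel_inducedMetric hz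
    (h.christoffel_zero_eq_zero hz (by simp) hu hH (Fin.succ_ne_zero _) (Fin.succ_ne_zero _)),
    h.inducedMetric_inv_zero_zero hQ hz hz0 hu, Fin.succ_zero_eq_one,
    h.christoffel_eq_faceCurvature hQ hz (by simpa), Real.sqrt_mul h1.le]
  · have := Real.sqrt_pos.2 h2
    have := Real.sqrt_pos.2 h1
    unfold inducedMetric
    field_simp
  · rw [← Fin.succ_zero_eq_one]; exact fun e => Fin.succ_ne_zero _ (Fin.succ_injective _ e)
  · rw [← Fin.succ_zero_eq_one]; exact fun e => Fin.succ_ne_zero _ (Fin.succ_injective _ e)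

end CornerCoords

end CornerGeometry

namespace CornerGeometry

/-! ### The derivative of the principal curvature along the corner -/

namespace SmoothCoordMetric

variable {k : ℕ} {s T : Set (EuclideanSpace ℝ (Fin k))}
  {G : EuclideanSpace ℝ (Fin k) → Matrix (Fin k) (Fin k) ℝ} {x : EuclideanSpace ℝ (Fin k)}

theorem curvature_comb_last (u v w z z' : Fin k → ℝ) (α β : ℝ) :
    curvature s G x u v w (fun i => α * z i + β * z' i) =
      α * curvature s G x u v w z + β * curvature s G x u v w z' := by
  simp only [curvature, Finset.mul_sum, ← Finset.sum_add_distrib]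
  refine Finset.sum_congr rfl fun _ _ => Finset.sum_congr rfl fun _ _ =>
    Finset.sum_congr rfl fun _ _ => Finset.sum_congr rfl fun _ _ =>
    Finset.sum_congr rfl fun _ _ => by ring

theorem curvature_comb_third (u v w w' z : Fin k → ℝ) (α β : ℝ) :
    curvature s G x u v (fun i => α * w i + β * w' i) z =
      α * curvature s G x u v w z + β * curvature s G x u v w' z := by
  simp only [curvature, Finset.mul_sum, ← Finset.sum_add_distrib]
  refine Finset.sum_congr rfl fun _ _ => Finset.sum_congr rfl fun _ _ =>
    Finset.sum_congr rfl fun _ _ => Finset.sum_congr rfl fun _ _ =>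
    Finset.sum_congr rfl fun _ _ => by ring

theorem curvature_comb_second (u v v' w z : Fin k → ℝ) (α β : ℝ) :
    curvature s G x u (fun i => α * v i + β * v' i) w z =
      α * curvature s G x u v w z + β * curvature s G x u v' w z := by
  simp only [curvature, Finset.mul_sum, ← Finset.sum_add_distrib]
  refine Finset.sum_congr rfl fun _ _ => Finset.sum_congr rfl fun _ _ =>
    Finset.sum_congr rfl fun _ _ => Finset.sum_congr rfl fun _ _ =>
    Finset.sum_congr rfl fun _ _ => by ring

theorem sum_mul_inwardNormal (hG : SmoothCoordMetric s T G) (hx : x ∈ T) (f a : Fin k) :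
    ∑ l, G x a l * inwardNormal G f x l = if a = f then (√((G x)⁻¹ f f))⁻¹ else 0 := by
  unfold inwardNormal
  simp only [← mul_div_assoc]
  rw [← Finset.sum_div, hG.sum_mul_inv hx]
  split_ifs <;> simp

/-- The inner product of `v` with the unit normal of a coordinate face. -/
theorem inner_inwardNormal (hG : SmoothCoordMetric s T G) (hx : x ∈ T) (f : Fin k)
    (v : Fin k → ℝ) :
    ∑ i, ∑ j, v i * G x i j * inwardNormal G f x j = v f / √((G x)⁻¹ f f) := by
  simp only [mul_assoc, ← Finset.mul_sum, hG.sum_mul_inwardNormal hx]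
  simp [div_eq_mul_inv]

theorem curvature_eq_of_last (u v w z q : Fin k → ℝ)
    (hz : ∀ a, ∑ l, G x a l * z l = q a) :
    curvature s G x u v w z =
      ∑ i, ∑ j, ∑ c, (∑ a, q a * curvatureEndo s G a c i j x) * (u i * v j * w c) := by
  unfold curvature
  refine Finset.sum_congr rfl fun i _ => Finset.sum_congr rfl fun j _ =>
    Finset.sum_congr rfl fun c _ => ?_
  rw [Finset.sum_comm, Finset.sum_mul]
  refine Finset.sum_congr rfl fun a _ => ?_
  rw [← hz, Finset.sum_mul, Finset.sum_mul]
  exact Finset.sum_congr rfl fun l _ => by ring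

end SmoothCoordMetric

namespace CornerCoords

open SmoothCoordMetric

variable {m : ℕ} {T : Set (EuclideanSpace ℝ (Fin (m + 2)))}
  {G H : EuclideanSpace ℝ (Fin (m + 2)) → Matrix (Fin (m + 2)) (Fin (m + 2)) ℝ}
  {r : EuclideanSpace ℝ (Fin (m + 2)) → ℝ} {x : EuclideanSpace ℝ (Fin (m + 2))}

local notation "𝔻" => range (cornerModel m)

/-- The Codazzi equation for vectors tangent to the face `{x_1 = 0}`. -/
theorem curvature_inwardNormal_one (h : CornerCoords T G H r) {lam : ℝ}
    (hQ : ∀ y ∈ T, 0 < y 0 → y 1 = 0 → ∀ i j, i ≠ 1 → j ≠ 1 →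
      secondFundamentalForm 𝔻 H 1 y i j = lam * H y i j)
    (hx : x ∈ T) (hx1 : x 1 = 0) {u v w : Fin (m + 2) → ℝ} (hu : u 1 = 0) (hv : v 1 = 0)
    (hw : w 1 = 0) :
    curvature 𝔻 G x u v w (inwardNormal G 1 x) =
      (∑ i, u i * partialDeriv 𝔻 i (faceCurvature G) x) * (∑ j, ∑ c, v j * G x j c * w c)
      - (∑ j, v j * partialDeriv 𝔻 j (faceCurvature G) x) * (∑ i, ∑ c, u i * G x i c * w c) := by
  have hG := h.metric
  rw [curvature_eq_of_last u v w _ _ (hG.sum_mul_inwardNormal hx 1)]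
  have hcod {i j c : Fin (m + 2)} (hi : i ≠ 1) (hj : j ≠ 1) (hc : c ≠ 1) :=
    hG.codazzi rayStable_range_cornerModel h.smooth_faceCurvature
      (fun y hy hy1 i j hi hj => h.christoffel_eq_faceCurvature hQ hy hy1 hi hj) hx hx1 hc hi hj
  have h0 := Real.sqrt_pos.2 (hG.inv_diag_pos hx 1)
  have key (i j c : Fin (m + 2)) :
      (∑ a, (if a = 1 then (√((G x)⁻¹ 1 1))⁻¹ else 0) * curvatureEndo 𝔻 G a c i j x)
        * (u i * v j * w c) =
      (partialDeriv 𝔻 i (faceCurvature G) x * G x j c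
        - partialDeriv 𝔻 j (faceCurvature G) x * G x i c) * (u i * v j * w c) := by
    by_cases hi : i = 1
    · simp [hi, hu]
    by_cases hj : j = 1
    · simp [hj, hv]
    by_cases hc : c = 1
    · simp [hc, hw]
    simp only [ite_mul, zero_mul, Finset.sum_ite_eq', Finset.mem_univ, if_true]
    rw [hcod hi hj hc]
    field_simp
  simp only [key]
  have e (p : Fin (m + 2) → ℝ) (q : Fin (m + 2) → Fin (m + 2) → ℝ) :
      (∑ i, p i) * ∑ j, ∑ c, q j c = ∑ i, ∑ j, ∑ c, p i * q j c := by
    rw [Finset.sum_mul]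
    refine Finset.sum_congr rfl fun i _ => ?_
    rw [Finset.mul_sum]
    exact Finset.sum_congr rfl fun j _ => Finset.mul_sum _ _ _
  rw [e, e]
  nth_rewrite 3 [Finset.sum_comm]
  simp only [← Finset.sum_sub_distrib]
  exact Finset.sum_congr rfl fun _ _ => Finset.sum_congr rfl fun _ _ =>
    Finset.sum_congr rfl fun _ _ => by ring

/-- The curvature `R(u, v, w, ν)` vanishes for `u, v` tangent to the face at infinity, whose unit
normal is `ν`. -/
theorem curvature_inwardNormal_zero (h : CornerCoords T G H r)
    (hH : ∀ y ∈ T, y 0 = 0 → ∀ i j, hessComp 𝔻 G r i j y = 0)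
    (hx : x ∈ T) (hx0 : x 0 = 0) (hu : gradNormSq 𝔻 G r x = 1) {u v : Fin (m + 2) → ℝ}
    (w : Fin (m + 2) → ℝ) (hu0 : u 0 = 0) (hv0 : v 0 = 0) :
    curvature 𝔻 G x u v w (inwardNormal G 0 x) = 0 := by
  rw [curvature_eq_of_last u v w _ (fun a => partialDeriv 𝔻 a r x) fun a => by
    rw [← h.metric.sum_gradComp_mul hx]
    exact Finset.sum_congr rfl fun l _ => by
      rw [h.gradComp_eq_inwardNormal hx hx0 hu, h.metric.symm hx, mul_comm]]
  refine Finset.sum_eq_zero fun i _ => Finset.sum_eq_zero fun j _ =>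
    Finset.sum_eq_zero fun c _ => ?_
  by_cases hi : i = 0
  · simp [hi, hu0]
  by_cases hj : j = 0
  · simp [hj, hv0]
  rw [h.metric.sum_curvatureEndo_mul_eq_zero rayStable_range_cornerModel h.smooth hH hx hx0 hi hj,
    zero_mul]

/-- The unit normal of the face `{x_1 = 0}` at the corner, in the orthonormal frame formed by the
unit normal of the face at infinity and the unit normal of the corner in that face. -/
theorem inwardNormal_one_eq (h : CornerCoords T G H r) {lam : ℝ}
    (hQ : ∀ y ∈ T, 0 < y 0 → y 1 = 0 → ∀ i j, i ≠ 1 → j ≠ 1 →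
      secondFundamentalForm 𝔻 H 1 y i j = lam * H y i j)
    {z : EuclideanSpace ℝ (Fin (m + 1))} (hz : faceEmb z ∈ T) (hz0 : z 0 = 0)
    (hu : gradNormSq 𝔻 G r (faceEmb z) = 1) :
    inwardNormal G 1 (faceEmb z) = fun i => lam * inwardNormal G 0 (faceEmb z) i
      + √(1 - lam ^ 2) * (Fin.cons 0 (inwardNormal (inducedMetric G) 0 z) : Fin (m + 2) → ℝ) i := by
  have hG := h.metric
  have h1 := h.inv_zero_one_eq hQ hz (by simp) (by simpa) hu
  have hs := h.sq_lt_one hQ hz hz0 hu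
  have p0 := Real.sqrt_pos.2 (hG.inv_diag_pos hz 0)
  have p1 := Real.sqrt_pos.2 (hG.inv_diag_pos hz 1)
  have ps := Real.sqrt_pos.2 hs
  funext i
  refine Fin.cases ?_ (fun i => ?_) i
  · simp only [Fin.cons_zero, mul_zero, add_zero]
    unfold inwardNormal
    rw [hG.inv_symm hz 0 1, h1]
    have e0 := Real.mul_self_sqrt (hG.inv_diag_pos hz 0).le
    set q := √((G (faceEmb z))⁻¹ 0 0)
    rw [← e0]
    field_simp
  · simp only [Fin.cons_succ]
    unfold inwardNormal
    rw [h.inducedMetric_inv_zero_zero hQ hz hz0 hu, hG.inducedMetric_inv hz, Real.sqrt_mul hs.le,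
      Fin.succ_zero_eq_one, hG.inv_symm hz 0 1, h1]
    have e0 := Real.mul_self_sqrt (hG.inv_diag_pos hz 0).le
    set q := √((G (faceEmb z))⁻¹ 0 0)
    rw [← e0]
    field_simp
    ring

/-- The corner equation in an adapted chart: the Codazzi equation of the face `{x_1 = 0}` for `Z`
and the vector tangent to this face and normal to the corner. -/
theorem corner_equation (h : CornerCoords T G H r) {lam : ℝ}
    (hQ : ∀ y ∈ T, 0 < y 0 → y 1 = 0 → ∀ i j, i ≠ 1 → j ≠ 1 →
      secondFundamentalForm 𝔻 H 1 y i j = lam * H y i j)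
    (hH : ∀ y ∈ T, y 0 = 0 → ∀ i j, hessComp 𝔻 G r i j y = 0)
    {z : EuclideanSpace ℝ (Fin (m + 1))} (hz : faceEmb z ∈ T) (hz0 : z 0 = 0)
    (hu : gradNormSq 𝔻 G r (faceEmb z) = 1)
    {Z : Fin (m + 2) → ℝ} (hZ0 : Z 0 = 0) (hZ1 : Z 1 = 0) :
    (∑ i, Z i * partialDeriv 𝔻 i (faceCurvature G) (faceEmb z)) / √(1 - lam ^ 2) =
      - curvature 𝔻 G (faceEmb z) (inwardNormal G 0 (faceEmb z)) Z
        (inwardNormal G 0 (faceEmb z)) (Fin.cons 0 (inwardNormal (inducedMetric G) 0 z)) := by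
  have hG := h.metric
  set a := inwardNormal G 0 (faceEmb z) with ha
  set b := inwardNormal G 1 (faceEmb z) with hb
  set e : Fin (m + 2) → ℝ := Fin.cons 0 (inwardNormal (inducedMetric G) 0 z) with he
  have hs := h.sq_lt_one hQ hz hz0 hu
  set σ := √(1 - lam ^ 2) with hσ
  have hσ0 : 0 < σ := Real.sqrt_pos.2 hs
  have hσ2 : σ ^ 2 = 1 - lam ^ 2 := Real.sq_sqrt hs.le
  have hb' : b = fun i => lam * a i + σ * e i := h.inwardNormal_one_eq hQ hz hz0 hu
  have p0 := Real.sqrt_pos.2 (hG.inv_diag_pos hz 0)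
  have p1 := Real.sqrt_pos.2 (hG.inv_diag_pos hz 1)
  have h10 := h.inv_zero_one_eq hQ hz (by simp) (by simpa) hu
  have e0 := Real.mul_self_sqrt (hG.inv_diag_pos hz 0).le
  have e1 := Real.mul_self_sqrt (hG.inv_diag_pos hz 1).le
  -- `t = a - lam * b` is tangent to the face `{x_1 = 0}` and normal to the corner; the coefficients
  -- have the form required by `curvature_comb_second`
  set t : Fin (m + 2) → ℝ := fun i => 1 * a i + (-lam) * b i with ht
  have ha1 : a 1 = lam * √((G (faceEmb z))⁻¹ 1 1) := by
    simp only [ha, inwardNormal]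
    rw [h10]; field_simp
  have hb1 : b 1 = √((G (faceEmb z))⁻¹ 1 1) := by
    simp only [hb, inwardNormal]
    nth_rewrite 1 [← e1]; field_simp
  have ha0 : a 0 = √((G (faceEmb z))⁻¹ 0 0) := by
    simp only [ha, inwardNormal]
    nth_rewrite 1 [← e0]; field_simp
  have hb0 : b 0 = lam * √((G (faceEmb z))⁻¹ 0 0) := by
    simp only [hb', ha0, he, Fin.cons_zero, mul_zero, add_zero]
  have ht1 : t 1 = 0 := by simp only [ht]; rw [ha1, hb1]; ring
  have ht0 : t 0 = σ ^ 2 * √((G (faceEmb z))⁻¹ 0 0) := by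
    simp only [ht]; rw [ha0, hb0, hσ2]; ring
  have hin (v : Fin (m + 2) → ℝ) : ∑ i, ∑ j, v i * G (faceEmb z) i j * t j =
      v 0 / √((G (faceEmb z))⁻¹ 0 0) - lam * (v 1 / √((G (faceEmb z))⁻¹ 1 1)) := by
    rw [← hG.inner_inwardNormal hz 0 v, ← hG.inner_inwardNormal hz 1 v, Finset.mul_sum,
      ← Finset.sum_sub_distrib]
    refine Finset.sum_congr rfl fun i _ => ?_
    rw [Finset.mul_sum, ← Finset.sum_sub_distrib]
    refine Finset.sum_congr rfl fun j _ => ?_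
    simp only [ht]
    ring
  have hZt : ∑ i, ∑ j, Z i * G (faceEmb z) i j * t j = 0 := by rw [hin, hZ0, hZ1]; simp
  have htt : ∑ i, ∑ j, t i * G (faceEmb z) i j * t j = σ ^ 2 := by
    rw [hin, ht0, ht1]; field_simp; ring
  have hcod := h.curvature_inwardNormal_one hQ hz (by simpa) hZ1 ht1 ht1
  rw [hZt, htt, mul_zero, sub_zero] at hcod
  -- rewrite everything in terms of the orthonormal pair `a, e`
  have ht' : t = fun i => σ ^ 2 * a i + (-(lam * σ)) * e i := by
    funext i
    simp only [ht]
    rw [hb', hσ2]; ring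
  have hself (v w : Fin (m + 2) → ℝ) : curvature 𝔻 G (faceEmb z) Z v w w = 0 := by
    have := hG.curvature_swap_last hz Z v w w
    linarith
  have hlast (v : Fin (m + 2) → ℝ) : curvature 𝔻 G (faceEmb z) Z v t b =
      σ * curvature 𝔻 G (faceEmb z) Z v a e := by
    rw [hb', ht', curvature_comb_third, curvature_comb_last, curvature_comb_last, hself, hself,
      hG.curvature_swap_last hz Z v e a]
    have : σ ^ 2 * σ + lam * σ * lam = σ := by rw [hσ2]; ring
    linear_combination (curvature 𝔻 G (faceEmb z) Z v a e) * this
  have hflat : curvature 𝔻 G (faceEmb z) Z e a e = 0 := by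
    rw [hG.curvature_swap_last hz, h.curvature_inwardNormal_zero hH hz (by simp) hu e hZ0
      (by simp [he]), neg_zero]
  have hfin : curvature 𝔻 G (faceEmb z) Z t a e =
      σ ^ 2 * curvature 𝔻 G (faceEmb z) Z a a e := by
    rw [ht', curvature_comb_second, hflat]; ring
  rw [hlast, hfin] at hcod
  rw [curvature_swap_first, neg_neg, div_eq_iff hσ0.ne']
  have : σ ^ 2 ≠ 0 := by positivity
  refine mul_right_cancel₀ this ?_
  rw [← hcod]
  ring

end CornerCoords

end CornerGeometry

namespace CornerGeometry

/-! ### Charts -/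

section Charts

variable {m : ℕ} {X : Type*} [TopologicalSpace X] {φ : OpenPartialHomeomorph X (CornerSpace m)}
  {y : EuclideanSpace ℝ (Fin (m + 2))}

theorem extend_target_mem_nhdsWithin_of_mem (hy : y ∈ (φ.extend (cornerModel m)).target) :
    (φ.extend (cornerModel m)).target ∈ 𝓝[range (cornerModel m)] y := by
  have h := φ.extend_target_mem_nhdsWithin (I := cornerModel m)
    (y := (φ.extend (cornerModel m)).symm y)
    (by rw [← φ.extend_source (I := cornerModel m)]; exact (φ.extend _).map_target hy)
  rwa [(φ.extend (cornerModel m)).right_inv hy] at h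

theorem chartDomain_target (φ : OpenPartialHomeomorph X (CornerSpace m)) :
    ChartDomain (range (cornerModel m)) (φ.extend (cornerModel m)).target :=
  chartDomain_corner φ.extend_target_subset_range fun _ => extend_target_mem_nhdsWithin_of_mem

theorem symm_mem_source (hy : y ∈ (φ.extend (cornerModel m)).target) :
    (φ.extend (cornerModel m)).symm y ∈ φ.source := by
  rw [← φ.extend_source (I := cornerModel m)]; exact (φ.extend _).map_target hy

/-- Restricting a chart domain to the preimage of an open set. -/
theorem chartDomain_inter_preimage (φ : OpenPartialHomeomorph X (CornerSpace m)) {U : Set X}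
    (hU : IsOpen U) : ChartDomain (range (cornerModel m))
      ((φ.extend (cornerModel m)).target ∩ (φ.extend (cornerModel m)).symm ⁻¹' U) :=
  chartDomain_corner (inter_subset_left.trans φ.extend_target_subset_range) fun _ hx =>
    inter_mem (extend_target_mem_nhdsWithin_of_mem hx.1)
      (mem_nhdsWithin_of_mem_nhds ((φ.continuousAt_extend_symm' hx.1).preimage_mem_nhds
        (hU.mem_nhds hx.2)))

theorem uniqueMDiffWithinAt_range (hy : y ∈ (φ.extend (cornerModel m)).target) :
    UniqueMDiffWithinAt 𝓘(ℝ, EuclideanSpace ℝ (Fin (m + 2))) (range (cornerModel m)) y :=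
  ((chartDomain_target φ).uniqueDiffOn y ((chartDomain_target φ).subset hy)).uniqueMDiffWithinAt

variable [ChartedSpace (CornerSpace m) X]

theorem coordVector_add (u v : EuclideanSpace ℝ (Fin (m + 2))) :
    coordVector φ y (u + v) = coordVector φ y u + coordVector φ y v := map_add _ _ _

theorem coordVector_smul (c : ℝ) (v : EuclideanSpace ℝ (Fin (m + 2))) :
    coordVector φ y (c • v) = c • coordVector φ y v := map_smul _ _ _

theorem contMDiffWithinAt_extend_symm (hφ : φ ∈ IsManifold.maximalAtlas (cornerModel m) ∞ X)
    (hy : y ∈ (φ.extend (cornerModel m)).target) :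
    ContMDiffWithinAt 𝓘(ℝ, EuclideanSpace ℝ (Fin (m + 2))) (cornerModel m) ∞
      (φ.extend (cornerModel m)).symm (range (cornerModel m)) y := by
  have h := contMDiffOn_extend_symm hφ y (by rwa [← φ.extend_target'])
  rw [← φ.extend_target'] at h
  exact h.mono_of_mem_nhdsWithin (extend_target_mem_nhdsWithin_of_mem hy)

variable {V : Type*} [NormedAddCommGroup V] [NormedSpace ℝ V]

theorem contDiffWithinAt_comp_symm (hφ : φ ∈ IsManifold.maximalAtlas (cornerModel m) ∞ X)
    (hy : y ∈ (φ.extend (cornerModel m)).target) {f : X → V}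
    (hf : ContMDiffAt (cornerModel m) 𝓘(ℝ, V) ∞ f ((φ.extend (cornerModel m)).symm y)) :
    ContDiffWithinAt ℝ ∞ (fun y => f ((φ.extend (cornerModel m)).symm y))
      (range (cornerModel m)) y :=
  contMDiffWithinAt_iff_contDiffWithinAt.1
    (hf.comp_contMDiffWithinAt y (contMDiffWithinAt_extend_symm hφ hy))

/-- The derivative of a function in the direction of a coordinate vector. -/
theorem mfderiv_coordVector (hφ : φ ∈ IsManifold.maximalAtlas (cornerModel m) ∞ X)
    (hy : y ∈ (φ.extend (cornerModel m)).target) {f : X → V}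
    (hf : MDifferentiableAt (cornerModel m) 𝓘(ℝ, V) f ((φ.extend (cornerModel m)).symm y))
    (v : EuclideanSpace ℝ (Fin (m + 2))) :
    (mfderiv (cornerModel m) 𝓘(ℝ, V) f ((φ.extend (cornerModel m)).symm y)
      (coordVector φ y v) : V) =
    fderivWithin ℝ (fun y => f ((φ.extend (cornerModel m)).symm y))
      (range (cornerModel m)) y v := by
  have h := mfderiv_comp_mfderivWithin y hf
    ((contMDiffWithinAt_extend_symm hφ hy).mdifferentiableWithinAt (by simp))
    (uniqueMDiffWithinAt_range hy)
  rw [mfderivWithin_eq_fderivWithin] at h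
  exact (DFunLike.congr_fun h v).symm

theorem coordVector_injective (hφ : φ ∈ IsManifold.maximalAtlas (cornerModel m) ∞ X)
    (hy : y ∈ (φ.extend (cornerModel m)).target) {v : EuclideanSpace ℝ (Fin (m + 2))}
    (hv : coordVector φ y v = 0) : v = 0 := by
  have hs := symm_mem_source hy
  have h := mfderiv_coordVector hφ hy ((φ.contMDiffAt_extend hφ hs).mdifferentiableAt (by simp)) v
  rw [hv, map_zero] at h
  have e : fderivWithin ℝ (fun y => φ.extend (cornerModel m) ((φ.extend (cornerModel m)).symm y))
      (range (cornerModel m)) y = fderivWithin ℝ id (range (cornerModel m)) y := by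
    refine Filter.EventuallyEq.fderivWithin_eq ?_ ((φ.extend (cornerModel m)).right_inv hy)
    filter_upwards [extend_target_mem_nhdsWithin_of_mem hy] with z hz
    exact (φ.extend (cornerModel m)).right_inv hz
  rw [e, fderivWithin_id ((chartDomain_target φ).uniqueDiffOn y
    ((chartDomain_target φ).subset hy))] at h
  exact h.symm

theorem coordVector_surjective (hφ : φ ∈ IsManifold.maximalAtlas (cornerModel m) ∞ X)
    (hy : y ∈ (φ.extend (cornerModel m)).target)
    (w : TangentSpace (cornerModel m) ((φ.extend (cornerModel m)).symm y)) :
    ∃ v, coordVector φ y v = w := by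
  set L : EuclideanSpace ℝ (Fin (m + 2)) →ₗ[ℝ] EuclideanSpace ℝ (Fin (m + 2)) :=
    (mfderivWithin 𝓘(ℝ, EuclideanSpace ℝ (Fin (m + 2))) (cornerModel m)
      (φ.extend (cornerModel m)).symm (range (cornerModel m)) y).toLinearMap with hL
  have hi : Function.Injective L := by
    rw [injective_iff_map_eq_zero]
    exact fun v hv => coordVector_injective hφ hy hv
  exact LinearMap.injective_iff_surjective.1 hi w

/-- Coordinate vector fields are smooth. -/
theorem contMDiffWithinAt_coordVector [IsManifold (cornerModel m) ∞ X]
    (hφ : φ ∈ IsManifold.maximalAtlas (cornerModel m) ∞ X)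
    (hy : y ∈ (φ.extend (cornerModel m)).target) (v : EuclideanSpace ℝ (Fin (m + 2))) :
    ContMDiffWithinAt 𝓘(ℝ, EuclideanSpace ℝ (Fin (m + 2))) (cornerModel m).tangent ∞
      (fun y => TotalSpace.mk' (EuclideanSpace ℝ (Fin (m + 2)))
        (E := (TangentSpace (cornerModel m) : X → Type))
        ((φ.extend (cornerModel m)).symm y) (coordVector φ y v))
      (range (cornerModel m)) y := by
  set T := (φ.extend (cornerModel m)).target with hT
  have hsub : T ⊆ range (cornerModel m) := φ.extend_target_subset_range
  have hu : UniqueMDiffOn 𝓘(ℝ, EuclideanSpace ℝ (Fin (m + 2))) T := by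
    intro z hz
    exact ((chartDomain_target φ).uniqueDiffOn z (hsub hz)).uniqueMDiffWithinAt.mono_nhds
      (nhdsWithin_le_iff.2 (extend_target_mem_nhdsWithin_of_mem hz))
  have h1 : ContMDiffOn 𝓘(ℝ, EuclideanSpace ℝ (Fin (m + 2))) (cornerModel m) ∞
      (φ.extend (cornerModel m)).symm T := fun z hz =>
    (contMDiffWithinAt_extend_symm hφ hz).mono hsub
  have h2 := h1.contMDiffOn_tangentMapWithin (m := ∞) (by simp) hu
  have h3 : ContMDiff 𝓘(ℝ, EuclideanSpace ℝ (Fin (m + 2)))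
      (𝓘(ℝ, EuclideanSpace ℝ (Fin (m + 2))).tangent) ∞
      (fun z : EuclideanSpace ℝ (Fin (m + 2)) =>
        (⟨z, v⟩ : TangentBundle 𝓘(ℝ, EuclideanSpace ℝ (Fin (m + 2)))
          (EuclideanSpace ℝ (Fin (m + 2))))) :=
    contMDiff_vectorSpace_iff_contDiff.2 contDiff_const
  have h4 := ContMDiffOn.comp (s := T) h2 h3.contMDiffOn fun z hz => hz
  refine ((h4 y hy).congr_of_mem (fun z hz => ?_) hy).mono_of_mem_nhdsWithin
    (extend_target_mem_nhdsWithin_of_mem hy)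
  simp only [Function.comp, tangentMapWithin]
  congr 1
  unfold coordVector
  rw [mfderivWithin_subset hsub (hu z hz)
    ((contMDiffWithinAt_extend_symm hφ hz).mdifferentiableWithinAt (by simp))]

end Charts

end CornerGeometry

namespace CornerGeometry

/-! ### Metrics in charts -/

section Fields

variable {m : ℕ} {X : Type*} [TopologicalSpace X] [ChartedSpace (CornerSpace m) X]
  {φ ψ : OpenPartialHomeomorph X (CornerSpace m)} {y : EuclideanSpace ℝ (Fin (m + 2))}

/-- A field of inner products whose components are smooth in every chart. -/
structure SmoothField (gbar : BilinField m X) : Prop where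
  symm : ∀ p u v, gbar p u v = gbar p v u
  pos : ∀ p u, u ≠ 0 → 0 < gbar p u u
  smooth : ∀ φ ∈ IsManifold.maximalAtlas (cornerModel m) ∞ X, ∀ i j,
    SmoothFn (range (cornerModel m)) (φ.extend (cornerModel m)).target
      fun y => components φ gbar y i j

theorem inner_coordVector (gbar : BilinField m X) (u v : EuclideanSpace ℝ (Fin (m + 2))) :
    gbar ((φ.extend (cornerModel m)).symm y) (coordVector φ y u) (coordVector φ y v) =
      ∑ i, ∑ j, u i * components φ gbar y i j * v j := by
  have hv (v : EuclideanSpace ℝ (Fin (m + 2))) :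
      coordVector φ y v = ∑ i, v i • coordVector φ y (EuclideanSpace.single i 1) := by
    have e : v = ∑ i, v i • EuclideanSpace.single i (1 : ℝ) := by
      ext j; simp [Finset.sum_apply, Pi.single_apply]
    conv_lhs => rw [e]
    let L : EuclideanSpace ℝ (Fin (m + 2)) →ₗ[ℝ]
        TangentSpace (cornerModel m) ((φ.extend (cornerModel m)).symm y) :=
      { toFun := coordVector φ y
        map_add' := coordVector_add
        map_smul' := coordVector_smul }
    exact (map_sum L _ _).trans (Finset.sum_congr rfl fun i _ => map_smul L _ _)
  have hu : gbar ((φ.extend (cornerModel m)).symm y) (coordVector φ y u) =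
      ∑ i, u i • gbar ((φ.extend (cornerModel m)).symm y)
        (coordVector φ y (EuclideanSpace.single i 1)) := by
    rw [hv u, map_sum]
    exact Finset.sum_congr rfl fun i _ => map_smul _ _ _
  rw [hu, hv v, _root_.sum_apply]
  refine Finset.sum_congr rfl fun i _ => ?_
  rw [map_sum]
  refine Finset.sum_congr rfl fun j _ => ?_
  rw [map_smul, _root_.smul_apply]
  simp only [smul_eq_mul, components]
  ring

theorem SmoothField.coordMetric {gbar : BilinField m X} (h : SmoothField gbar)
    (hφ : φ ∈ IsManifold.maximalAtlas (cornerModel m) ∞ X) :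
    SmoothCoordMetric (range (cornerModel m)) (φ.extend (cornerModel m)).target
      (components φ gbar) where
  domain := chartDomain_target φ
  smooth := h.smooth φ hφ
  posDef y hy := by
    refine Matrix.PosDef.of_dotProduct_mulVec_pos ?_ fun v hv => ?_
    · ext i j
      simp only [Matrix.conjTranspose_apply, star_trivial]
      exact h.symm _ _ _
    · have hne : WithLp.toLp 2 v ≠ 0 := by simpa using hv
      have := h.pos _ (coordVector φ y (WithLp.toLp 2 v))
        fun h0 => hne (coordVector_injective hφ hy h0)
      rw [inner_coordVector] at this
      convert! this using 1
      simp only [dotProduct, Matrix.mulVec, star_trivial, Finset.mul_sum]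
      exact Finset.sum_congr rfl fun i _ => Finset.sum_congr rfl fun j _ => by ring

theorem smoothField_of_smoothMetric [IsManifold (cornerModel m) ∞ X] (gbar : SmoothMetric m X) :
    SmoothField gbar.inner where
  symm := gbar.symm
  pos := gbar.pos
  smooth φ hφ i j y hy := by
    have h1 := (gbar.contMDiff.contMDiffAt
      (x := (φ.extend (cornerModel m)).symm y)).comp_contMDiffWithinAt y
        (contMDiffWithinAt_extend_symm hφ hy)
    have h2 := contMDiffWithinAt_coordVector hφ hy (EuclideanSpace.single i 1)
    have h3 := contMDiffWithinAt_coordVector hφ hy (EuclideanSpace.single j 1)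
    have h4 : ContMDiffWithinAt 𝓘(ℝ, EuclideanSpace ℝ (Fin (m + 2)))
        ((cornerModel m).prod 𝓘(ℝ, ℝ)) ∞ (fun y => TotalSpace.mk' ℝ
          (E := Bundle.Trivial X ℝ) ((φ.extend (cornerModel m)).symm y)
          (gbar.inner ((φ.extend (cornerModel m)).symm y)
            (coordVector φ y (EuclideanSpace.single i 1))
            (coordVector φ y (EuclideanSpace.single j 1)))) (range (cornerModel m)) y :=
      ContMDiffWithinAt.clm_bundle_apply₂ (F₁ := EuclideanSpace ℝ (Fin (m + 2)))
        (F₂ := EuclideanSpace ℝ (Fin (m + 2))) h1 h2 h3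
    rw [contMDiffWithinAt_totalSpace] at h4
    exact contMDiffWithinAt_iff_contDiffWithinAt.1 h4.2

end Fields

end CornerGeometry

namespace CornerGeometry

/-! ### The unit normal of `Q` does not depend on the chart -/

section Normal

variable {m : ℕ} {X : Type*} [TopologicalSpace X] [ChartedSpace (CornerSpace m) X]
  {φ ψ : OpenPartialHomeomorph X (CornerSpace m)} {y : EuclideanSpace ℝ (Fin (m + 2))}
  {M Q : Set X} {gbar : BilinField m X}

theorem symm_mem_M_iff (hφ : IsAdaptedChart M Q φ)
    (hy : y ∈ (φ.extend (cornerModel m)).target) :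
    (φ.extend (cornerModel m)).symm y ∈ M ↔ y 0 = 0 := by
  rw [hφ.mem_M_iff _ (symm_mem_source hy)]
  have : (φ ((φ.extend (cornerModel m)).symm y)).1 = y := (φ.extend _).right_inv hy
  rw [this]

theorem symm_mem_Q_iff (hφ : IsAdaptedChart M Q φ)
    (hy : y ∈ (φ.extend (cornerModel m)).target) :
    (φ.extend (cornerModel m)).symm y ∈ Q ↔ y 1 = 0 := by
  rw [hφ.mem_Q_iff _ (symm_mem_source hy)]
  have : (φ ((φ.extend (cornerModel m)).symm y)).1 = y := (φ.extend _).right_inv hy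
  rw [this]

/-- The unit normal of the face `{x_1 = 0}` of the chart `φ`, as a tangent vector of `X`; meaningful
for `p` in the source of `φ`. -/
noncomputable def unitNormal (φ : OpenPartialHomeomorph X (CornerSpace m)) (gbar : BilinField m X)
    (p : X) : TangentSpace (cornerModel m) p :=
  show EuclideanSpace ℝ (Fin (m + 2)) from coordVector φ (φ.extend (cornerModel m) p)
    (WithLp.toLp 2 (inwardNormal (components φ gbar) 1 (φ.extend (cornerModel m) p)))

-- `coordVector φ y` lives in a type depending on `y`, so the round trip through the chart is
-- rewritten in the model space
theorem unitNormal_symm (hy : y ∈ (φ.extend (cornerModel m)).target) :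
    unitNormal φ gbar ((φ.extend (cornerModel m)).symm y) =
      coordVector φ y (WithLp.toLp 2 (inwardNormal (components φ gbar) 1 y)) := by
  have h : ∀ y', y' = y → (show EuclideanSpace ℝ (Fin (m + 2)) from coordVector φ y'
      (WithLp.toLp 2 (inwardNormal (components φ gbar) 1 y'))) =
        coordVector φ y (WithLp.toLp 2 (inwardNormal (components φ gbar) 1 y)) := by
    rintro _ rfl; rfl
  exact h _ ((φ.extend (cornerModel m)).right_inv hy)

theorem inner_unitNormal (h : SmoothField gbar)
    (hφ : φ ∈ IsManifold.maximalAtlas (cornerModel m) ∞ X)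
    (hy : y ∈ (φ.extend (cornerModel m)).target) (v : EuclideanSpace ℝ (Fin (m + 2))) :
    gbar _ (unitNormal φ gbar ((φ.extend (cornerModel m)).symm y)) (coordVector φ y v) =
      v 1 / √((components φ gbar y)⁻¹ 1 1) := by
  rw [h.symm, unitNormal_symm hy, inner_coordVector,
    ← (h.coordMetric hφ).inner_inwardNormal hy 1]

theorem inner_unitNormal_self (h : SmoothField gbar)
    (hφ : φ ∈ IsManifold.maximalAtlas (cornerModel m) ∞ X)
    (hy : y ∈ (φ.extend (cornerModel m)).target) :
    gbar _ (unitNormal φ gbar ((φ.extend (cornerModel m)).symm y))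
      (unitNormal φ gbar ((φ.extend (cornerModel m)).symm y)) = 1 := by
  have h1 := inner_unitNormal h hφ hy (WithLp.toLp 2 (inwardNormal (components φ gbar) 1 y))
  rw [← unitNormal_symm hy] at h1
  rw [h1]
  have h2 := (h.coordMetric hφ).inv_diag_pos hy 1
  have h3 := Real.sqrt_pos.2 h2
  simp only [inwardNormal]
  rw [div_div, Real.mul_self_sqrt h2.le, div_self h2.ne']

/-- The differential of a nonnegative function vanishing on `Q` is a nonnegative multiple of the
conormal of `Q`. -/
theorem exists_mfderiv_eq_unitNormal (h : SmoothField gbar) (hφ : IsAdaptedChart M Q φ)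
    (hy : y ∈ (φ.extend (cornerModel m)).target) (hy1 : y 1 = 0) {f : X → ℝ} {U : Set X}
    (hU : IsOpen U) (hyU : (φ.extend (cornerModel m)).symm y ∈ U)
    (hf : ContMDiffOn (cornerModel m) 𝓘(ℝ, ℝ) ∞ f U) (hf0 : ∀ p ∈ U, 0 ≤ f p)
    (hfQ : ∀ p ∈ U, p ∈ Q → f p = 0) :
    ∃ a : ℝ, 0 ≤ a ∧ ∀ w : TangentSpace (cornerModel m) ((φ.extend (cornerModel m)).symm y),
      (mfderiv (cornerModel m) 𝓘(ℝ, ℝ) f ((φ.extend (cornerModel m)).symm y) w : ℝ) =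
        a * gbar _ (unitNormal φ gbar ((φ.extend (cornerModel m)).symm y)) w := by
  have hD := chartDomain_inter_preimage φ hU
  have hyT : y ∈ (φ.extend (cornerModel m)).target ∩ (φ.extend (cornerModel m)).symm ⁻¹' U :=
    ⟨hy, hyU⟩
  have hs : SmoothFn (range (cornerModel m))
      ((φ.extend (cornerModel m)).target ∩ (φ.extend (cornerModel m)).symm ⁻¹' U)
      (fun y => f ((φ.extend (cornerModel m)).symm y)) := fun z hz =>
    contDiffWithinAt_comp_symm hφ.mem_maximalAtlas hz.1 (hf.contMDiffAt (hU.mem_nhds hz.2))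
  have h0 : f ((φ.extend (cornerModel m)).symm y) = 0 :=
    hfQ _ hyU ((symm_mem_Q_iff hφ hy).2 hy1)
  have h1 := partialDeriv_nonneg rayStable_range_cornerModel hD hyT hs 1 h0 fun z hz => hf0 _ hz.2
  have h2 := (h.coordMetric hφ.mem_maximalAtlas).inv_diag_pos hy 1
  have h3 := Real.sqrt_pos.2 h2
  refine ⟨√((components φ gbar y)⁻¹ 1 1) * partialDeriv (range (cornerModel m)) 1
    (fun y => f ((φ.extend (cornerModel m)).symm y)) y, by positivity, fun w => ?_⟩
  obtain ⟨v, rfl⟩ := coordVector_surjective hφ.mem_maximalAtlas hy w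
  rw [inner_unitNormal h hφ.mem_maximalAtlas hy, mfderiv_coordVector hφ.mem_maximalAtlas hy
    ((hf.contMDiffAt (hU.mem_nhds hyU)).mdifferentiableAt (by simp)), fderivWithin_apply_eq_sum,
    Finset.sum_eq_single 1 (fun i _ hi => ?_) (by simp)]
  · field_simp
  · rw [partialDeriv_eq_zero_face rayStable_range_cornerModel hD hyT hs hy1 hi
      fun z hz hz1 => hfQ _ hz.2 ((symm_mem_Q_iff hφ hz.1).2 hz1), mul_zero]

theorem contMDiffOn_chart_coord (hφ : φ ∈ IsManifold.maximalAtlas (cornerModel m) ∞ X)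
    (i : Fin (m + 2)) :
    ContMDiffOn (cornerModel m) 𝓘(ℝ, ℝ) ∞ (fun p => φ.extend (cornerModel m) p i) φ.source :=
  (EuclideanSpace.proj (𝕜 := ℝ) i).contMDiff.comp_contMDiffOn (φ.contMDiffOn_extend hφ)

/-- The coordinate `x_1` has differential a positive multiple of the conormal of `Q`. -/
theorem mfderiv_chart_coord (h : SmoothField gbar)
    (hφ : φ ∈ IsManifold.maximalAtlas (cornerModel m) ∞ X)
    (hy : y ∈ (φ.extend (cornerModel m)).target)
    (w : TangentSpace (cornerModel m) ((φ.extend (cornerModel m)).symm y)) :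
    (mfderiv (cornerModel m) 𝓘(ℝ, ℝ) (fun p => φ.extend (cornerModel m) p 1)
      ((φ.extend (cornerModel m)).symm y) w : ℝ) =
      √((components φ gbar y)⁻¹ 1 1) *
        gbar _ (unitNormal φ gbar ((φ.extend (cornerModel m)).symm y)) w := by
  have h3 := Real.sqrt_pos.2 ((h.coordMetric hφ).inv_diag_pos hy 1)
  obtain ⟨v, rfl⟩ := coordVector_surjective hφ hy w
  rw [inner_unitNormal h hφ hy, mfderiv_coordVector hφ hy
    (((contMDiffOn_chart_coord hφ 1).contMDiffAt
      (φ.open_source.mem_nhds (symm_mem_source hy))).mdifferentiableAt (by simp))]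
  have e : fderivWithin ℝ (fun y => φ.extend (cornerModel m) ((φ.extend (cornerModel m)).symm y) 1)
      (range (cornerModel m)) y =
      fderivWithin ℝ (EuclideanSpace.proj (𝕜 := ℝ) (1 : Fin (m + 2))) (range (cornerModel m)) y := by
    refine Filter.EventuallyEq.fderivWithin_eq ?_ (by
      change φ.extend (cornerModel m) ((φ.extend (cornerModel m)).symm y) 1 = y 1
      rw [(φ.extend (cornerModel m)).right_inv hy])
    filter_upwards [extend_target_mem_nhdsWithin_of_mem hy] with z hz
    change φ.extend (cornerModel m) ((φ.extend (cornerModel m)).symm z) 1 = z 1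
    rw [(φ.extend (cornerModel m)).right_inv hz]
  rw [e, ContinuousLinearMap.fderivWithin _ ((chartDomain_target φ).uniqueDiffOn y
    ((chartDomain_target φ).subset hy))]
  change v 1 = _
  field_simp

/-- The inward unit normal of `Q` is the same in all adapted charts: by
`exists_mfderiv_eq_unitNormal`, the conormals are positive multiples of each other. -/
theorem unitNormal_eq (h : SmoothField gbar) (hφ : IsAdaptedChart M Q φ)
    (hψ : IsAdaptedChart M Q ψ) {p : X} (hp : p ∈ φ.source) (hp' : p ∈ ψ.source) (hQ : p ∈ Q) :
    unitNormal φ gbar p = unitNormal ψ gbar p := by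
  have key : ∀ {χ : OpenPartialHomeomorph X (CornerSpace m)}, IsAdaptedChart M Q χ →
      p ∈ χ.source → gbar p (unitNormal χ gbar p) (unitNormal χ gbar p) = 1 ∧
      (∃ a : ℝ, 0 < a ∧ ∀ w, (mfderiv (cornerModel m) 𝓘(ℝ, ℝ)
        (fun p => χ.extend (cornerModel m) p 1) p w : ℝ) = a * gbar p (unitNormal χ gbar p) w) ∧
      ∀ {f : X → ℝ} {U : Set X}, IsOpen U → p ∈ U →
        ContMDiffOn (cornerModel m) 𝓘(ℝ, ℝ) ∞ f U → (∀ p ∈ U, 0 ≤ f p) →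
        (∀ p ∈ U, p ∈ Q → f p = 0) → ∃ a : ℝ, 0 ≤ a ∧ ∀ w,
          (mfderiv (cornerModel m) 𝓘(ℝ, ℝ) f p w : ℝ) = a * gbar p (unitNormal χ gbar p) w := by
    intro χ hχ hpχ
    obtain ⟨y, hy, rfl⟩ : ∃ y ∈ (χ.extend (cornerModel m)).target,
        (χ.extend (cornerModel m)).symm y = p :=
      ⟨_, (χ.extend _).map_source (by rwa [χ.extend_source]), χ.extend_left_inv hpχ⟩
    exact ⟨inner_unitNormal_self h hχ.mem_maximalAtlas hy,
      ⟨_, Real.sqrt_pos.2 ((h.coordMetric hχ.mem_maximalAtlas).inv_diag_pos hy 1),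
        mfderiv_chart_coord h hχ.mem_maximalAtlas hy⟩,
      fun hU hyU hf hf0 hfQ => exists_mfderiv_eq_unitNormal h hχ hy
        ((symm_mem_Q_iff hχ hy).1 hQ) hU hyU hf hf0 hfQ⟩
  obtain ⟨h1, -, h2⟩ := key hφ hp
  obtain ⟨h3, ⟨a, ha, hfa⟩, -⟩ := key hψ hp'
  obtain ⟨b, hb, hfb⟩ := h2 ψ.open_source hp' (contMDiffOn_chart_coord hψ.mem_maximalAtlas 1)
    (fun q hq => (ψ q).2.2) (fun q hq hqQ => (hψ.mem_Q_iff q hq).1 hqQ)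
  have e : a • unitNormal ψ gbar p = b • unitNormal φ gbar p := by
    by_contra hne
    have h4 := h.pos p _ (sub_ne_zero.2 hne)
    have h5 (w) : gbar p (a • unitNormal ψ gbar p - b • unitNormal φ gbar p) w = 0 := by
      rw [(gbar p).map_sub, (gbar p).map_smul, (gbar p).map_smul]
      change a * gbar p (unitNormal ψ gbar p) w - b * gbar p (unitNormal φ gbar p) w = 0
      exact sub_eq_zero.2 ((hfa w).symm.trans (hfb w))
    exact h4.ne' (h5 _)
  have hab : a = b := by
    have h5 : gbar p (a • unitNormal ψ gbar p) (a • unitNormal ψ gbar p) =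
      gbar p (b • unitNormal φ gbar p) (b • unitNormal φ gbar p) := by rw [e]
    simp only [map_smul, _root_.smul_apply, smul_eq_mul, h1, h3, mul_one] at h5
    nlinarith
  rw [← hab] at e
  exact (smul_right_injective _ ha.ne' e).symm

end Normal

end CornerGeometry

namespace CornerGeometry

/-! ### The principal curvature of `Q` as a function on `X` -/

/-- The global data: `Q` is umbilic with constant factor `lam` for `g`, and `gbar = r² g` is smooth
up to the boundary. -/
structure CornerSetting {m : ℕ} {X : Type*} [TopologicalSpace X]
    [ChartedSpace (CornerSpace m) X] [IsManifold (cornerModel m) ∞ X] (M Q : Set X)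
    (g : BilinField m X) (lam : ℝ) (r : X → ℝ) (gbar : BilinField m X) : Prop where
  cornered : IsCorneredSpace (m := m) M Q
  defining : IsDefiningFunction (m := m) M r
  metric : SmoothField gbar
  conformal : ∀ p ∉ M, ∀ u v, gbar p u v = r p ^ 2 * g p u v
  umbilic : IsUmbilicFace M Q g lam

/-- The derivative within the corner, in a direction tangent to the corner, is computed by the
coordinate expression of the function. -/
theorem mfderivWithin_corner {m : ℕ} {X : Type*} [TopologicalSpace X]
    [ChartedSpace (CornerSpace m) X] {φ : OpenPartialHomeomorph X (CornerSpace m)}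
    {y : EuclideanSpace ℝ (Fin (m + 2))} {M Q : Set X} (hφ : IsAdaptedChart M Q φ) {η : X → ℝ}
    {f : EuclideanSpace ℝ (Fin (m + 2)) → ℝ}
    (hη : ContMDiffOn (cornerModel m) 𝓘(ℝ, ℝ) ∞ η (M ∩ Q))
    (hf : SmoothFn (range (cornerModel m)) (φ.extend (cornerModel m)).target f)
    (hηf : ∀ y ∈ (φ.extend (cornerModel m)).target, y 0 = 0 → y 1 = 0 →
      η ((φ.extend (cornerModel m)).symm y) = f y)
    (hy : y ∈ (φ.extend (cornerModel m)).target) (hy0 : y 0 = 0) (hy1 : y 1 = 0)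
    {Z : EuclideanSpace ℝ (Fin (m + 2))} (hZ0 : Z 0 = 0) (hZ1 : Z 1 = 0) :
    (mfderivWithin (cornerModel m) 𝓘(ℝ, ℝ) η (M ∩ Q) ((φ.extend (cornerModel m)).symm y)
      (coordVector φ y Z) : ℝ) = ∑ i, Z i * partialDeriv (range (cornerModel m)) i f y := by
  rw [← fderivWithin_apply_eq_sum]
  set L : Set (EuclideanSpace ℝ (Fin (m + 2))) :=
    {y ∈ (φ.extend (cornerModel m)).target | y 0 = 0 ∧ y 1 = 0} with hL
  have hLD : L ⊆ (range (cornerModel m)) := fun y hy => φ.extend_target_subset_range hy.1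
  have hyL : y ∈ L := ⟨hy, hy0, hy1⟩
  have hS : (φ.extend (cornerModel m)).symm y ∈ M ∩ Q :=
    ⟨(symm_mem_M_iff hφ hy).2 hy0, (symm_mem_Q_iff hφ hy).2 hy1⟩
  have h1 := ((hη _ hS).mdifferentiableWithinAt (by simp)).hasMFDerivWithinAt
  have h2 := ((contMDiffWithinAt_extend_symm hφ.mem_maximalAtlas hy).mdifferentiableWithinAt
    (by simp)).hasMFDerivWithinAt.mono hLD
  have h3 := HasMFDerivWithinAt.comp y h1 h2 fun z hz =>
    ⟨(symm_mem_M_iff hφ hz.1).2 hz.2.1, (symm_mem_Q_iff hφ hz.1).2 hz.2.2⟩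
  rw [hasMFDerivWithinAt_iff_hasFDerivWithinAt] at h3
  have h4 := (hf.differentiableWithinAt hy).hasFDerivWithinAt.mono hLD
  have h5 := h4.congr (f₁ := η ∘ (φ.extend (cornerModel m)).symm)
    (fun z hz => hηf z hz.1 hz.2.1 hz.2.2) (hηf y hy hy0 hy1)
  -- both derivatives are compared along the line `t ↦ y + t Z`
  have hγ : HasDerivAt (fun t : ℝ => y + t • Z) Z 0 := by
    simpa using ((hasDerivAt_id (0 : ℝ)).smul_const Z).const_add y
  have hline (t : ℝ) : (y + t • Z) 0 = 0 ∧ (y + t • Z) 1 = 0 := by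
    simp [hy0, hy1, hZ0, hZ1]
  have hJ : ∀ᶠ t in 𝓝 (0 : ℝ), y + t • Z ∈ L := by
    have hc : Tendsto (fun t : ℝ => y + t • Z) (𝓝 0) (𝓝[(range (cornerModel m))] y) := by
      refine tendsto_nhdsWithin_iff.2 ⟨?_, Eventually.of_forall fun t => ?_⟩
      · simpa using hγ.continuousAt.tendsto
      · exact mem_range_cornerModel.2 ⟨(hline t).1.ge, (hline t).2.ge⟩
    filter_upwards [hc (extend_target_mem_nhdsWithin_of_mem hy)] with t ht
    exact ⟨ht, hline t⟩
  have h6 := h3.comp_hasDerivWithinAt_of_eq (s := {t : ℝ | y + t • Z ∈ L}) (0 : ℝ)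
    hγ.hasDerivWithinAt (fun t ht => ht) (by simp)
  have h7 := h5.comp_hasDerivWithinAt_of_eq (s := {t : ℝ | y + t • Z ∈ L}) (0 : ℝ)
    hγ.hasDerivWithinAt (fun t ht => ht) (by simp)
  exact (h6.hasDerivAt hJ).unique (h7.hasDerivAt hJ)

namespace CornerSetting

variable {m : ℕ} {X : Type*} [TopologicalSpace X] [ChartedSpace (CornerSpace m) X]
  [IsManifold (cornerModel m) ∞ X]
  {φ ψ : OpenPartialHomeomorph X (CornerSpace m)} {y : EuclideanSpace ℝ (Fin (m + 2))}
  {M Q : Set X} {g gbar : BilinField m X} {lam : ℝ} {r : X → ℝ}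

local notation "𝔻" => range (cornerModel m)

theorem cornerCoords (h : CornerSetting M Q g lam r gbar) (hφ : IsAdaptedChart M Q φ) :
    CornerCoords (φ.extend (cornerModel m)).target (components φ gbar) (components φ g)
      (fun y => r ((φ.extend (cornerModel m)).symm y)) where
  metric := h.metric.coordMetric hφ.mem_maximalAtlas
  smooth y hy := contDiffWithinAt_comp_symm hφ.mem_maximalAtlas hy h.defining.smooth.contMDiffAt
  eq_zero y hy hy0 := (h.defining.eq_zero_iff _).2 ((symm_mem_M_iff hφ hy).2 hy0)
  pos y hy hy0 := (h.defining.nonneg _).lt_of_ne fun e =>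
    hy0.ne' ((symm_mem_M_iff hφ hy).1 ((h.defining.eq_zero_iff _).1 e.symm))
  conformal y hy hy0 := by
    have hM : (φ.extend (cornerModel m)).symm y ∉ M := fun hM =>
      hy0.ne' ((symm_mem_M_iff hφ hy).1 hM)
    have hr : r ((φ.extend (cornerModel m)).symm y) ≠ 0 := fun e =>
      hM ((h.defining.eq_zero_iff _).1 e)
    ext i j
    rw [Matrix.smul_apply, smul_eq_mul]
    unfold components
    rw [h.conformal _ hM]
    field_simp

theorem umbilic_coords (h : CornerSetting M Q g lam r gbar) (hφ : IsAdaptedChart M Q φ) :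
    ∀ y ∈ (φ.extend (cornerModel m)).target, 0 < y 0 → y 1 = 0 → ∀ i j, i ≠ 1 → j ≠ 1 →
      secondFundamentalForm 𝔻 (components φ g) 1 y i j = lam * components φ g y i j :=
  fun y hy hy0 hy1 => h.umbilic φ hφ y hy
    ⟨(symm_mem_Q_iff hφ hy).2 hy1, fun hM => hy0.ne' ((symm_mem_M_iff hφ hy).1 hM)⟩

/-- The coordinate expression of the normal derivative of `r`. -/
theorem mfderiv_unitNormal (h : CornerSetting M Q g lam r gbar)
    (hφ : φ ∈ IsManifold.maximalAtlas (cornerModel m) ∞ X)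
    (hy : y ∈ (φ.extend (cornerModel m)).target) :
    (mfderiv (cornerModel m) 𝓘(ℝ, ℝ) r ((φ.extend (cornerModel m)).symm y)
      (unitNormal φ gbar ((φ.extend (cornerModel m)).symm y)) : ℝ) =
    gradComp 𝔻 (components φ gbar) (fun y => r ((φ.extend (cornerModel m)).symm y)) 1 y /
      √((components φ gbar y)⁻¹ 1 1) := by
  rw [unitNormal_symm hy, mfderiv_coordVector hφ hy
    (h.defining.smooth.contMDiffAt.mdifferentiableAt (by simp)), fderivWithin_apply_eq_sum]
  unfold gradComp
  rw [Finset.sum_div]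
  refine Finset.sum_congr rfl fun i _ => ?_
  simp only [inwardNormal]
  rw [(h.metric.coordMetric hφ).inv_symm hy i 1]
  exact div_mul_eq_mul_div (_ : ℝ) _ _

/-- Away from the corner, `mul_faceCurvature` expresses the principal curvature by the unit normal,
which does not depend on the chart. -/
theorem faceCurvature_eq_of_pos (h : CornerSetting M Q g lam r gbar) (hφ : IsAdaptedChart M Q φ)
    (hψ : IsAdaptedChart M Q ψ) {p : X} (hp : p ∈ φ.source) (hp' : p ∈ ψ.source) (hQ : p ∈ Q)
    (hM : p ∉ M) :
    faceCurvature (components φ gbar) (φ.extend (cornerModel m) p) =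
      faceCurvature (components ψ gbar) (ψ.extend (cornerModel m) p) := by
  have key {χ : OpenPartialHomeomorph X (CornerSpace m)} (hχ : IsAdaptedChart M Q χ)
      (hpχ : p ∈ χ.source) : (mfderiv (cornerModel m) 𝓘(ℝ, ℝ) r p (unitNormal χ gbar p) : ℝ) =
        lam - r p * faceCurvature (components χ gbar) (χ.extend (cornerModel m) p) := by
    obtain ⟨y, hy, rfl⟩ : ∃ y ∈ (χ.extend (cornerModel m)).target,
        (χ.extend (cornerModel m)).symm y = p :=
      ⟨_, (χ.extend _).map_source (by rwa [χ.extend_source]), χ.extend_left_inv hpχ⟩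
    rw [(χ.extend (cornerModel m)).right_inv hy, h.mfderiv_unitNormal hχ.mem_maximalAtlas hy]
    have hc := h.cornerCoords hχ
    have := hc.mul_faceCurvature (h.umbilic_coords hχ) hy
      ((hc.zero_le hy).lt_of_ne fun e => hM ((symm_mem_M_iff hχ hy).2 e.symm))
      ((symm_mem_Q_iff hχ hy).1 hQ)
    exact (sub_sub_cancel lam _).symm.trans (congrArg (lam - ·) this.symm)
  have h1 := key hφ hp
  rw [unitNormal_eq h.metric hφ hψ hp hp' hQ, key hψ hp'] at h1
  exact (mul_left_cancel₀ (fun e => hM ((h.defining.eq_zero_iff _).1 e))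
    (sub_right_injective h1)).symm

/-- The principal curvature of `Q` is the same in all adapted charts. On the corner, this follows
from the case of points outside the corner by continuity. -/
theorem faceCurvature_eq (h : CornerSetting M Q g lam r gbar) (hφ : IsAdaptedChart M Q φ)
    (hψ : IsAdaptedChart M Q ψ) {p : X} (hp : p ∈ φ.source) (hp' : p ∈ ψ.source) (hQ : p ∈ Q) :
    faceCurvature (components φ gbar) (φ.extend (cornerModel m) p) =
      faceCurvature (components ψ gbar) (ψ.extend (cornerModel m) p) := by
  by_cases hM : p ∈ M
  swap
  · exact h.faceCurvature_eq_of_pos hφ hψ hp hp' hQ hM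
  obtain ⟨y, hy, rfl⟩ : ∃ y ∈ (φ.extend (cornerModel m)).target,
      (φ.extend (cornerModel m)).symm y = p :=
    ⟨_, (φ.extend _).map_source (by rwa [φ.extend_source]), φ.extend_left_inv hp⟩
  have hD := chartDomain_inter_preimage φ ψ.open_source
  have hy0 := (symm_mem_M_iff hφ hy).1 hM
  have hy1 := (symm_mem_Q_iff hφ hy).1 hQ
  rw [(φ.extend (cornerModel m)).right_inv hy]
  have hτ : ContinuousWithinAt (fun y => ψ.extend (cornerModel m)
      ((φ.extend (cornerModel m)).symm y)) 𝔻 y :=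
    ((ψ.continuousAt_extend hp').comp (φ.continuousAt_extend_symm' hy)).continuousWithinAt
  have hc2 : ContinuousWithinAt (fun y => faceCurvature (components ψ gbar)
      (ψ.extend (cornerModel m) ((φ.extend (cornerModel m)).symm y))) 𝔻 y := by
    refine ContinuousWithinAt.comp (g := faceCurvature (components ψ gbar))
      (f := fun y => ψ.extend (cornerModel m) ((φ.extend (cornerModel m)).symm y)) (t := 𝔻)
      (((h.cornerCoords hψ).smooth_faceCurvature
      ).continuousWithinAt ((ψ.extend _).map_source (by rwa [ψ.extend_source]))) hτ
      fun z _ => ⟨_, rfl⟩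
  refine eq_of_eq_ray rayStable_range_cornerModel hD ⟨hy, hp'⟩
    ((h.cornerCoords hφ).smooth_faceCurvature.continuousWithinAt hy) hc2 0 fun t ht hT => ?_
  have e := h.faceCurvature_eq_of_pos hφ hψ (symm_mem_source hT.1) hT.2
    ((symm_mem_Q_iff hφ hT.1).2 (by simp [hy1]))
    (fun hM => by simpa [hy0, ht.ne'] using (symm_mem_M_iff hφ hT.1).1 hM)
  rw [(φ.extend (cornerModel m)).right_inv hT.1] at e
  exact e

/-- The principal curvature of `Q` with respect to `gbar`, as a function on `X` which is
meaningful on `Q`; it is computed in some adapted chart. -/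
noncomputable def cornerCurvature (h : CornerSetting M Q g lam r gbar) (p : X) : ℝ :=
  faceCurvature (components (h.cornered.exists_chart p).choose gbar)
    ((h.cornered.exists_chart p).choose.extend (cornerModel m) p)

theorem cornerCurvature_eq (h : CornerSetting M Q g lam r gbar) (hφ : IsAdaptedChart M Q φ)
    {p : X} (hp : p ∈ φ.source) (hQ : p ∈ Q) :
    h.cornerCurvature p = faceCurvature (components φ gbar) (φ.extend (cornerModel m) p) :=
  h.faceCurvature_eq (h.cornered.exists_chart p).choose_spec.1 hφ
    (h.cornered.exists_chart p).choose_spec.2 hp hQ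

theorem cornerCurvature_symm (h : CornerSetting M Q g lam r gbar) (hφ : IsAdaptedChart M Q φ)
    (hy : y ∈ (φ.extend (cornerModel m)).target) (hy1 : y 1 = 0) :
    h.cornerCurvature ((φ.extend (cornerModel m)).symm y) =
      faceCurvature (components φ gbar) y := by
  rw [h.cornerCurvature_eq hφ (symm_mem_source hy) ((symm_mem_Q_iff hφ hy).2 hy1),
    (φ.extend (cornerModel m)).right_inv hy]

theorem contMDiffOn_cornerCurvature (h : CornerSetting M Q g lam r gbar) :
    ContMDiffOn (cornerModel m) 𝓘(ℝ, ℝ) ∞ h.cornerCurvature (M ∩ Q) := by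
  intro p hp
  obtain ⟨φ, hφ, hpφ⟩ := h.cornered.exists_chart p
  have h1 : ContMDiffAt (cornerModel m) 𝓘(ℝ, ℝ) ∞
      (fun p => faceCurvature (components φ gbar) (φ.extend (cornerModel m) p)) p := by
    have hs := (h.cornerCoords hφ).smooth_faceCurvature (φ.extend (cornerModel m) p)
      ((φ.extend _).map_source (by rwa [φ.extend_source]))
    exact ContMDiffWithinAt.comp p hs.contMDiffWithinAt
      (φ.contMDiffAt_extend hφ.mem_maximalAtlas hpφ) fun q _ => ⟨_, rfl⟩
  refine h1.contMDiffWithinAt.congr_of_eventuallyEq_of_mem ?_ hp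
  filter_upwards [mem_nhdsWithin_of_mem_nhds (φ.open_source.mem_nhds hpφ), self_mem_nhdsWithin]
    with q hq hqS
  exact h.cornerCurvature_eq hφ hq hqS.2

end CornerSetting

/-- The condition `|dr| = 1` in coordinates. -/
theorem gradNormSq_eq_one {m : ℕ} {X : Type*} [TopologicalSpace X] [ChartedSpace (CornerSpace m) X]
    [IsManifold (cornerModel m) ∞ X] {φ : OpenPartialHomeomorph X (CornerSpace m)}
    {y : EuclideanSpace ℝ (Fin (m + 2))} {gbar : BilinField m X} {r : X → ℝ}
    (h : SmoothField gbar) (hφ : φ ∈ IsManifold.maximalAtlas (cornerModel m) ∞ X)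
    (hr : ContMDiff (cornerModel m) 𝓘(ℝ, ℝ) ∞ r) (hy : y ∈ (φ.extend (cornerModel m)).target)
    (hu : ∃ w : TangentSpace (cornerModel m) ((φ.extend (cornerModel m)).symm y),
      (∀ v, gbar _ w v = mfderiv (cornerModel m) 𝓘(ℝ, ℝ) r
        ((φ.extend (cornerModel m)).symm y) v) ∧ gbar _ w w = 1) :
    gradNormSq (range (cornerModel m)) (components φ gbar)
      (fun y => r ((φ.extend (cornerModel m)).symm y)) y = 1 := by
  obtain ⟨w, hw, hw1⟩ := hu
  obtain ⟨W, rfl⟩ := coordVector_surjective hφ hy w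
  have hG := h.coordMetric hφ
  set p : Fin (m + 2) → ℝ := fun a => partialDeriv (range (cornerModel m)) a
    (fun y => r ((φ.extend (cornerModel m)).symm y)) y with hp
  have h1 (v : EuclideanSpace ℝ (Fin (m + 2))) :
      ∑ i, ∑ j, W i * components φ gbar y i j * v j = ∑ i, v i * p i := by
    rw [← inner_coordVector, hw, mfderiv_coordVector hφ hy
      (hr.contMDiffAt.mdifferentiableAt (by simp)), fderivWithin_apply_eq_sum]
  have h2 (j : Fin (m + 2)) : ∑ i, W i * components φ gbar y i j = p j := by
    have := h1 (EuclideanSpace.single j 1)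
    simpa [Pi.single_apply] using this
  have h3 (l : Fin (m + 2)) : gradComp (range (cornerModel m)) (components φ gbar)
      (fun y => r ((φ.extend (cornerModel m)).symm y)) l y = W l := by
    calc _ = ∑ a, (components φ gbar y)⁻¹ l a * p a := rfl
      _ = ∑ i, (∑ a, (components φ gbar y)⁻¹ l a * components φ gbar y a i) * W i := by
        simp only [← h2, Finset.mul_sum, Finset.sum_mul]
        rw [Finset.sum_comm]
        refine Finset.sum_congr rfl fun _ _ => Finset.sum_congr rfl fun _ _ => ?_
        rw [hG.symm hy]; ring
      _ = W l := by simp [hG.sum_inv_mul hy]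
  unfold gradNormSq
  simp only [h3]
  rw [inner_coordVector, h1] at hw1
  rw [← hw1]
  exact Finset.sum_congr rfl fun _ _ => mul_comm _ _

namespace CornerSetting

variable {m : ℕ} {X : Type*} [TopologicalSpace X] [ChartedSpace (CornerSpace m) X]
  [IsManifold (cornerModel m) ∞ X]
  {φ : OpenPartialHomeomorph X (CornerSpace m)} {y : EuclideanSpace ℝ (Fin (m + 2))}
  {M Q : Set X} {g : BilinField m X} {lam : ℝ} {r : X → ℝ}

local notation "𝔻" => range (cornerModel m)

/-- A neighborhood of the face at infinity, in an adapted chart, on which `|dr| = 1`. -/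
theorem exists_unitGradient_domain {gbar : SmoothMetric m X}
    (h : CornerSetting M Q g lam r gbar.inner)
    (hu : ∀ᶠ p in 𝓝ˢ M, HasUnitGradientAt gbar r p) (hφ : IsAdaptedChart M Q φ) :
    ∃ T ⊆ (φ.extend (cornerModel m)).target, ChartDomain 𝔻 T ∧
      (∀ y ∈ (φ.extend (cornerModel m)).target, y 0 = 0 → y ∈ T) ∧
      ∀ y ∈ T, gradNormSq 𝔻 (components φ gbar.inner)
        (fun y => r ((φ.extend (cornerModel m)).symm y)) y = 1 := by
  obtain ⟨U, hU, hMU, hUr⟩ := eventually_nhdsSet_iff_exists.1 hu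
  refine ⟨_, inter_subset_left, chartDomain_inter_preimage φ hU,
    fun y hy hy0 => ⟨hy, hMU ((symm_mem_M_iff hφ hy).2 hy0)⟩, fun y hy => ?_⟩
  exact gradNormSq_eq_one h.metric hφ.mem_maximalAtlas h.defining.smooth hy.1 (hUr _ hy.2)

/-- The function `cornerCurvature / √(1 - lam ^ 2)` has the properties required of `η`. -/
theorem umbilic_and_equation (hm : 1 ≤ m) {gbar : SmoothMetric m X}
    (h : CornerSetting M Q g lam r gbar.inner)
    (hu : ∀ᶠ p in 𝓝ˢ M, HasUnitGradientAt gbar r p) (hE : IsEinstein M g) :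
    IsUmbilicCornerWith M Q gbar.inner (fun p => h.cornerCurvature p / √(1 - lam ^ 2)) ∧
    SatisfiesCornerEquation M Q gbar.inner (fun p => h.cornerCurvature p / √(1 - lam ^ 2)) := by
  have key {φ : OpenPartialHomeomorph X (CornerSpace m)} (hφ : IsAdaptedChart M Q φ) :
      ∃ T ⊆ (φ.extend (cornerModel m)).target,
        CornerCoords T (components φ gbar.inner) (components φ g)
          (fun y => r ((φ.extend (cornerModel m)).symm y)) ∧
        (∀ y ∈ (φ.extend (cornerModel m)).target, y 0 = 0 → y ∈ T) ∧
        (∀ y ∈ T, gradNormSq 𝔻 (components φ gbar.inner)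
          (fun y => r ((φ.extend (cornerModel m)).symm y)) y = 1) ∧
        ∀ y ∈ T, y 0 = 0 → ∀ i j, hessComp 𝔻 (components φ gbar.inner)
          (fun y => r ((φ.extend (cornerModel m)).symm y)) i j y = 0 := by
    obtain ⟨T, hT, hD, hface, hgrad⟩ := h.exists_unitGradient_domain hu hφ
    have hc := (h.cornerCoords hφ).restrict hD hT
    exact ⟨T, hT, hc, hface, hgrad, fun y hy hy0 => hc.hessComp_eq_zero hm hgrad
      (fun y hy hy0 => hE φ hφ.mem_maximalAtlas y (hT hy)
        fun hM => hy0.ne' ((symm_mem_M_iff hφ (hT hy)).1 hM)) hy hy0⟩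
  constructor
  · intro φ hφ z hz0 hz i j
    obtain ⟨T, hT, hc, hface, hgrad, hH⟩ := key hφ
    have hzT := hface _ hz (by simp)
    change _ = h.cornerCurvature _ / √(1 - lam ^ 2) * faceMetric _ _ _ _ _
    rw [h.cornerCurvature_symm hφ hz (by simpa)]
    exact hc.secondFundamentalForm_corner (fun y hy => h.umbilic_coords hφ y (hT hy)) hzT hz0
      (hgrad _ hzT) (hH _ hzT (by simp)) i j
  · intro φ hφ z hz0 hz Z hZ0 hZ1
    obtain ⟨T, hT, hc, hface, hgrad, hH⟩ := key hφ
    have hzT := hface _ hz (by simp)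
    have hf := (h.cornerCoords hφ).smooth_faceCurvature
    rw [mfderivWithin_corner hφ (f := fun y => (√(1 - lam ^ 2))⁻¹ *
        faceCurvature (components φ gbar.inner) y) ?_ ((SmoothFn.const _).mul hf)
      (fun y hy _ hy1 => by rw [h.cornerCurvature_symm hφ hy hy1, div_eq_inv_mul]) hz (by simp)
      (by simpa) hZ0 hZ1]
    · have := hc.corner_equation (fun y hy => h.umbilic_coords hφ y (hT hy)) hH hzT hz0
        (hgrad _ hzT) (Z := fun i => Z i) hZ0 hZ1
      refine Eq.trans ?_ this
      rw [Finset.sum_div]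
      refine Finset.sum_congr rfl fun i _ => ?_
      rw [partialDeriv_const_mul (chartDomain_target φ) hz hf]
      have e (a b c : ℝ) : a * (b⁻¹ * c) = a * c / b := by ring
      exact e _ _ _
    · exact h.contMDiffOn_cornerCurvature.div_const _

end CornerSetting

end CornerGeometry

namespace CornerGeometry

/-! ### Umbilic faces in flat space -/

/-- The functions `Φ a` are Cartesian coordinates for `G`: the metric `G` is the pullback of the
Euclidean metric by the map with components `Φ a`. -/
structure FlatCoords {k : ℕ} (s T : Set (EuclideanSpace ℝ (Fin k)))
    (G : EuclideanSpace ℝ (Fin k) → Matrix (Fin k) (Fin k) ℝ)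
    (Φ : Fin k → EuclideanSpace ℝ (Fin k) → ℝ) : Prop where
  metric : SmoothCoordMetric s T G
  smooth : ∀ a, SmoothFn s T (Φ a)
  eq : ∀ y ∈ T, ∀ i j, G y i j = ∑ a, partialDeriv s i (Φ a) y * partialDeriv s j (Φ a) y

/-- The Cartesian components of the unit normal to the face `{x_f = 0}`. -/
noncomputable def flatNormal {k : ℕ} (s : Set (EuclideanSpace ℝ (Fin k)))
    (G : EuclideanSpace ℝ (Fin k) → Matrix (Fin k) (Fin k) ℝ)
    (Φ : Fin k → EuclideanSpace ℝ (Fin k) → ℝ) (f a : Fin k) (y : EuclideanSpace ℝ (Fin k)) : ℝ :=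
  ∑ l, inwardNormal G f y l * partialDeriv s l (Φ a) y

namespace FlatCoords

variable {k : ℕ} {s T : Set (EuclideanSpace ℝ (Fin k))}
  {G : EuclideanSpace ℝ (Fin k) → Matrix (Fin k) (Fin k) ℝ}
  {Φ : Fin k → EuclideanSpace ℝ (Fin k) → ℝ} {x : EuclideanSpace ℝ (Fin k)} {f : Fin k}
  {η : EuclideanSpace ℝ (Fin k) → ℝ}

/-- The coordinate vectors span: a vector orthogonal to all of them vanishes. -/
theorem eq_zero_of_sum_eq_zero (h : FlatCoords s T G Φ) (hx : x ∈ T) {w : Fin k → ℝ}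
    (hw : ∀ j, ∑ a, w a * partialDeriv s j (Φ a) x = 0) : w = 0 := by
  set J : Matrix (Fin k) (Fin k) ℝ := fun a i => partialDeriv s i (Φ a) x with hJ
  have hG : J.transpose * J = G x := by
    ext i j
    rw [h.eq x hx, Matrix.mul_apply]
    rfl
  have h1 : ((G x)⁻¹ * J.transpose) * J = 1 := by
    rw [Matrix.mul_assoc, hG, h.metric.inv_mul hx]
  have h2 : J * ((G x)⁻¹ * J.transpose) = 1 := mul_eq_one_comm.1 h1
  have h3 : Matrix.vecMul w J = 0 := funext hw
  calc w = Matrix.vecMul w (J * ((G x)⁻¹ * J.transpose)) := by rw [h2, Matrix.vecMul_one]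
    _ = 0 := by rw [← Matrix.vecMul_vecMul, h3, Matrix.zero_vecMul]

/-- The tangential part of the second derivative of a flat coordinate is given by the Christoffel
symbols. -/
theorem sum_partialDeriv_mul (h : FlatCoords s T G Φ) (hx : x ∈ T) (b i j : Fin k) :
    ∑ a, partialDeriv s b (Φ a) x * partialDeriv s i (partialDeriv s j (Φ a)) x =
      ∑ l, G x b l * christoffel s G l i j x := by
  have hD := h.metric.domain
  have hp (i a : Fin k) : SmoothFn s T (partialDeriv s i (Φ a)) := (h.smooth a).partialDeriv hD i
  have hd (c i j : Fin k) : partialDeriv s c (fun y => G y i j) x =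
      ∑ a, (partialDeriv s c (partialDeriv s i (Φ a)) x * partialDeriv s j (Φ a) x +
        partialDeriv s i (Φ a) x * partialDeriv s c (partialDeriv s j (Φ a)) x) := by
    rw [partialDeriv_congr hD hx c fun y hy => h.eq y hy i j,
      partialDeriv_sum hD hx fun a _ => (hp i a).mul (hp j a)]
    exact Finset.sum_congr rfl fun a _ => partialDeriv_mul hD hx (hp i a) (hp j a) c
  have hcomm (i j a : Fin k) : partialDeriv s i (partialDeriv s j (Φ a)) x =
      partialDeriv s j (partialDeriv s i (Φ a)) x := partialDeriv_comm hD hx (h.smooth a) i j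
  rw [h.metric.sum_mul_christoffel hx, hd, hd, hd, ← Finset.sum_add_distrib,
    ← Finset.sum_sub_distrib, Finset.mul_sum]
  refine Finset.sum_congr rfl fun a _ => ?_
  rw [hcomm b i, hcomm b j, hcomm j i]
  ring

theorem sum_flatNormal_mul (f : Fin k) (v : Fin k → ℝ) :
    ∑ a, flatNormal s G Φ f a x * v a =
      ∑ l, inwardNormal G f x l * ∑ a, partialDeriv s l (Φ a) x * v a := by
  simp only [flatNormal, Finset.sum_mul, Finset.mul_sum]
  rw [Finset.sum_comm]
  exact Finset.sum_congr rfl fun _ _ => Finset.sum_congr rfl fun _ _ => by ring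

theorem sum_flatNormal_mul_partialDeriv (h : FlatCoords s T G Φ) (hx : x ∈ T) (f j : Fin k) :
    ∑ a, flatNormal s G Φ f a x * partialDeriv s j (Φ a) x =
      if j = f then (√((G x)⁻¹ f f))⁻¹ else 0 := by
  rw [sum_flatNormal_mul, ← h.metric.sum_mul_inwardNormal hx]
  exact Finset.sum_congr rfl fun l _ => by rw [← h.eq x hx, h.metric.symm hx l j, mul_comm]

theorem sum_flatNormal_sq (h : FlatCoords s T G Φ) (hx : x ∈ T) (f : Fin k) :
    ∑ a, flatNormal s G Φ f a x * flatNormal s G Φ f a x = 1 := by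
  have h1 := h.metric.inv_diag_pos hx f
  rw [sum_flatNormal_mul]
  simp_rw [mul_comm (partialDeriv s _ (Φ _) x), h.sum_flatNormal_mul_partialDeriv hx]
  rw [Finset.sum_eq_single f (fun l _ hl => by rw [if_neg hl, mul_zero]) (by simp), if_pos rfl,
    inwardNormal, ← div_eq_mul_inv, div_div, Real.mul_self_sqrt h1.le, div_self h1.ne']

theorem smooth_flatNormal (h : FlatCoords s T G Φ) (f a : Fin k) :
    SmoothFn s T (flatNormal s G Φ f a) := by
  have hs (y) (hy : y ∈ T) := h.metric.inv_diag_pos hy f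
  exact SmoothFn.sum fun l _ => ((h.metric.smooth_inv l f).div (h.metric.smooth_sqrt_inv f)
    fun y hy => (Real.sqrt_pos.2 (hs y hy)).ne').mul
      ((h.smooth a).partialDeriv h.metric.domain l)

/-- The Weingarten equation for an umbilic face. -/
theorem partialDeriv_flatNormal (h : FlatCoords s T G Φ)
    (hx : x ∈ T) {i : Fin k} (hi : i ≠ f)
    (hK : ∀ j, j ≠ f → christoffel s G f i j x = √((G x)⁻¹ f f) * η x * G x i j) (a : Fin k) :
    partialDeriv s i (flatNormal s G Φ f a) x = - η x * partialDeriv s i (Φ a) x := by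
  have hD := h.metric.domain
  have hN (a) := h.smooth_flatNormal f a
  have hp (i a : Fin k) : SmoothFn s T (partialDeriv s i (Φ a)) := (h.smooth a).partialDeriv hD i
  have h1 := h.metric.inv_diag_pos hx f
  have hs := Real.sqrt_pos.2 h1
  -- the vector `∂_i N + η ∂_i Φ` is orthogonal to all coordinate vectors
  set w : Fin k → ℝ := fun a => partialDeriv s i (flatNormal s G Φ f a) x +
    η x * partialDeriv s i (Φ a) x with hw
  have hwN : ∑ a, flatNormal s G Φ f a x * w a = 0 := by
    have e := partialDeriv_congr hD hx i fun y hy => h.sum_flatNormal_sq hy f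
    rw [partialDeriv_const, partialDeriv_sum hD hx fun a _ => (hN a).mul (hN a)] at e
    have e2 := h.sum_flatNormal_mul_partialDeriv hx f i
    rw [if_neg hi] at e2
    calc ∑ a, flatNormal s G Φ f a x * w a
        = (∑ a, partialDeriv s i (fun y => flatNormal s G Φ f a y * flatNormal s G Φ f a y) x) / 2
          + η x * ∑ a, flatNormal s G Φ f a x * partialDeriv s i (Φ a) x := by
          rw [Finset.sum_div, Finset.mul_sum, ← Finset.sum_add_distrib]
          refine Finset.sum_congr rfl fun a _ => ?_
          rw [partialDeriv_mul hD hx (hN a) (hN a)]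
          ring
      _ = 0 := by rw [e, e2]; ring
  have hwj (j : Fin k) (hj : j ≠ f) : ∑ a, partialDeriv s j (Φ a) x * w a = 0 := by
    have e := partialDeriv_congr hD hx i fun y hy =>
      (h.sum_flatNormal_mul_partialDeriv hy f j).trans (if_neg hj)
    rw [partialDeriv_const, partialDeriv_sum hD hx fun a _ => (hN a).mul (hp j a)] at e
    have e2 : ∑ a, flatNormal s G Φ f a x * partialDeriv s i (partialDeriv s j (Φ a)) x =
        η x * G x i j := by
      calc _ = ∑ l, inwardNormal G f x l * ∑ b, G x l b * christoffel s G b i j x := by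
            simp only [sum_flatNormal_mul, h.sum_partialDeriv_mul hx]
        _ = ∑ b, (∑ l, G x b l * inwardNormal G f x l) * christoffel s G b i j x := by
            simp only [Finset.mul_sum, Finset.sum_mul]
            rw [Finset.sum_comm]
            refine Finset.sum_congr rfl fun b _ => Finset.sum_congr rfl fun l _ => ?_
            rw [h.metric.symm hx l b]; ring
        _ = (√((G x)⁻¹ f f))⁻¹ * christoffel s G f i j x := by
            simp [h.metric.sum_mul_inwardNormal hx]
        _ = η x * G x i j := by rw [hK j hj]; field_simp
    calc ∑ a, partialDeriv s j (Φ a) x * w a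
        = ∑ a, partialDeriv s i (fun y => flatNormal s G Φ f a y * partialDeriv s j (Φ a) y) x
          - ∑ a, flatNormal s G Φ f a x * partialDeriv s i (partialDeriv s j (Φ a)) x
          + η x * ∑ a, partialDeriv s i (Φ a) x * partialDeriv s j (Φ a) x := by
          rw [Finset.mul_sum, ← Finset.sum_sub_distrib, ← Finset.sum_add_distrib]
          refine Finset.sum_congr rfl fun a _ => ?_
          rw [partialDeriv_mul hD hx (hN a) (hp j a)]
          ring
      _ = 0 := by rw [e, e2, ← h.eq x hx]; ring
  have hwf : ∑ a, partialDeriv s f (Φ a) x * w a = 0 := by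
    rw [sum_flatNormal_mul, Finset.sum_eq_single f (fun l _ hl => by rw [hwj l hl, mul_zero])
      (by simp)] at hwN
    refine (mul_eq_zero.1 hwN).resolve_left ?_
    simp only [inwardNormal]
    positivity
  have h0 := h.eq_zero_of_sum_eq_zero hx (w := w) fun j => by
    rw [Finset.sum_congr rfl fun a _ => mul_comm (w a) _]
    rcases eq_or_ne j f with rfl | hj
    exacts [hwf, hwj j hj]
  have := congrFun h0 a
  simp only [hw, Pi.zero_apply] at this
  linarith

/-- The principal curvature of an umbilic face in flat space is constant along the face, by
comparing the mixed second derivatives of the normal. -/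
theorem partialDeriv_curvature_eq_zero (hs : RayStable s) (h : FlatCoords s T G Φ)
    (hη : SmoothFn s T η)
    (hK : ∀ y ∈ T, y f = 0 → ∀ i j, i ≠ f → j ≠ f →
      christoffel s G f i j y = √((G y)⁻¹ f f) * η y * G y i j)
    (hx : x ∈ T) (hxf : x f = 0) {i j : Fin k} (hi : i ≠ f) (hj : j ≠ f) (hij : i ≠ j) :
    partialDeriv s i η x = 0 := by
  have hD := h.metric.domain
  have hN (a) := h.smooth_flatNormal f a
  have hp (i a : Fin k) : SmoothFn s T (partialDeriv s i (Φ a)) := (h.smooth a).partialDeriv hD i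
  -- the mixed second derivatives of the normal agree
  have h2 (i j : Fin k) (hi : i ≠ f) (hj : j ≠ f) (a : Fin k) :
      partialDeriv s i (partialDeriv s j (flatNormal s G Φ f a)) x =
        -(partialDeriv s i η x * partialDeriv s j (Φ a) x +
          η x * partialDeriv s i (partialDeriv s j (Φ a)) x) := by
    rw [partialDeriv_congr_face hs hD hx ((hN a).partialDeriv hD j) (hη.mul (hp j a)).neg hxf hi
      fun y hy hyf => by
        rw [h.partialDeriv_flatNormal hy hj (fun l hl => hK y hy hyf j l hj hl) a, neg_mul],
      partialDeriv_neg hD hx (hη.mul (hp j a)), partialDeriv_mul hD hx hη (hp j a)]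
  have h3 (a : Fin k) : partialDeriv s i η x * partialDeriv s j (Φ a) x =
      partialDeriv s j η x * partialDeriv s i (Φ a) x := by
    have e1 := h2 i j hi hj a
    have e2 := h2 j i hj hi a
    rw [partialDeriv_comm hD hx (hN a) j i, partialDeriv_comm hD hx (h.smooth a) j i] at e2
    linarith
  have h4 (c : Fin k) : partialDeriv s i η x * G x j c = partialDeriv s j η x * G x i c := by
    rw [h.eq x hx, h.eq x hx, Finset.mul_sum, Finset.mul_sum]
    refine Finset.sum_congr rfl fun a _ => ?_
    rw [← mul_assoc, h3, mul_assoc]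
  have h5 : ∑ c, (partialDeriv s i η x * G x j c) * (G x)⁻¹ c j =
      ∑ c, (partialDeriv s j η x * G x i c) * (G x)⁻¹ c j := by simp only [h4]
  simp only [mul_assoc, ← Finset.mul_sum, h.metric.sum_mul_inv hx, if_neg hij] at h5
  simpa using h5

/-- Along an umbilic face, the center of curvature `N + η Φ` is constant. -/
theorem partialDeriv_center_eq_zero (hs : RayStable s) (h : FlatCoords s T G Φ)
    (hη : SmoothFn s T η)
    (hK : ∀ y ∈ T, y f = 0 → ∀ i j, i ≠ f → j ≠ f →
      christoffel s G f i j y = √((G y)⁻¹ f f) * η y * G y i j)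
    (hx : x ∈ T) (hxf : x f = 0) {i j : Fin k} (hi : i ≠ f) (hj : j ≠ f) (hij : i ≠ j)
    (a : Fin k) : partialDeriv s i (fun y => flatNormal s G Φ f a y + η y * Φ a y) x = 0 := by
  have hD := h.metric.domain
  rw [partialDeriv_add hD hx (h.smooth_flatNormal f a) (hη.mul (h.smooth a)),
    partialDeriv_mul hD hx hη (h.smooth a),
    h.partialDeriv_flatNormal hx hi (fun l hl => hK x hx hxf i l hi hl) a,
    h.partialDeriv_curvature_eq_zero hs hη hK hx hxf hi hj hij]
  ring

/-- Along an umbilic face, the constant term of the equation of the sphere (or hyperplane) is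
constant. -/
theorem partialDeriv_power_eq_zero (hs : RayStable s) (h : FlatCoords s T G Φ)
    (hη : SmoothFn s T η)
    (hK : ∀ y ∈ T, y f = 0 → ∀ i j, i ≠ f → j ≠ f →
      christoffel s G f i j y = √((G y)⁻¹ f f) * η y * G y i j)
    (hx : x ∈ T) (hxf : x f = 0) {i j : Fin k} (hi : i ≠ f) (hj : j ≠ f) (hij : i ≠ j) :
    partialDeriv s i
      (fun y => ∑ a, (2 * flatNormal s G Φ f a y + η y * Φ a y) * Φ a y) x = 0 := by
  have hD := h.metric.domain
  have hN (a) := h.smooth_flatNormal f a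
  have h2 (a : Fin k) : SmoothFn s T fun y => 2 * flatNormal s G Φ f a y :=
    (SmoothFn.const 2).mul (hN a)
  have h1 := h.sum_flatNormal_mul_partialDeriv hx f i
  rw [if_neg hi] at h1
  rw [partialDeriv_sum hD hx fun a _ => ((h2 a).add (hη.mul (h.smooth a))).mul (h.smooth a)]
  calc _ = 2 * ∑ a, flatNormal s G Φ f a x * partialDeriv s i (Φ a) x := by
        rw [Finset.mul_sum]
        refine Finset.sum_congr rfl fun a _ => ?_
        rw [partialDeriv_mul hD hx ((h2 a).add (hη.mul (h.smooth a))) (h.smooth a),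
          partialDeriv_add hD hx (h2 a) (hη.mul (h.smooth a)),
          partialDeriv_const_mul hD hx (hN a), partialDeriv_mul hD hx hη (h.smooth a),
          h.partialDeriv_flatNormal hx hi (fun l hl => hK x hx hxf i l hi hl) a,
          h.partialDeriv_curvature_eq_zero hs hη hK hx hxf hi hj hij]
        ring
    _ = 0 := by rw [h1, mul_zero]

end FlatCoords

end CornerGeometry

namespace CornerGeometry

/-! ### Locally constant functions on the corner -/

/-- A function on the corner whose tangential derivatives vanish is locally constant. -/
theorem eventually_eq_of_partialDeriv_eq_zero {m : ℕ} {X : Type*} [TopologicalSpace X]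
    {φ : OpenPartialHomeomorph X (CornerSpace m)} [ChartedSpace (CornerSpace m) X]
    {M Q : Set X} (hφ : IsAdaptedChart M Q φ) {p : X} (hp : p ∈ φ.source) (hpS : p ∈ M ∩ Q)
    {f : X → ℝ} {f' : EuclideanSpace ℝ (Fin (m + 2)) → ℝ}
    (hf' : SmoothFn (range (cornerModel m)) (φ.extend (cornerModel m)).target f')
    (hff' : ∀ y ∈ (φ.extend (cornerModel m)).target, y 0 = 0 → y 1 = 0 →
      f ((φ.extend (cornerModel m)).symm y) = f' y)
    (hd : ∀ y ∈ (φ.extend (cornerModel m)).target, y 0 = 0 → y 1 = 0 → ∀ i, i ≠ 0 → i ≠ 1 →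
      partialDeriv (range (cornerModel m)) i f' y = 0) :
    ∀ᶠ q in 𝓝[M ∩ Q] p, f q = f p := by
  have hpt : φ.extend (cornerModel m) p ∈ (φ.extend (cornerModel m)).target :=
    (φ.extend _).map_source (by rwa [φ.extend_source])
  obtain ⟨ε, hε, hεt⟩ := Metric.mem_nhdsWithin_iff.1 (extend_target_mem_nhdsWithin_of_mem hpt)
  have hcoord {q : X} (hq : q ∈ φ.source) (hqS : q ∈ M ∩ Q) :
      φ.extend (cornerModel m) q 0 = 0 ∧ φ.extend (cornerModel m) q 1 = 0 :=
    ⟨(hφ.mem_M_iff q hq).1 hqS.1, (hφ.mem_Q_iff q hq).1 hqS.2⟩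
  have hval {q : X} (hq : q ∈ φ.source) (hqS : q ∈ M ∩ Q) :
      f q = f' (φ.extend (cornerModel m) q) := by
    have hqt : φ.extend (cornerModel m) q ∈ (φ.extend (cornerModel m)).target :=
      (φ.extend _).map_source (by rwa [φ.extend_source])
    rw [← hff' _ hqt (hcoord hq hqS).1 (hcoord hq hqS).2, φ.extend_left_inv hq]
  filter_upwards [mem_nhdsWithin_of_mem_nhds (φ.open_source.mem_nhds hp), self_mem_nhdsWithin,
    mem_nhdsWithin_of_mem_nhds ((φ.continuousAt_extend (I := cornerModel m) hp).preimage_mem_nhds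
      (Metric.ball_mem_nhds _ hε))] with q hq hqS hqε
  rw [hval hq hqS, hval hp hpS]
  obtain ⟨x0, x1⟩ := hcoord hp hpS
  obtain ⟨z0, z1⟩ := hcoord hq hqS
  set x := φ.extend (cornerModel m) p
  set z := φ.extend (cornerModel m) q
  -- the function is constant on the segment from `x` to `z`
  have hline (t : ℝ) : (x + t • (z - x)) 0 = 0 ∧ (x + t • (z - x)) 1 = 0 := by
    simp [x0, x1, z0, z1]
  have hD (t : ℝ) : x + t • (z - x) ∈ range (cornerModel m) :=
    mem_range_cornerModel.2 ⟨(hline t).1.ge, (hline t).2.ge⟩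
  have hT {t : ℝ} (ht : t ∈ Icc (0 : ℝ) 1) :
      x + t • (z - x) ∈ (φ.extend (cornerModel m)).target :=
    hεt ⟨(convex_ball x ε).add_smul_sub_mem (Metric.mem_ball_self hε) hqε ht, hD t⟩
  have hder {t : ℝ} (ht : t ∈ Icc (0 : ℝ) 1) :
      HasDerivWithinAt (fun t : ℝ => f' (x + t • (z - x))) 0 (Icc 0 1) t := by
    have hγ : HasDerivWithinAt (fun t : ℝ => x + t • (z - x)) (z - x) (Icc 0 1) t := by
      simpa using (((hasDerivAt_id t).smul_const (z - x)).const_add x).hasDerivWithinAt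
    have h1 := (hf'.differentiableWithinAt (hT ht)).hasFDerivWithinAt.comp_hasDerivWithinAt t hγ
      fun t _ => hD t
    have h2 : fderivWithin ℝ f' (range (cornerModel m)) (x + t • (z - x)) (z - x) = 0 := by
      rw [fderivWithin_apply_eq_sum]
      refine Finset.sum_eq_zero fun i _ => ?_
      rcases eq_or_ne i 0 with rfl | hi0
      · simp [x0, z0]
      rcases eq_or_ne i 1 with rfl | hi1
      · simp [x1, z1]
      rw [hd _ (hT ht) (hline t).1 (hline t).2 i hi0 hi1, mul_zero]
    rwa [h2] at h1
  have := constant_of_derivWithin_zero (fun t ht => (hder ht).differentiableWithinAt)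
    (fun t ht => (hder (Ico_subset_Icc_self ht)).derivWithin
      (uniqueDiffOn_Icc zero_lt_one t (Ico_subset_Icc_self ht))) 1 (by simp)
  simpa using this

/-! ### Euclidean embeddings -/

section Flat

variable {m : ℕ} {X : Type*} [TopologicalSpace X] [ChartedSpace (CornerSpace m) X]
  {φ : OpenPartialHomeomorph X (CornerSpace m)} {y : EuclideanSpace ℝ (Fin (m + 2))}
  {F : X → EuclideanSpace ℝ (Fin (m + 2))}

local notation "𝔻" => range (cornerModel m)

/-- The differential of a component of `F`. -/
noncomputable def componentDeriv (F : X → EuclideanSpace ℝ (Fin (m + 2))) (a : Fin (m + 2))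
    (p : X) : TangentSpace (cornerModel m) p →L[ℝ] ℝ :=
  mfderiv (cornerModel m) 𝓘(ℝ, ℝ) (fun p => F p a) p

/-- The pullback by `F` of the Euclidean metric, as the sum of the squares of the differentials of
the components of `F`. -/
noncomputable def pullbackField (F : X → EuclideanSpace ℝ (Fin (m + 2))) : BilinField m X :=
  fun p => ∑ a, (componentDeriv F a p).smulRight (componentDeriv F a p)

theorem pullbackField_apply (F : X → EuclideanSpace ℝ (Fin (m + 2))) (p : X)
    (u v : TangentSpace (cornerModel m) p) :
    pullbackField F p u v = ∑ a, componentDeriv F a p u * componentDeriv F a p v := by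
  rw [pullbackField, _root_.sum_apply, _root_.sum_apply]
  rfl

theorem contMDiff_component
    (hF : ContMDiff (cornerModel m) 𝓘(ℝ, EuclideanSpace ℝ (Fin (m + 2))) ∞ F) (a : Fin (m + 2)) :
    ContMDiff (cornerModel m) 𝓘(ℝ, ℝ) ∞ fun p => F p a :=
  (EuclideanSpace.proj (𝕜 := ℝ) a).contMDiff.comp hF

theorem componentDeriv_apply
    (hF : ContMDiff (cornerModel m) 𝓘(ℝ, EuclideanSpace ℝ (Fin (m + 2))) ∞ F) (a : Fin (m + 2))
    (p : X) (u : TangentSpace (cornerModel m) p) :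
    componentDeriv F a p u =
      EuclideanSpace.proj (𝕜 := ℝ) a
        (mfderiv (cornerModel m) 𝓘(ℝ, EuclideanSpace ℝ (Fin (m + 2))) F p u) := by
  have h1 := ((EuclideanSpace.proj (𝕜 := ℝ) a).hasMFDerivAt (x := F p)).comp p
    (hF.contMDiffAt.mdifferentiableAt (by simp)).hasMFDerivAt
  exact DFunLike.congr_fun h1.mfderiv u

theorem componentDeriv_coordVector
    (hF : ContMDiff (cornerModel m) 𝓘(ℝ, EuclideanSpace ℝ (Fin (m + 2))) ∞ F)
    (hφ : φ ∈ IsManifold.maximalAtlas (cornerModel m) ∞ X)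
    (hy : y ∈ (φ.extend (cornerModel m)).target) (a : Fin (m + 2))
    (v : EuclideanSpace ℝ (Fin (m + 2))) :
    componentDeriv F a _ (coordVector φ y v) =
      ∑ i, v i * partialDeriv 𝔻 i (fun y => F ((φ.extend (cornerModel m)).symm y) a) y := by
  rw [← fderivWithin_apply_eq_sum]
  exact mfderiv_coordVector hφ hy ((contMDiff_component hF a).contMDiffAt.mdifferentiableAt
    (by simp)) v

theorem components_pullbackField
    (hF : ContMDiff (cornerModel m) 𝓘(ℝ, EuclideanSpace ℝ (Fin (m + 2))) ∞ F)
    (hφ : φ ∈ IsManifold.maximalAtlas (cornerModel m) ∞ X)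
    (hy : y ∈ (φ.extend (cornerModel m)).target) (i j : Fin (m + 2)) :
    components φ (pullbackField F) y i j =
      ∑ a, partialDeriv 𝔻 i (fun y => F ((φ.extend (cornerModel m)).symm y) a) y *
        partialDeriv 𝔻 j (fun y => F ((φ.extend (cornerModel m)).symm y) a) y := by
  unfold components
  rw [pullbackField_apply]
  simp only [componentDeriv_coordVector hF hφ hy]
  simp

theorem smoothFn_component
    (hF : ContMDiff (cornerModel m) 𝓘(ℝ, EuclideanSpace ℝ (Fin (m + 2))) ∞ F)
    (hφ : φ ∈ IsManifold.maximalAtlas (cornerModel m) ∞ X) (a : Fin (m + 2)) :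
    SmoothFn 𝔻 (φ.extend (cornerModel m)).target
      fun y => F ((φ.extend (cornerModel m)).symm y) a := fun _ hy =>
  contDiffWithinAt_comp_symm hφ hy (contMDiff_component hF a).contMDiffAt

theorem smoothField_pullbackField
    (hF : ContMDiff (cornerModel m) 𝓘(ℝ, EuclideanSpace ℝ (Fin (m + 2))) ∞ F)
    (hi : ∀ p, Function.Injective
      (mfderiv (cornerModel m) 𝓘(ℝ, EuclideanSpace ℝ (Fin (m + 2))) F p)) :
    SmoothField (pullbackField F) where
  symm p u v := by
    simp only [pullbackField_apply, mul_comm]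
  pos p u hu := by
    rw [pullbackField_apply]
    refine (Finset.sum_nonneg fun a _ => mul_self_nonneg _).lt_of_ne fun h0 => hu (hi p ?_)
    rw [map_zero]
    refine PiLp.ext fun a => ?_
    have := (Finset.sum_eq_zero_iff_of_nonneg fun a _ => mul_self_nonneg _).1 h0.symm a
      (Finset.mem_univ a)
    rw [mul_self_eq_zero, componentDeriv_apply hF] at this
    exact this
  smooth φ hφ i j := by
    have hp (a i : Fin (m + 2)) := (smoothFn_component hF hφ a).partialDeriv
      (chartDomain_target φ) i
    exact (SmoothFn.sum fun a _ => (hp a i).mul (hp a j)).congr (chartDomain_target φ)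
      fun y hy => components_pullbackField hF hφ hy i j

theorem flatCoords_pullbackField
    (hF : ContMDiff (cornerModel m) 𝓘(ℝ, EuclideanSpace ℝ (Fin (m + 2))) ∞ F)
    (hi : ∀ p, Function.Injective
      (mfderiv (cornerModel m) 𝓘(ℝ, EuclideanSpace ℝ (Fin (m + 2))) F p))
    (hφ : φ ∈ IsManifold.maximalAtlas (cornerModel m) ∞ X) :
    FlatCoords 𝔻 (φ.extend (cornerModel m)).target (components φ (pullbackField F))
      fun a y => F ((φ.extend (cornerModel m)).symm y) a where
  metric := (smoothField_pullbackField hF hi).coordMetric hφ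
  smooth := smoothFn_component hF hφ
  eq _ hy := components_pullbackField hF hφ hy

/-- The first coordinate of the half-space model is a defining function of the face at infinity,
and compactifies the hyperbolic metric to the Euclidean one. -/
theorem cornerSetting_pullbackField [IsManifold (cornerModel m) ∞ X] {M Q : Set X}
    {g : BilinField m X} {lam : ℝ} (hX : IsCorneredSpace (m := m) M Q)
    (hQ : IsUmbilicFace M Q g lam)
    (hF : ContMDiff (cornerModel m) 𝓘(ℝ, EuclideanSpace ℝ (Fin (m + 2))) ∞ F)
    (hi : ∀ p, Function.Injective
      (mfderiv (cornerModel m) 𝓘(ℝ, EuclideanSpace ℝ (Fin (m + 2))) F p))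
    (h0 : ∀ p, 0 ≤ F p 0) (hM : ∀ p, F p 0 = 0 ↔ p ∈ M)
    (hg : ∀ p ∉ M, ∀ u v, g p u v = pullbackField F p u v / F p 0 ^ 2) :
    CornerSetting M Q g lam (fun p => F p 0) (pullbackField F) where
  cornered := hX
  defining :=
    { smooth := contMDiff_component hF 0
      nonneg := h0
      eq_zero_iff := hM
      mfderiv_ne_zero p _ hp0 := by
        let L : EuclideanSpace ℝ (Fin (m + 2)) →L[ℝ] EuclideanSpace ℝ (Fin (m + 2)) :=
          mfderiv (cornerModel m) 𝓘(ℝ, EuclideanSpace ℝ (Fin (m + 2))) F p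
        have hL : Function.Injective L.toLinearMap := hi p
        obtain ⟨u, hu⟩ := LinearMap.injective_iff_surjective.1 hL (EuclideanSpace.single 0 1)
        have h1 := componentDeriv_apply hF 0 p u
        have h2 : componentDeriv F 0 p u = 0 := DFunLike.congr_fun hp0 u
        rw [h2] at h1
        have h3 := congrArg (fun w : EuclideanSpace ℝ (Fin (m + 2)) => w 0) hu
        have h4 : (0 : ℝ) = 1 := h1.trans (h3.trans (by simp))
        exact zero_ne_one h4 }
  metric := smoothField_pullbackField hF hi
  conformal p hp u v := by
    have : F p 0 ≠ 0 := fun e => hp ((hM p).1 e)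
    rw [hg p hp]
    field_simp
  umbilic := hQ

end Flat

end CornerGeometry

namespace CornerGeometry

/-! ### The corner of a flat umbilic face -/

namespace CornerSetting

variable {m : ℕ} {X : Type*} [TopologicalSpace X] [ChartedSpace (CornerSpace m) X]
  [IsManifold (cornerModel m) ∞ X]
  {φ : OpenPartialHomeomorph X (CornerSpace m)} {y : EuclideanSpace ℝ (Fin (m + 2))}
  {M Q : Set X} {g : BilinField m X} {lam : ℝ} {r : X → ℝ}
  {F : X → EuclideanSpace ℝ (Fin (m + 2))} {p q : X}

local notation "𝔻" => range (cornerModel m)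

/-- The Cartesian components of the unit normal of `Q`, as functions on `X` which are meaningful on
`Q`; they are computed in some adapted chart. -/
noncomputable def normalComp (h : CornerSetting M Q g lam r (pullbackField F)) (a : Fin (m + 2))
    (p : X) : ℝ :=
  componentDeriv F a p (unitNormal (h.cornered.exists_chart p).choose (pullbackField F) p)

theorem normalComp_symm (h : CornerSetting M Q g lam r (pullbackField F))
    (hF : ContMDiff (cornerModel m) 𝓘(ℝ, EuclideanSpace ℝ (Fin (m + 2))) ∞ F)
    (hφ : IsAdaptedChart M Q φ) (hy : y ∈ (φ.extend (cornerModel m)).target) (hy1 : y 1 = 0)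
    (a : Fin (m + 2)) :
    h.normalComp a ((φ.extend (cornerModel m)).symm y) =
      flatNormal 𝔻 (components φ (pullbackField F))
        (fun a y => F ((φ.extend (cornerModel m)).symm y) a) 1 a y := by
  unfold normalComp
  rw [unitNormal_eq h.metric (h.cornered.exists_chart _).choose_spec.1 hφ
    (h.cornered.exists_chart _).choose_spec.2 (symm_mem_source hy) ((symm_mem_Q_iff hφ hy).2 hy1),
    unitNormal_symm hy, componentDeriv_coordVector hF hφ.mem_maximalAtlas hy]
  rfl

/-- The unit normal of `Q` is not orthogonal to the hyperplane at infinity, as the faces meet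
transversally. -/
theorem exists_normalComp_ne_zero (h : CornerSetting M Q g lam r (pullbackField F))
    (hF : ContMDiff (cornerModel m) 𝓘(ℝ, EuclideanSpace ℝ (Fin (m + 2))) ∞ F)
    (hi : ∀ p, Function.Injective
      (mfderiv (cornerModel m) 𝓘(ℝ, EuclideanSpace ℝ (Fin (m + 2))) F p))
    (hM : ∀ p, F p 0 = 0 ↔ p ∈ M) (hp : p ∈ M ∩ Q) : ∃ a, a ≠ 0 ∧ h.normalComp a p ≠ 0 := by
  obtain ⟨φ, hφ, hpφ⟩ := h.cornered.exists_chart p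
  obtain ⟨y, hy, rfl⟩ : ∃ y ∈ (φ.extend (cornerModel m)).target,
      (φ.extend (cornerModel m)).symm y = p :=
    ⟨_, (φ.extend _).map_source (by rwa [φ.extend_source]), φ.extend_left_inv hpφ⟩
  have hy0 := (symm_mem_M_iff hφ hy).1 hp.1
  have hy1 := (symm_mem_Q_iff hφ hy).1 hp.2
  have hfl := flatCoords_pullbackField hF hi hφ.mem_maximalAtlas
  by_contra! hN
  simp only [h.normalComp_symm hF hφ hy hy1] at hN
  have hsum (v : Fin (m + 2) → ℝ) : ∑ a, flatNormal 𝔻 (components φ (pullbackField F))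
      (fun a y => F ((φ.extend (cornerModel m)).symm y) a) 1 a y * v a =
      flatNormal 𝔻 (components φ (pullbackField F))
      (fun a y => F ((φ.extend (cornerModel m)).symm y) a) 1 0 y * v 0 :=
    Finset.sum_eq_single 0 (fun a _ ha => by rw [hN a ha, zero_mul]) (by simp)
  have h1 := hfl.sum_flatNormal_sq hy 1
  rw [hsum] at h1
  -- otherwise the differential of the height function vanishes
  have h2 (j : Fin (m + 2)) :
      partialDeriv 𝔻 j (fun y => F ((φ.extend (cornerModel m)).symm y) 0) y = 0 := by
    rcases eq_or_ne j 1 with rfl | hj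
    · exact partialDeriv_eq_zero_face rayStable_range_cornerModel (chartDomain_target φ) hy
        (smoothFn_component hF hφ.mem_maximalAtlas 0) hy0 (by simp)
        fun z hz hz0 => (hM _).2 ((symm_mem_M_iff hφ hz).2 hz0)
    · have h3 := hfl.sum_flatNormal_mul_partialDeriv hy 1 j
      rw [if_neg hj, hsum] at h3
      exact (mul_eq_zero.1 h3).resolve_left fun e => by
        rw [e, zero_mul] at h1
        exact zero_ne_one h1
  have h4 := hfl.eq_zero_of_sum_eq_zero hy (w := Pi.single 0 1) fun j => by
    rw [Finset.sum_eq_single 0 (fun a _ ha => by simp [ha]) (by simp), h2, mul_zero]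
  simpa using congrFun h4 0

/-- The curvature, the center and the constant term of the equation of a sphere or hyperplane
containing the corner are locally constant on the corner. -/
theorem eventually_eq_sphere (h : CornerSetting M Q g lam r (pullbackField F))
    (hF : ContMDiff (cornerModel m) 𝓘(ℝ, EuclideanSpace ℝ (Fin (m + 2))) ∞ F)
    (hi : ∀ p, Function.Injective
      (mfderiv (cornerModel m) 𝓘(ℝ, EuclideanSpace ℝ (Fin (m + 2))) F p))
    (hp : p ∈ M ∩ Q) : ∀ᶠ q in 𝓝[M ∩ Q] p, h.cornerCurvature q = h.cornerCurvature p ∧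
      (∀ a, h.normalComp a q + h.cornerCurvature q * F q a =
        h.normalComp a p + h.cornerCurvature p * F p a) ∧
      ∑ a, (2 * h.normalComp a q + h.cornerCurvature q * F q a) * F q a =
        ∑ a, (2 * h.normalComp a p + h.cornerCurvature p * F p a) * F p a := by
  obtain ⟨φ, hφ, hpφ⟩ := h.cornered.exists_chart p
  have hs := rayStable_range_cornerModel (m := m)
  have hfl := flatCoords_pullbackField hF hi hφ.mem_maximalAtlas
  have hη := (h.cornerCoords hφ).smooth_faceCurvature
  have hK : ∀ y ∈ (φ.extend (cornerModel m)).target, y 1 = 0 → ∀ i j, i ≠ 1 → j ≠ 1 →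
      christoffel 𝔻 (components φ (pullbackField F)) 1 i j y =
        √((components φ (pullbackField F) y)⁻¹ 1 1) *
          faceCurvature (components φ (pullbackField F)) y *
            components φ (pullbackField F) y i j := fun y hy hy1 i j hi hj =>
    (h.cornerCoords hφ).christoffel_eq_faceCurvature (h.umbilic_coords hφ) hy hy1 hi hj
  have hN (a) := hfl.smooth_flatNormal 1 a
  have hΦ := hfl.smooth
  refine (eventually_eq_of_partialDeriv_eq_zero hφ hpφ hp hη
    (fun y hy _ hy1 => h.cornerCurvature_symm hφ hy hy1)
    fun y hy _ hy1 i hi0 hi1 => hfl.partialDeriv_curvature_eq_zero hs hη hK hy hy1 hi1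
      (j := 0) (by simp) hi0).and ((eventually_all.2 fun a => ?_).and ?_)
  · exact eventually_eq_of_partialDeriv_eq_zero hφ hpφ hp
      (f := fun q => h.normalComp a q + h.cornerCurvature q * F q a)
      ((hN a).add (hη.mul (hΦ a)))
      (fun y hy _ hy1 => by rw [h.cornerCurvature_symm hφ hy hy1, h.normalComp_symm hF hφ hy hy1])
      fun y hy _ hy1 i hi0 hi1 => hfl.partialDeriv_center_eq_zero hs hη hK hy hy1 hi1
        (j := 0) (by simp) hi0 a
  · exact eventually_eq_of_partialDeriv_eq_zero hφ hpφ hp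
      (f := fun q => ∑ a, (2 * h.normalComp a q + h.cornerCurvature q * F q a) * F q a)
      (SmoothFn.sum fun a _ => (((SmoothFn.const 2).mul (hN a)).add (hη.mul (hΦ a))).mul (hΦ a))
      (fun y hy _ hy1 => by
        simp only [h.cornerCurvature_symm hφ hy hy1, h.normalComp_symm hF hφ hy hy1])
      fun y hy _ hy1 i hi0 hi1 => hfl.partialDeriv_power_eq_zero hs hη hK hy hy1 hi1
        (j := 0) (by simp) hi0

/-- A connected component of the corner lies in a sphere or a hyperplane. -/
theorem sphere_equation (h : CornerSetting M Q g lam r (pullbackField F))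
    (hF : ContMDiff (cornerModel m) 𝓘(ℝ, EuclideanSpace ℝ (Fin (m + 2))) ∞ F)
    (hi : ∀ p, Function.Injective
      (mfderiv (cornerModel m) 𝓘(ℝ, EuclideanSpace ℝ (Fin (m + 2))) F p))
    (hp : p ∈ M ∩ Q) (hq : q ∈ connectedComponentIn (M ∩ Q) p) :
    h.cornerCurvature p * ∑ a, F q a ^ 2
      - 2 * ∑ a, (h.normalComp a p + h.cornerCurvature p * F p a) * F q a
      + ∑ a, (2 * h.normalComp a p + h.cornerCurvature p * F p a) * F p a = 0 := by
  have hsub := connectedComponentIn_subset (M ∩ Q) p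
  obtain ⟨h1, h2, h3⟩ := isPreconnected_connectedComponentIn.induction₂ (x := p) (y := q)
    (fun p q => h.cornerCurvature q = h.cornerCurvature p ∧
      (∀ a, h.normalComp a q + h.cornerCurvature q * F q a =
        h.normalComp a p + h.cornerCurvature p * F p a) ∧
      ∑ a, (2 * h.normalComp a q + h.cornerCurvature q * F q a) * F q a =
        ∑ a, (2 * h.normalComp a p + h.cornerCurvature p * F p a) * F p a)
    (fun x hx => (h.eventually_eq_sphere hF hi (hsub hx)).filter_mono (nhdsWithin_mono _ hsub))
    (fun x y z _ _ _ hxy hyz => ⟨hyz.1.trans hxy.1, fun a => (hyz.2.1 a).trans (hxy.2.1 a),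
      hyz.2.2.trans hxy.2.2⟩)
    (fun x y _ _ hxy => ⟨hxy.1.symm, fun a => (hxy.2.1 a).symm, hxy.2.2.symm⟩)
    (mem_connectedComponentIn hp) hq
  rw [← h3, ← h1]
  simp only [← h1] at h2
  simp only [← h2, Finset.mul_sum]
  rw [← Finset.sum_sub_distrib, ← Finset.sum_add_distrib]
  exact Finset.sum_eq_zero fun a _ => by ring

end CornerSetting

/-- Through every point of the corner there is a regular curve in its connected component. -/
theorem exists_curve {m : ℕ} (hm : 1 ≤ m) {X : Type*} [TopologicalSpace X]
    [ChartedSpace (CornerSpace m) X]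
    {φ : OpenPartialHomeomorph X (CornerSpace m)}
    {V : Type*} [NormedAddCommGroup V] [NormedSpace ℝ V] {M Q : Set X} {F : X → V} {p : X}
    (hF : ContMDiff (cornerModel m) 𝓘(ℝ, V) ∞ F)
    (hi : ∀ p, Function.Injective (mfderiv (cornerModel m) 𝓘(ℝ, V) F p))
    (hφ : IsAdaptedChart M Q φ) (hp : p ∈ φ.source) (hpS : p ∈ M ∩ Q) :
    ∃ (γ : ℝ → V) (v : V), γ 0 = F p ∧ HasStrictDerivAt γ v 0 ∧ v ≠ 0 ∧
      ∀ᶠ t in 𝓝 (0 : ℝ), γ t ∈ F '' connectedComponentIn (M ∩ Q) p := by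
  obtain ⟨y, hy, rfl⟩ : ∃ y ∈ (φ.extend (cornerModel m)).target,
      (φ.extend (cornerModel m)).symm y = p :=
    ⟨_, (φ.extend _).map_source (by rwa [φ.extend_source]), φ.extend_left_inv hp⟩
  have hy0 := (symm_mem_M_iff hφ hy).1 hpS.1
  have hy1 := (symm_mem_Q_iff hφ hy).1 hpS.2
  set E : EuclideanSpace ℝ (Fin (m + 2)) := EuclideanSpace.single ⟨2, by omega⟩ 1 with hE
  have hE0 : E 0 = 0 := by simp [hE, Fin.ext_iff]
  have hE1 : E 1 = 0 := by simp [hE, Fin.ext_iff]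
  have hline (t : ℝ) : (y + t • E) 0 = 0 ∧ (y + t • E) 1 = 0 := by
    simp [hy0, hy1, hE0, hE1]
  have hD (t : ℝ) : y + t • E ∈ range (cornerModel m) :=
    mem_range_cornerModel.2 ⟨(hline t).1.ge, (hline t).2.ge⟩
  have hl : ContDiff ℝ ∞ fun t : ℝ => y + t • E := by fun_prop
  have hl' : HasDerivAt (fun t : ℝ => y + t • E) E 0 := by
    simpa using ((hasDerivAt_id (0 : ℝ)).smul_const E).const_add y
  have h1 := contDiffWithinAt_comp_symm hφ.mem_maximalAtlas hy hF.contMDiffAt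
  refine ⟨fun t => F ((φ.extend (cornerModel m)).symm (y + t • E)),
    fderivWithin ℝ (fun y => F ((φ.extend (cornerModel m)).symm y))
      (range (cornerModel m)) y E, by simp, ?_, ?_, ?_⟩
  · have h2 : ContDiffAt ℝ ∞
        (fun t : ℝ => F ((φ.extend (cornerModel m)).symm (y + t • E))) 0 := by
      refine contDiffWithinAt_univ.1 ?_
      refine ContDiffWithinAt.comp (0 : ℝ) (t := range (cornerModel m))
        (g := fun y => F ((φ.extend (cornerModel m)).symm y)) (by simpa using h1)
        hl.contDiffAt.contDiffWithinAt fun t _ => hD t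
    refine h2.hasStrictDerivAt' ?_ (by simp)
    refine hasDerivWithinAt_univ.1 ?_
    exact HasFDerivWithinAt.comp_hasDerivWithinAt_of_eq (0 : ℝ)
      (h1.differentiableWithinAt (by simp)).hasFDerivWithinAt hl'.hasDerivWithinAt
      (fun t _ => hD t) (by simp)
  · rw [← mfderiv_coordVector hφ.mem_maximalAtlas hy (hF.contMDiffAt.mdifferentiableAt (by simp))]
    intro h0
    have h2 := coordVector_injective hφ.mem_maximalAtlas hy (hi _ (h0.trans (map_zero _).symm))
    simp [hE] at h2
  · have hc : Tendsto (fun t : ℝ => y + t • E) (𝓝 0) (𝓝[range (cornerModel m)] y) :=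
      tendsto_nhdsWithin_iff.2 ⟨by simpa using hl'.continuousAt.tendsto,
        Eventually.of_forall hD⟩
    obtain ⟨ε, hε, hεt⟩ := Metric.eventually_nhds_iff_ball.1
      (hc (extend_target_mem_nhdsWithin_of_mem hy))
    filter_upwards [Metric.ball_mem_nhds _ hε] with t ht
    refine ⟨_, ?_, rfl⟩
    have hpre : IsPreconnected ((fun t : ℝ => (φ.extend (cornerModel m)).symm (y + t • E)) ''
        Metric.ball 0 ε) :=
      (convex_ball (0 : ℝ) ε).isPreconnected.image _
        (φ.continuousOn_extend_symm.comp hl.continuous.continuousOn fun t ht => hεt t ht)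
    refine hpre.subset_connectedComponentIn ⟨0, Metric.mem_ball_self hε, by simp⟩ ?_
      ⟨t, ht, rfl⟩
    rintro _ ⟨t, ht, rfl⟩
    exact ⟨(symm_mem_M_iff hφ (hεt t ht)).2 (hline t).1,
      (symm_mem_Q_iff hφ (hεt t ht)).2 (hline t).2⟩

end CornerGeometry

namespace CornerGeometry

/-! ### Circles and lines in the plane `{x_0 = 0}` -/

/-- The generalized circle `η |x|² - 2 ⟨c, x⟩ + e = 0` in the plane `{x_0 = 0}`. -/
def generalizedCircle (η c₁ c₂ e : ℝ) : Set (EuclideanSpace ℝ (Fin 3)) :=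
  {x | x 0 = 0 ∧ η * (x 1 ^ 2 + x 2 ^ 2) - 2 * (c₁ * x 1 + c₂ * x 2) + e = 0}

variable {η c₁ c₂ e : ℝ}

/-- The hypothesis says that the radius is positive if `η ≠ 0`, and that the equation is not trivial
if `η = 0`. -/
theorem generalizedCircle_isPlanar (hκ : 0 < c₁ ^ 2 + c₂ ^ 2 - η * e) :
    IsPlanarCircle (generalizedCircle η c₁ c₂ e) ∨ IsPlanarLine (generalizedCircle η c₁ c₂ e) := by
  rcases eq_or_ne η 0 with rfl | hη
  · right
    have hκ' : 0 < c₁ ^ 2 + c₂ ^ 2 := by linarith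
    set κ := c₁ ^ 2 + c₂ ^ 2 with hκd
    refine ⟨!₂[0, e * c₁ / (2 * κ), e * c₂ / (2 * κ)], !₂[0, -c₂, c₁], by simp, by simp, ?_, ?_⟩
    · intro h0
      have h1 := congrArg (fun w : EuclideanSpace ℝ (Fin 3) => w 1) h0
      have h2 := congrArg (fun w : EuclideanSpace ℝ (Fin 3) => w 2) h0
      simp at h1 h2
      simp [hκd, h1, h2] at hκ'
    · ext x
      constructor
      · rintro ⟨h0, h1⟩
        refine ⟨(c₁ * x 2 - c₂ * x 1) / κ, ?_⟩
        have h1' : c₁ * x 1 + c₂ * x 2 = e / 2 := by linarith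
        ext i
        fin_cases i
        · simp [h0]
        · simp
          field_simp
          rw [hκd]
          linear_combination (-2 * c₁) * h1'
        · simp
          field_simp
          rw [hκd]
          linear_combination (-2 * c₂) * h1'
      · rintro ⟨t, rfl⟩
        constructor
        · simp
        · simp
          field_simp
          rw [hκd]
          ring
  · left
    refine ⟨!₂[0, c₁ / η, c₂ / η], √(c₁ ^ 2 + c₂ ^ 2 - η * e) / |η|, by simp,
      div_pos (Real.sqrt_pos.2 hκ) (abs_pos.2 hη), ?_⟩
    ext x
    refine and_congr_right fun h0 => ?_
    rw [EuclideanSpace.dist_eq, ← Real.sqrt_sq_eq_abs, ← Real.sqrt_div hκ.le,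
      Real.sqrt_inj (by positivity) (by positivity), Fin.sum_univ_three]
    simp [h0, Real.dist_eq, sq_abs]
    field_simp
    constructor <;> intro h
    · linear_combination η * h
    · refine mul_left_cancel₀ hη ?_
      linear_combination h

theorem isPreconnected_of_isPlanarLine {C : Set (EuclideanSpace ℝ (Fin 3))} (h : IsPlanarLine C) :
    IsPreconnected C := by
  obtain ⟨c, d, -, -, -, rfl⟩ := h
  exact isPreconnected_range (by fun_prop)

theorem isPreconnected_of_isPlanarCircle {C : Set (EuclideanSpace ℝ (Fin 3))}
    (h : IsPlanarCircle C) : IsPreconnected C := by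
  obtain ⟨c, ρ, hc, hρ, rfl⟩ := h
  have e : {x : EuclideanSpace ℝ (Fin 3) | x 0 = 0 ∧ dist x c = ρ} =
      range fun t : ℝ => !₂[0, c 1 + ρ * Real.cos t, c 2 + ρ * Real.sin t] := by
    ext x
    have hd : dist x c = ρ ↔ (x 0 - c 0) ^ 2 + (x 1 - c 1) ^ 2 + (x 2 - c 2) ^ 2 = ρ ^ 2 := by
      rw [EuclideanSpace.dist_eq, Real.sqrt_eq_iff_eq_sq (by positivity) hρ.le,
        Fin.sum_univ_three]
      simp [Real.dist_eq, sq_abs]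
    constructor
    · rintro ⟨h0, h1⟩
      rw [hd, h0, hc] at h1
      set z : ℂ := ⟨x 1 - c 1, x 2 - c 2⟩ with hz
      have hn : ‖z‖ = ρ := by
        rw [Complex.norm_def, Real.sqrt_eq_iff_eq_sq (Complex.normSq_nonneg z) hρ.le,
          Complex.normSq_apply]
        linear_combination h1
      have hz0 : z ≠ 0 := by rw [← norm_ne_zero_iff, hn]; exact hρ.ne'
      refine ⟨Complex.arg z, ?_⟩
      beta_reduce
      rw [Complex.cos_arg hz0, Complex.sin_arg, hn, mul_div_cancel₀ _ hρ.ne',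
        mul_div_cancel₀ _ hρ.ne']
      ext i
      fin_cases i <;> simp [h0, hz]
    · rintro ⟨t, rfl⟩
      refine ⟨by simp, hd.2 ?_⟩
      simp [hc]
      linear_combination ρ ^ 2 * Real.cos_sq_add_sin_sq t
  rw [e]
  refine isPreconnected_range ?_
  fun_prop

/-- A subset of a generalized circle which contains a regular curve through the point `q` is a
neighborhood of `q` in the generalized circle. -/
theorem mem_nhdsWithin_generalizedCircle (hκ : 0 < c₁ ^ 2 + c₂ ^ 2 - η * e)
    {A : Set (EuclideanSpace ℝ (Fin 3))} (hA : A ⊆ generalizedCircle η c₁ c₂ e)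
    {γ : ℝ → EuclideanSpace ℝ (Fin 3)} {v : EuclideanSpace ℝ (Fin 3)}
    (hγ : HasStrictDerivAt γ v 0) (hv : v ≠ 0) (hγA : ∀ᶠ t in 𝓝 (0 : ℝ), γ t ∈ A) :
    A ∈ 𝓝[generalizedCircle η c₁ c₂ e] (γ 0) := by
  set q := γ 0 with hq
  have hqA : q ∈ A := hγA.self_of_nhds
  obtain ⟨hq0, hqe⟩ := hA hqA
  have hγi (i : Fin 3) : HasStrictDerivAt (fun t => γ t i) (v i) 0 :=
    (EuclideanSpace.proj (𝕜 := ℝ) i).hasStrictFDerivAt.comp_hasStrictDerivAt 0 hγ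
  -- the normal vector `n` of the generalized circle at `q`
  set n₁ := c₁ - η * q 1 with hn₁
  set n₂ := c₂ - η * q 2 with hn₂
  have hn : n₁ ^ 2 + n₂ ^ 2 = c₁ ^ 2 + c₂ ^ 2 - η * e := by
    rw [hn₁, hn₂]; linear_combination η * hqe
  have hn0 : 0 < n₁ ^ 2 + n₂ ^ 2 := hn ▸ hκ
  have hv0 : v 0 = 0 := by
    refine (hγi 0).hasDerivAt.unique ((hasDerivAt_const (0 : ℝ) (0 : ℝ)).congr_of_eventuallyEq ?_)
    filter_upwards [hγA] with t ht using (hA ht).1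
  have hvn : n₁ * v 1 + n₂ * v 2 = 0 := by
    have h1 := (((((hγi 1).hasDerivAt.pow 2).add ((hγi 2).hasDerivAt.pow 2)).const_mul η).sub
      ((((hγi 1).hasDerivAt.const_mul c₁).add ((hγi 2).hasDerivAt.const_mul c₂)).const_mul
        2)).add_const e
    have h2 := h1.unique ((hasDerivAt_const (0 : ℝ) (0 : ℝ)).congr_of_eventuallyEq (by
      filter_upwards [hγA] with t ht using (hA ht).2))
    simp only [← hq] at h2
    rw [hn₁, hn₂]
    norm_num at h2
    linear_combination (-1 / 2) * h2
  -- the coordinate along the tangent line at `q`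
  set σ : EuclideanSpace ℝ (Fin 3) → ℝ := fun x => n₁ * x 2 - n₂ * x 1 with hσ
  have hσc : Continuous σ := by fun_prop
  have hσv : n₁ * v 2 - n₂ * v 1 ≠ 0 := by
    intro h0
    apply hv
    have e1 : (n₁ ^ 2 + n₂ ^ 2) * v 1 = 0 := by linear_combination n₁ * hvn - n₂ * h0
    have e2 : (n₁ ^ 2 + n₂ ^ 2) * v 2 = 0 := by linear_combination n₂ * hvn + n₁ * h0
    ext i
    fin_cases i
    · exact hv0
    · exact (mul_eq_zero.1 e1).resolve_left hn0.ne'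
    · exact (mul_eq_zero.1 e2).resolve_left hn0.ne'
  have hmap := (((hγi 2).const_mul n₁).sub ((hγi 1).const_mul n₂)).map_nhds_eq hσv
  -- the neighborhood of `q` on which `σ` is injective along the generalized circle
  set W : Set (EuclideanSpace ℝ (Fin 3)) :=
    {x | 0 < n₁ * (c₁ - η * x 1) + n₂ * (c₂ - η * x 2)} with hW
  have hWo : IsOpen W := isOpen_lt continuous_const (by fun_prop)
  have hqW : q ∈ W := by
    change 0 < n₁ * n₁ + n₂ * n₂
    linarith [sq n₁, sq n₂]
  have hinj {x x' : EuclideanSpace ℝ (Fin 3)} (hx : x ∈ generalizedCircle η c₁ c₂ e) (hxW : x ∈ W)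
      (hx' : x' ∈ generalizedCircle η c₁ c₂ e) (hxW' : x' ∈ W) (hs : σ x = σ x') : x = x' := by
    have hs' : n₁ * (x 2 - x' 2) - n₂ * (x 1 - x' 1) = 0 := by
      have : n₁ * x 2 - n₂ * x 1 = n₁ * x' 2 - n₂ * x' 1 := hs
      linarith
    have h1 : (c₁ - η * x 1 + (c₁ - η * x' 1)) * (x 1 - x' 1) +
        (c₂ - η * x 2 + (c₂ - η * x' 2)) * (x 2 - x' 2) = 0 := by
      linear_combination hx'.2 - hx.2
    have h2 : (n₁ * (x 1 - x' 1) + n₂ * (x 2 - x' 2)) *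
        ((n₁ * (c₁ - η * x 1) + n₂ * (c₂ - η * x 2)) +
          (n₁ * (c₁ - η * x' 1) + n₂ * (c₂ - η * x' 2))) = 0 := by
      linear_combination (n₁ ^ 2 + n₂ ^ 2) * h1 -
        (n₁ * (c₂ - η * x 2 + (c₂ - η * x' 2)) - n₂ * (c₁ - η * x 1 + (c₁ - η * x' 1))) * hs'
    have h3 := (mul_eq_zero.1 h2).resolve_right (add_pos hxW hxW').ne'
    have e1 : (n₁ ^ 2 + n₂ ^ 2) * (x 1 - x' 1) = 0 := by linear_combination n₁ * h3 - n₂ * hs'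
    have e2 : (n₁ ^ 2 + n₂ ^ 2) * (x 2 - x' 2) = 0 := by linear_combination n₂ * h3 + n₁ * hs'
    ext i
    fin_cases i
    · exact hx.1.trans hx'.1.symm
    · exact sub_eq_zero.1 ((mul_eq_zero.1 e1).resolve_left hn0.ne')
    · exact sub_eq_zero.1 ((mul_eq_zero.1 e2).resolve_left hn0.ne')
  have hT : {t | γ t ∈ A ∧ γ t ∈ W} ∈ 𝓝 (0 : ℝ) :=
    inter_mem hγA (hγ.hasDerivAt.continuousAt.preimage_mem_nhds (hWo.mem_nhds hqW))
  have himg : (fun t => σ (γ t)) '' {t | γ t ∈ A ∧ γ t ∈ W} ∈ 𝓝 (σ q) := by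
    have := image_mem_map (m := fun t => σ (γ t)) hT
    rwa [show map (fun t => σ (γ t)) (𝓝 0) = 𝓝 (σ q) from hmap] at this
  filter_upwards [mem_nhdsWithin_of_mem_nhds (hσc.continuousAt.preimage_mem_nhds himg),
    mem_nhdsWithin_of_mem_nhds (hWo.mem_nhds hqW), self_mem_nhdsWithin] with x hx hxW hxC
  obtain ⟨t, ⟨htA, htW⟩, ht⟩ := hx
  rw [← hinj (hA htA) htW hxC hxW ht]
  exact htA

/-- A nonempty closed subset of a preconnected set `C` which is relatively open in `C` is all of
`C`. -/
theorem eq_of_isPreconnected_of_isClosed {α : Type*} [TopologicalSpace α] {A C : Set α}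
    (hC : IsPreconnected C) (hAC : A ⊆ C) (hA : IsClosed A) (hne : A.Nonempty)
    (hn : ∀ q ∈ A, A ∈ 𝓝[C] q) : A = C := by
  refine hAC.antisymm ?_
  by_contra hsub
  obtain ⟨x, hxC, hxA⟩ := not_subset.1 hsub
  have hu : A ⊆ interior (A ∪ Cᶜ) := fun q hq => mem_interior_iff_mem_nhds.2 <| by
    have := mem_nhdsWithin_iff_eventually.1 (hn q hq)
    filter_upwards [this] with z hz
    by_cases hzC : z ∈ C
    exacts [Or.inl (hz hzC), Or.inr hzC]
  obtain ⟨q, hq⟩ := hne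
  obtain ⟨z, hzC, hzu, hzA⟩ := hC _ _ isOpen_interior hA.isOpen_compl
    (fun z _ => (em (z ∈ A)).imp (fun h => hu h) id) ⟨q, hAC hq, hu hq⟩ ⟨x, hxC, hxA⟩
  exact (interior_subset hzu).elim hzA fun h => h hzC

/-- The image under an embedding of a connected component of a set with closed image is closed. -/
theorem isClosed_image_connectedComponentIn {α β : Type*} [TopologicalSpace α] [TopologicalSpace β]
    {F : α → β} (hF : IsEmbedding F) {S : Set α} (hS : IsClosed (F '' S)) {p : α} (hp : p ∈ S) :
    IsClosed (F '' connectedComponentIn S p) := by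
  refine isClosed_of_closure_subset fun x hx => ?_
  obtain ⟨s, hs, rfl⟩ := hS.closure_subset_iff.2 (image_mono (connectedComponentIn_subset S p)) hx
  have hsc : s ∈ closure (connectedComponentIn S p) := by
    rwa [hF.isInducing.closure_eq_preimage_closure_image]
  have hpre : IsPreconnected (insert s (connectedComponentIn S p)) :=
    isPreconnected_connectedComponentIn.subset_closure (subset_insert _ _)
      (insert_subset hsc subset_closure)
  exact ⟨s, hpre.subset_connectedComponentIn (mem_insert_of_mem _ (mem_connectedComponentIn hp))
    (insert_subset hs (connectedComponentIn_subset S p)) (mem_insert _ _), rfl⟩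

/-- Each component of the corner is open and closed in a circle or a line, by the equation which the
component satisfies, the regular curves in it, and the closedness of the corner. -/
theorem isPlanar_image_connectedComponentIn {X : Type*} [TopologicalSpace X]
    [ChartedSpace (CornerSpace 1) X] [IsManifold (cornerModel 1) ∞ X] {M Q : Set X}
    (hX : IsCorneredSpace (m := 1) M Q) {g : BilinField 1 X} {lam : ℝ}
    (hQ : IsUmbilicFace M Q g lam) {F : X → EuclideanSpace ℝ (Fin 3)}
    (hF : IsHyperbolicEmbedding M g F) (hS : IsClosed (F '' (M ∩ Q))) {p : X} (hp : p ∈ M ∩ Q) :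
    IsPlanarCircle (F '' connectedComponentIn (M ∩ Q) p) ∨
      IsPlanarLine (F '' connectedComponentIn (M ∩ Q) p) := by
  have h := cornerSetting_pullbackField hX hQ hF.smooth hF.immersion hF.nonneg hF.eq_zero_iff
    fun p hp u v => by
      have key (a b : EuclideanSpace ℝ (Fin 3)) : inner ℝ a b = ∑ i, a i * b i := by
        rw [PiLp.inner_apply]
        exact Finset.sum_congr rfl fun i _ => mul_comm _ _
      rw [hF.metric_eq p hp, pullbackField_apply]
      refine congrArg (· / F p 0 ^ 2) ((key _ _).trans (Finset.sum_congr rfl fun a _ => ?_))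
      rw [componentDeriv_apply hF.smooth, componentDeriv_apply hF.smooth]
      rfl
  set η := h.cornerCurvature p with hη
  set N := fun a => h.normalComp a p with hN
  have hp0 : F p 0 = 0 := (hF.eq_zero_iff p).2 hp.1
  set c₁ := N 1 + η * F p 1 with hc₁
  set c₂ := N 2 + η * F p 2 with hc₂
  set e := (2 * N 1 + η * F p 1) * F p 1 + (2 * N 2 + η * F p 2) * F p 2 with he
  -- this quantity is `|N|²` minus the square of the vertical component of `N`
  have hκ : 0 < c₁ ^ 2 + c₂ ^ 2 - η * e := by
    have e1 : c₁ ^ 2 + c₂ ^ 2 - η * e = N 1 ^ 2 + N 2 ^ 2 := by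
      rw [hc₁, hc₂, he]; ring
    obtain ⟨a, ha0, ha⟩ := h.exists_normalComp_ne_zero hF.smooth hF.immersion hF.eq_zero_iff hp
    rw [e1]
    fin_cases a
    · exact absurd rfl ha0
    · have : 0 < N 1 ^ 2 := by have : N 1 ≠ 0 := ha; positivity
      positivity
    · have : 0 < N 2 ^ 2 := by have : N 2 ≠ 0 := ha; positivity
      positivity
  have hsub : F '' connectedComponentIn (M ∩ Q) p ⊆ generalizedCircle η c₁ c₂ e := by
    rintro _ ⟨q, hq, rfl⟩
    have hq0 : F q 0 = 0 := (hF.eq_zero_iff q).2 (connectedComponentIn_subset _ _ hq).1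
    refine ⟨hq0, ?_⟩
    have h1 := h.sphere_equation hF.smooth hF.immersion hp hq
    have h2 (f : Fin (1 + 2) → ℝ) : ∑ a, f a = f 0 + f 1 + f 2 := Fin.sum_univ_three f
    simp only [h2, hq0, hp0] at h1
    rw [hc₁, hc₂, he]
    linear_combination h1
  have hC := generalizedCircle_isPlanar hκ
  have heq : F '' connectedComponentIn (M ∩ Q) p = generalizedCircle η c₁ c₂ e := by
    refine eq_of_isPreconnected_of_isClosed
      (hC.elim isPreconnected_of_isPlanarCircle isPreconnected_of_isPlanarLine) hsub
      (isClosed_image_connectedComponentIn hF.isEmbedding hS hp)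
      ⟨_, p, mem_connectedComponentIn hp, rfl⟩ ?_
    rintro _ ⟨q, hq, rfl⟩
    obtain ⟨φ, hφ, hqφ⟩ := hX.exists_chart q
    obtain ⟨γ, v, hγ0, hγ, hv, hγA⟩ := exists_curve le_rfl hF.smooth hF.immersion hφ hqφ
      (connectedComponentIn_subset _ _ hq)
    rw [← hγ0]
    rw [← connectedComponentIn_eq hq] at hγA
    exact mem_nhdsWithin_generalizedCircle hκ hsub hγ hv hγA
  rwa [heq]

end CornerGeometry

theorem mainTheorem9 {m : ℕ} (hm : 1 ≤ m) {X : Type*} [TopologicalSpace X] [T2Space X]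
    [SecondCountableTopology X] [ChartedSpace (CornerSpace m) X]
    [IsManifold (cornerModel m) ∞ X] (M Q : Set X) (hX : IsCorneredSpace (m := m) M Q)
    (g : BilinField m X) (hg : IsCAHMetric M g) (hE : IsEinstein M g)
    (lam : ℝ) (hQ : IsUmbilicFace M Q g lam) :
    (∀ (r : X → ℝ) (gbar : SmoothMetric m X), IsGeodesicCompactification M g r gbar →
      ∃ η : X → ℝ, ContMDiffOn (cornerModel m) 𝓘(ℝ, ℝ) ∞ η (M ∩ Q) ∧
        IsUmbilicCornerWith M Q gbar.inner η ∧ SatisfiesCornerEquation M Q gbar.inner η) ∧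
    (m = 1 → ∀ F : X → EuclideanSpace ℝ (Fin 3), IsHyperbolicEmbedding M g F →
      IsClosed (F '' (M ∩ Q)) → ∀ p ∈ M ∩ Q,
        IsPlanarCircle (F '' connectedComponentIn (M ∩ Q) p) ∨
          IsPlanarLine (F '' connectedComponentIn (M ∩ Q) p)) := by
  constructor
  · intro r gbar hgeo
    have h : CornerGeometry.CornerSetting M Q g lam r gbar.inner :=
      ⟨hX, hgeo.defining, CornerGeometry.smoothField_of_smoothMetric gbar,
        hgeo.compactification, hQ⟩
    exact ⟨fun p => h.cornerCurvature p / √(1 - lam ^ 2),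
      h.contMDiffOn_cornerCurvature.div_const _, h.umbilic_and_equation hm hgeo.unitGradient hE⟩
  · rintro rfl F hF hS p hp
    exact CornerGeometry.isPlanar_image_connectedComponentIn hX hQ hF hS hp
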